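/- **Setting.** Let $\Delta$ be the toppling matrix of the isotropic critical Abelian sandpile on $\mathbb Z^2$: $\Delta_{ii}=4$, $\Delta_{ij}=-1$ for nearest neighbours, $0$ otherwise. Let $$G_0(x,y)=\frac1{(2\pi)^2}\int_{-\pi}^{\pi}\!\int_{-\pi}^{\pi}\frac{\cos(px+qy)-1}{4-2\cos p-2\cos q}\,dq\,dp$$ be the infinite-lattice Green function, normalised by $G_0(0,0)=0$. A *local bond modification* (LBM) is a real symmetric matrix $\mathbf B_u$ indexed by a finite set of sites (given relative to a local origin), all of whose rows sum to zero. Let $\mathbf G_{uu}$ be the matrix of $G_0$ between the sites of the LBM, $\vec k_u,\vec l_u$ the vectors of horizontal and vertical positions of the sites relative to the local origin, and $p_u=\det(\mathbb I+\mathbf B_u\mathbf G_{uu})$; assume $p_u\ne0$. For $\vec f,\vec g\in\{\vec k_u,\vec l_u\}$ put $c_{u,fg}=-p_u\,\vec f^{\,T}(\mathbb I+\mathbf B_u\mathbf G_{uu})^{-1}\mathbf B_u\,\vec g$, and let $$\mathbf M_u=\begin{pmatrix}c_{u,kk}&c_{u,kl}\\ c_{u,kl}&c_{u,ll}\end{pmatrix},\qquad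 \mathbf N_{uv}=-\frac1{2\pi r_{uv}^2}\begin{pmatrix}\cos2\phi_{uv}&\sin2\phi_{uv}\\ \sin2\phi_{uv}&-\cos2\phi_{uv}\end{pmatrix},$$ where $z_v-z_u=r_{uv}e^{i\phi_{uv}}$ is the vector from the $u$-th to the $v$-th point. Let $n\ge2$ LBMs be given, with local origins $z_1,\dots,z_n\in\mathbb Z^2\subset\mathbb C$. For $S\subseteq\{1,\dots,n\}$ let $p_S(z)=\det(\mathbb I+\mathbf B\mathbf G)$, where $\mathbf B$ is block diagonal with blocks $\mathbf B_u$, $u\in S$, and $\mathbf G$ has as blocks $\mathbf G_{uv}$ the matrices of $G_0$ between the sites of the $u$-th and the $v$-th LBM. The connected $n$-point correlation is the joint cumulant $$\langle 1\cdots n\rangle_c(z)=\sum_\pi(-1)^{|\pi|-1}(|\pi|-1)!\prod_{S\in\pi}p_S(z),$$ the sum running over the partitions $\pi$ of $\{1,\dots,n\}$. Put $$T(z)=-\sum\operatorname{Trace}\left(\mathbf M_{u_1}\mathbf N_{u_1u_2}\mathbf M_{u_2}\cdots\mathbf M_{u_n}\mathbf N_{u_nu_1}\right),$$ the sum running over the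 $(n-1)!$ cyclic orderings of $\{1,\dots,n\}$. In the $c=-2$ logarithmic conformal field theory let $$\phi_u=-\left\{A_u:\!\partial\theta\bar\partial\bar\theta+\bar\partial\theta\partial\bar\theta\!:+B_{1u}:\!\partial\theta\partial\bar\theta+\bar\partial\theta\bar\partial\bar\theta\!:+iB_{2u}:\!\partial\theta\partial\bar\theta-\bar\partial\theta\bar\partial\bar\theta\!:\right\},$$ $$A_u=\frac{c_{u,kk}+c_{u,ll}}{2\pi},\qquad B_{1u}=\frac{c_{u,kk}-c_{u,ll}}{2\pi},\qquad B_{2u}=\frac{c_{u,kl}}{\pi}.$$ Correlations of these fields are given by Wick's theorem for the anticommuting fields $\theta,\bar\theta$, with no contraction inside a normal-ordered product, $\langle\partial\theta(z)\,\partial\bar\theta(w)\rangle=-\frac1{2(z-w)^2}$, $\langle\bar\partial\theta(z)\,\bar\partial\bar\theta(w)\rangle=-\frac1{2(\bar z-\bar w)^2}$, and vanishing contractions $\langle\partial\theta\,\bar\partial\bar\theta\rangle$, $\langle\bar\partial\theta\,\partial\bar\theta\rangle$; connected correlations are the joint cumulants. **Theorem.** 1. $p_S(z)$ is the infinite-volume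 correlation: for all $z$ and $S$ it is the limit, as $N\to\infty$, of $\det\Delta'/\det\Delta$ on the box $[-N,N]^2$ with open boundary, where $\Delta'$ is $\Delta$ plus the matrices $\mathbf B_u$, $u\in S$, placed at $z_u$. 2. For all $0<a\le b$ there are $C$ and $R>0$ (depending only on $a$, $b$ and the $n$ LBMs) such that, whenever $r\ge R$ and $ar\le|z_u-z_v|\le br$ for all $u\ne v$, $$|\langle1\cdots n\rangle_c(z)|\le\frac{C}{r^{2n}},\qquad |\langle1\cdots n\rangle_c(z)-T(z)|\le\frac{C}{r^{2n+1}}.$$ 3. For all distinct $w_1,\dots,w_n\in\mathbb C$, $T(w)$ equals the connected correlation $\langle\phi_1(w_1)\cdots\phi_n(w_n)\rangle_c$. 4. The fields $\phi_u$ have scaling dimension two: for distinct points $w_u$, every $S$ and every $c>0$, $\langle\prod_{u\in S}\phi_u(cw_u)\rangle=c^{-2|S|}\langle\prod_{u\in S}\phi_u(w_u)\rangle$. Accordingly, if $r_m\to\infty$ and $z^{(m)}_u/r_m\to w_u$ for every $u$, with distinct limits $w_u$, then $r_m^{2n}\langle1\cdots n\rangle_c(z^{(m)})\to\langle\phi_1(w_1)\cdots\phi_n(w_n)\rangle_c$.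 -/

import Mathlib

open Filter Topology

noncomputable section

/-! ### The critical sandpile on the square lattice -/

/-- The toppling matrix of the isotropic conservative sandpile on `ℤ²`. -/
def topplingMatrix : Matrix (ℤ × ℤ) (ℤ × ℤ) ℝ := fun i j =>
  if i = j then 4 else if |i.1 - j.1| + |i.2 - j.2| = 1 then -1 else 0

/-- The lattice Green function `G₀(x, y)` of the critical sandpile in infinite volume, normalised
to vanish at the origin (its value at the origin diverges in infinite volume). -/
def latticeGreen (d : ℤ × ℤ) : ℝ :=
  (1 / (2 * Real.pi) ^ 2) *
    ∫ p in (-Real.pi)..Real.pi, ∫ q in (-Real.pi)..Real.pi,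
      (Real.cos (p * d.1 + q * d.2) - 1) / (4 - 2 * Real.cos p - 2 * Real.cos q)

/-- A local bond modification, given by its `B`-matrix in coordinates relative to its local
origin: `B` vanishes outside a finite set of sites, is symmetric, and is conservative. -/
structure LocalBondModification where
  B : Matrix (ℤ × ℤ) (ℤ × ℤ) ℝ
  sites : Finset (ℤ × ℤ)
  support : ∀ i j, B i j ≠ 0 → i ∈ sites ∧ j ∈ sites
  symm : B.IsSymm
  row_sum : ∀ i, ∑ j ∈ sites, B i j = 0

namespace LocalBondModification

variable (L : LocalBondModification)

/-- The finite block `B_u`. -/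
def block : Matrix L.sites L.sites ℝ := L.B.submatrix Subtype.val Subtype.val

/-- The Green function matrix `G_uu` between the sites of the modification. -/
def selfGreen : Matrix L.sites L.sites ℝ := fun i j => latticeGreen (j.1 - i.1)

/-- The bulk probability `p_u = det (1 + B_u G_uu)`. -/
def bulkProb : ℝ := (1 + L.block * L.selfGreen).det

/-- The vector of horizontal positions relative to the local origin. -/
def kVec : L.sites → ℝ := fun i => (i.1.1 : ℝ)

/-- The vector of vertical positions relative to the local origin. -/
def lVec : L.sites → ℝ := fun i => (i.1.2 : ℝ)

/-- `-p_u fᵀ (1 + B_u G_uu)⁻¹ B_u g`. -/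
def coeff (f g : L.sites → ℝ) : ℝ :=
  -L.bulkProb * (f ⬝ᵥ (((1 + L.block * L.selfGreen)⁻¹ * L.block).mulVec g))

def ckk : ℝ := L.coeff L.kVec L.kVec

def ckl : ℝ := L.coeff L.kVec L.lVec

def cll : ℝ := L.coeff L.lVec L.lVec

/-- The matrix `M_u`. -/
def M : Matrix (Fin 2) (Fin 2) ℝ := !![L.ckk, L.ckl; L.ckl, L.cll]

end LocalBondModification

/-- A lattice site as a point of the complex plane. -/
def siteToComplex (i : ℤ × ℤ) : ℂ := ⟨(i.1 : ℝ), (i.2 : ℝ)⟩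

/-- The toppling matrix `Δ'` after inserting the modifications `L u`, `u ∈ S`, with local origins
at `z u`. -/
def modifiedToppling {n : ℕ} (L : Fin n → LocalBondModification) (z : Fin n → ℤ × ℤ)
    (S : Finset (Fin n)) : Matrix (ℤ × ℤ) (ℤ × ℤ) ℝ := fun i j =>
  topplingMatrix i j + ∑ u ∈ S, (L u).B (i - z u) (j - z u)

/-- The square `[-N, N]²` of the lattice. -/
def box (N : ℕ) : Finset (ℤ × ℤ) := Finset.Icc (-(N : ℤ), -(N : ℤ)) ((N : ℤ), (N : ℤ))

/-- The determinant of a toppling matrix restricted to the box (open boundary: grains toppled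
across the boundary are lost). -/
def boxDet (D : Matrix (ℤ × ℤ) (ℤ × ℤ) ℝ) (N : ℕ) : ℝ :=
  (D.submatrix (Subtype.val : box N → ℤ × ℤ) (Subtype.val : box N → ℤ × ℤ)).det

/-- The sites of the modifications `L u`, `u ∈ S`, block by block. -/
abbrev BlockSites {n : ℕ} (L : Fin n → LocalBondModification) (S : Finset (Fin n)) : Type :=
  (u : S) × (L u.1).sites

/-- The block diagonal matrix `B` with blocks `B_u`. -/
def blockB {n : ℕ} (L : Fin n → LocalBondModification) (S : Finset (Fin n)) :
    Matrix (BlockSites L S) (BlockSites L S) ℝ :=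
  Matrix.blockDiagonal' fun u : S => (L u.1).block

/-- The matrix `G` with blocks `G_uv`. -/
def blockG {n : ℕ} (L : Fin n → LocalBondModification) (z : Fin n → ℤ × ℤ)
    (S : Finset (Fin n)) : Matrix (BlockSites L S) (BlockSites L S) ℝ := fun a b =>
  latticeGreen ((z b.1.1 + b.2.1) - (z a.1.1 + a.2.1))

/-- The infinite-volume correlation `det (1 + B G)` of the modifications `L u`, `u ∈ S`. -/
def lbmCorrelation {n : ℕ} (L : Fin n → LocalBondModification) (z : Fin n → ℤ × ℤ)
    (S : Finset (Fin n)) : ℝ := (1 + blockB L S * blockG L z S).det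

/-- The connected `n`-point function (joint cumulant) of a family of correlations indexed by
subsets of the insertions. -/
def connected {K : Type*} [Field K] {n : ℕ} (p : Finset (Fin n) → K) : K :=
  ∑ π : Finpartition (Finset.univ : Finset (Fin n)),
    (-1) ^ (π.parts.card - 1) * ((π.parts.card - 1).factorial : K) * ∏ S ∈ π.parts, p S

/-- The connected `n`-point correlation of the modifications `L u` with local origins `z u`. -/
def lbmConnected {n : ℕ} (L : Fin n → LocalBondModification) (z : Fin n → ℤ × ℤ) : ℝ :=
  connected (lbmCorrelation L z)

/-! ### The trace formula -/

/-- The matrix `N_uv`, where `d = r_uv e^{i φ_uv}` points from `u` to `v`. -/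
def angularN (d : ℂ) : Matrix (Fin 2) (Fin 2) ℝ :=
  (-(1 / (2 * Real.pi * ‖d‖ ^ 2))) •
    !![Real.cos (2 * d.arg), Real.sin (2 * d.arg);
       Real.sin (2 * d.arg), -Real.cos (2 * d.arg)]

/-- `∑ Trace (M_{u₁} N_{u₁u₂} ⋯ M_{uₙ} N_{uₙu₁})` over the `(n - 1)!` cyclic orderings of the `n`
points: each cyclic ordering arises from `n` linear orderings `s`. -/
def cyclicTraceSum {n : ℕ} (M : Fin n → Matrix (Fin 2) (Fin 2) ℝ) (w : Fin n → ℂ) : ℝ :=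
  (1 / (n : ℝ)) * ∑ s : Equiv.Perm (Fin n),
    (List.ofFn fun x : Fin n =>
      M (s x) * angularN (w (s (finRotate n x)) - w (s x))).prod.trace

/-! ### The `c = -2` theory

The index `0 : Fin 2` stands for the derivative `∂` and `1 : Fin 2` for `∂̄`. -/

/-- A field `-{A :∂θ ∂̄θ̄ + ∂̄θ ∂θ̄: + B₁ :∂θ ∂θ̄ + ∂̄θ ∂̄θ̄: + i B₂ :∂θ ∂θ̄ - ∂̄θ ∂̄θ̄:}`. -/
structure LCFTField where
  A : ℂ
  B₁ : ℂ
  B₂ : ℂ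

/-- The coefficient in `φ` of the normal ordered product of the `a`-derivative of `θ` (row) and the
`b`-derivative of `θ̄` (column). -/
def LCFTField.term (φ : LCFTField) : Matrix (Fin 2) (Fin 2) ℂ :=
  -!![φ.B₁ + Complex.I * φ.B₂, φ.A; φ.A, φ.B₁ - Complex.I * φ.B₂]

/-- The Wick contraction of the `a`-derivative of `θ` at `z` (row) with the `b`-derivative of `θ̄`
at `w` (column):
`⟨∂θ ∂θ̄⟩ = -1 / (2 (z - w)²)`, `⟨∂̄θ ∂̄θ̄⟩ = -1 / (2 (z̄ - w̄)²)`, the others vanish. -/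
def contraction (z w : ℂ) : Matrix (Fin 2) (Fin 2) ℂ :=
  !![-1 / (2 * (z - w) ^ 2), 0; 0, -1 / (2 * (starRingEnd ℂ (z - w)) ^ 2)]

/-- The correlation `⟨∏_{u ∈ S} φ_u(w_u)⟩`, by Wick's theorem: choose a term of every field
(`a u` is the derivative on `θ`, `b u` the one on `θ̄`), and contract each `θ` with the `θ̄` of the
insertion `σ u`. By normal ordering no field is contracted with itself; the anticommuting `θ`, `θ̄`
give the sign of `σ`. -/
def lcftCorrelation {n : ℕ} (φ : Fin n → LCFTField) (w : Fin n → ℂ) (S : Finset (Fin n)) : ℂ :=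
  ∑ a : S → Fin 2, ∑ b : S → Fin 2, (∏ u : S, (φ u.1).term (a u) (b u)) *
    ∑ σ : Equiv.Perm S, if ∀ u, σ u ≠ u then
      ((Equiv.Perm.sign σ : ℤ) : ℂ) * ∏ u : S, contraction (w u.1) (w (σ u).1) (a u) (b (σ u))
    else 0

/-- The connected `n`-point correlation of the fields `φ_u(w_u)`. -/
def lcftConnected {n : ℕ} (φ : Fin n → LCFTField) (w : Fin n → ℂ) : ℂ :=
  connected (lcftCorrelation φ w)

/-- The field that represents a local bond modification. -/
def LocalBondModification.field (L : LocalBondModification) : LCFTField where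
  A := ((1 / (2 * Real.pi) * (L.ckk + L.cll) : ℝ) : ℂ)
  B₁ := ((1 / (2 * Real.pi) * (L.ckk - L.cll) : ℝ) : ℂ)
  B₂ := ((1 / Real.pi * L.ckl : ℝ) : ℂ)

end

/-! A modification is neutral: the rows of the symmetric matrix B_u sum to zero, so B_u annihilates
everything that is constant over the sites of u. This makes the finite-volume ratio blind to the
divergent constant in the Green function. In `lbmCorrelation_eq` it also allows the Green function
between two different modifications to be replaced by its second difference `mixedDiff`, which
decays like r⁻². Once the diagonal blocks are factored out, p_S = ∏ p_u · det(1 + K). Here K has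
zero diagonal blocks, and its other blocks are (1 + B_u G_uu)⁻¹ B_u times second differences.

Infinite volume: Sylvester's identity turns det Δ'/det Δ into det(1 + B G_N), with G_N the Green
function of the box. The maximum principle bounds the increments of G_N by 1, so G_N - G_N(0,0) has
limit points. Liouville's theorem for bounded harmonic functions, together with evenness, identifies
each of them with G_0 (`tendsto_boxGreen_sub`).

Trace formula: det(1 + K) is the sum of the principal minors of K, grouped by the blocks that they
meet, and the joint cumulant of these sums is the cumulant of the groups (`cumulant_sum_powerset`).
A minor that meets exactly the blocks in V has at least |V| rows, so it is O(r^(-2|V|)), and to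
leading order only the minors with one site per block count. In these, K may be replaced by a matrix
that factors through the two coordinates in each block, since the second differences of G_0 equal
the bilinear form N up to O(r⁻³) (`exists_mixedDiff_bound`). The minors become signed sums over
permutations of products along cycles. The exponential formula `cumulant_sum_permsOn` reduces the
cumulant to single n-cycles, that is, to traces.

Field theory: Wick's theorem for the fermions gives a sum of the same kind, and
`connected_eq_trace_sum` serves both sides. N is the Hessian of (1/2π) log r; in the directions ∂
and ∂̄ it is diagonal and reproduces the contractions, while M_u becomes the coefficient matrix of
φ_u. The change of basis cancels in the trace. The scaling limit follows because the traces are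
continuous and homogeneous of degree -2n. -/

noncomputable section

/-! ### Joint cumulants -/

/-- The joint cumulant of a set function `p` on the insertions in `S`. -/
def cumulant {K α : Type*} [Field K] [DecidableEq α] (p : Finset α → K) (S : Finset α) : K :=
  ∑ π : Finpartition S,
    (-1) ^ (π.parts.card - 1) * ((π.parts.card - 1).factorial : K) * ∏ T ∈ π.parts, p T

theorem connected_eq_cumulant {K : Type*} [Field K] {n : ℕ} (p : Finset (Fin n) → K) :
    connected p = cumulant p Finset.univ := rfl

section Cumulant

variable {K α : Type*} [Field K] [DecidableEq α]

/-- A partition π of S with a marked block U that avoids i is the same as a proper subset T = S \ U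
containing i with a partition of T. The partition of T has one block fewer than π, hence the weight
with |π| - 2. -/
theorem cumulant_split (p : Finset α → K) {S : Finset α} {i : α} (hi : i ∈ S) :
    ∑ T ∈ S.ssubsets.filter (i ∈ ·), cumulant p T * p (S \ T) =
      ∑ π : Finpartition S, ∑ _U ∈ π.parts.filter (i ∉ ·),
        (-1) ^ (π.parts.card - 2) * ((π.parts.card - 2).factorial : K) *
          ∏ T ∈ π.parts, p T := by
  simp only [cumulant, Finset.sum_mul]
  rw [Finset.sum_sigma', Finset.sum_sigma']
  refine Finset.sum_bij'
    (i := fun x hx => ⟨x.2.extend (b := S \ x.1) (c := S) ?_ Finset.disjoint_sdiff ?_, S \ x.1⟩)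
    (j := fun y hy => ⟨S \ y.2, y.1.ofSubset (Finset.erase_subset y.2 y.1.parts) ?_⟩)
    ?_ ?_ ?_ ?_ ?_
  · simp only [Finset.mem_sigma, Finset.mem_filter, Finset.mem_ssubsets, Finset.mem_univ,
      and_true] at hx
    exact (Finset.sdiff_nonempty.2 hx.1.2).ne_empty
  · simp only [Finset.mem_sigma, Finset.mem_filter, Finset.mem_ssubsets, Finset.mem_univ,
      and_true] at hx
    exact Finset.union_sdiff_of_subset hx.1.1
  · simp only [Finset.mem_sigma, Finset.mem_filter, Finset.mem_univ, true_and] at hy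
    obtain ⟨π, U⟩ := y
    simp only at hy ⊢
    ext a
    simp only [Finset.mem_sup, Finset.mem_erase, Finset.mem_sdiff, id]
    constructor
    · rintro ⟨V, ⟨hV, hVp⟩, ha⟩
      exact ⟨π.le hVp ha, fun haU => hV (π.eq_of_mem_parts hVp hy.1 ha haU)⟩
    · rintro ⟨ha, haU⟩
      obtain ⟨V, hV, haV⟩ := π.exists_mem ha
      exact ⟨V, ⟨fun h => haU (h ▸ haV), hV⟩, haV⟩
  · rintro ⟨T, π⟩ hx
    simp only [Finset.mem_sigma, Finset.mem_filter, Finset.mem_ssubsets, Finset.mem_univ,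
      and_true, true_and, Finpartition.extend] at hx ⊢
    exact ⟨Finset.mem_insert_self _ _, fun h => (Finset.mem_sdiff.1 h).2 hx.2⟩
  · rintro ⟨π, U⟩ hy
    simp only [Finset.mem_sigma, Finset.mem_filter, Finset.mem_ssubsets, Finset.mem_univ,
      and_true, true_and] at hy ⊢
    refine ⟨Finset.sdiff_ssubset (π.le hy.1) (π.nonempty_of_mem_parts hy.1), ?_⟩
    exact Finset.mem_sdiff.2 ⟨hi, hy.2⟩
  · rintro ⟨T, π⟩ hx
    simp only [Finset.mem_sigma, Finset.mem_filter, Finset.mem_ssubsets, Finset.mem_univ,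
      and_true] at hx
    have hT : S \ (S \ T) = T := Finset.sdiff_sdiff_eq_self hx.1.1
    have key : ∀ (T' : Finset α) (h : T' = T) (π' : Finpartition T'), π'.parts = π.parts →
        (⟨T', π'⟩ : (T : Finset α) × Finpartition T) = ⟨T, π⟩ := by
      rintro T' rfl π' h
      rw [Finpartition.ext h]
    refine key _ hT _ ?_
    simp only [Finpartition.ofSubset, Finpartition.extend]
    refine Finset.erase_insert fun h => ?_
    have hne := (Finset.sdiff_nonempty.2 hx.1.2)
    obtain ⟨a, ha⟩ := hne
    exact (Finset.mem_sdiff.1 ha).2 (π.le h ha)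
  · rintro ⟨π, U⟩ hy
    simp only [Finset.mem_sigma, Finset.mem_filter, Finset.mem_univ, true_and] at hy
    have hU : S \ (S \ U) = U := Finset.sdiff_sdiff_eq_self (π.le hy.1)
    refine Sigma.ext (Finpartition.ext ?_) (heq_of_eq hU)
    simp only [Finpartition.ofSubset, Finpartition.extend, hU]
    exact Finset.insert_erase hy.1
  · rintro ⟨T, π⟩ hx
    simp only [Finset.mem_sigma, Finset.mem_filter, Finset.mem_ssubsets, Finset.mem_univ,
      and_true] at hx
    have hnot : S \ T ∉ π.parts := fun h => by
      obtain ⟨a, ha⟩ := Finset.sdiff_nonempty.2 hx.1.2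
      exact (Finset.mem_sdiff.1 ha).2 (π.le h ha)
    simp only [Finpartition.extend]
    rw [Finset.prod_insert hnot, Finset.card_insert_of_notMem hnot]
    rw [show π.parts.card + 1 - 2 = π.parts.card - 1 by omega]
    ring

/-- The linked cluster recursion: the cumulant of the cluster of `i`, times the correlation of
the other insertions. -/
theorem cumulant_recursion (p : Finset α → K) (h0 : p ∅ = 1) {S : Finset α} {i : α}
    (hi : i ∈ S) : ∑ T ∈ S.powerset.filter (i ∈ ·), cumulant p T * p (S \ T) = p S := by
  have hS : S.powerset.filter (i ∈ ·) = insert S (S.ssubsets.filter (i ∈ ·)) := by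
    ext T
    simp only [Finset.mem_filter, Finset.mem_powerset, Finset.mem_insert, Finset.mem_ssubsets]
    constructor
    · rintro ⟨h1, h2⟩
      rcases eq_or_ne T S with h | h
      · exact Or.inl h
      · exact Or.inr ⟨lt_of_le_of_ne h1 h, h2⟩
    · rintro (rfl | ⟨h1, h2⟩)
      · exact ⟨subset_rfl, hi⟩
      · exact ⟨h1.1, h2⟩
  rw [hS, Finset.sum_insert (by simp), cumulant_split p hi, Finset.sdiff_self, h0, mul_one]
  have hne : S ≠ ∅ := Finset.ne_empty_of_mem hi
  simp only [cumulant]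
  rw [← Finset.sum_add_distrib, Finset.sum_eq_single (Finpartition.indiscrete hne)]
  · simp [Finpartition.indiscrete, Finset.filter_singleton, hi]
  · intro π _ hπ
    obtain ⟨V, hV, hiV⟩ := π.exists_mem hi
    have hf : π.parts.filter (i ∉ ·) = π.parts.erase V := by
      ext U
      simp only [Finset.mem_filter, Finset.mem_erase]
      constructor
      · rintro ⟨h1, h2⟩
        exact ⟨fun h => h2 (h ▸ hiV), h1⟩
      · rintro ⟨h1, h2⟩
        exact ⟨h2, fun h => h1 (π.eq_of_mem_parts h2 hV h hiV)⟩
    -- With k + 2 blocks, each of the k + 1 blocks avoiding i may be marked; the total (k +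
    -- 1)·(-1)^k k! cancels the weight (-1)^(k+1) (k + 1)! of π itself.
    rw [Finset.sum_const, hf, Finset.card_erase_of_mem hV]
    have hcard : 2 ≤ π.parts.card := by
      by_contra hlt
      have h1 : π.parts.card = 1 := by
        have := Finset.card_pos.2 ⟨V, hV⟩
        omega
      obtain ⟨W, hW⟩ := Finset.card_eq_one.1 h1
      apply hπ
      have hs := π.sup_parts
      rw [hW, Finset.sup_singleton, id] at hs
      exact Finpartition.ext (by rw [hW, hs]; rfl)
    obtain ⟨k, hk⟩ := Nat.exists_eq_add_of_le hcard
    rw [hk]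
    simp only [show 2 + k - 1 = k + 1 by omega, Nat.add_sub_cancel_left, Nat.factorial_succ,
      nsmul_eq_mul, pow_succ]
    push_cast
    ring
  · simp

/-- The recursion determines its solution: the term T = S is κ S · p ∅ = κ S, and all other terms
involve smaller clusters. -/
theorem cumulant_eq_of_recursion (p κ : Finset α → K) (h0 : p ∅ = 1)
    (h : ∀ S : Finset α, ∀ i ∈ S, ∑ T ∈ S.powerset.filter (i ∈ ·), κ T * p (S \ T) = p S)
    {S : Finset α} (hS : S.Nonempty) : cumulant p S = κ S := by
  induction S using Finset.strongInduction with
  | H S ih =>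
    obtain ⟨i, hi⟩ := hS
    have h1 := cumulant_recursion p h0 hi
    have h2 := h S i hi
    have hmem : S ∈ S.powerset.filter (i ∈ ·) := by simp [hi]
    rw [← h2, ← Finset.add_sum_erase _ _ hmem, ← Finset.add_sum_erase _ _ hmem] at h1
    have h3 : ∑ T ∈ (S.powerset.filter (i ∈ ·)).erase S, cumulant p T * p (S \ T) =
        ∑ T ∈ (S.powerset.filter (i ∈ ·)).erase S, κ T * p (S \ T) := by
      refine Finset.sum_congr rfl fun T hT => ?_
      simp only [Finset.mem_erase, Finset.mem_filter, Finset.mem_powerset] at hT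
      rw [ih T (lt_of_le_of_ne hT.2.1 hT.1) ⟨i, hT.2.2⟩]
    rw [h3] at h1
    simpa [h0] using h1

/-- Cumulants of two or more insertions do not see constants added to the insertions. -/
theorem cumulant_sum_powerset (h : Finset α → K) (h0 : h ∅ = 1) {S : Finset α}
    (hS : 2 ≤ S.card) : cumulant (fun S => ∑ V ∈ S.powerset, h V) S = cumulant h S := by
  -- If `h` gives the moments of variables x_u, the sums over the powerset give the moments of 1 +
  -- x_u, so only the first cumulants change, each by 1. In the recursion, the cumulants of `h`
  -- produce the subsets containing i, and the shift at {i} produces those avoiding i.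
  have key : cumulant (fun S => ∑ V ∈ S.powerset, h V) S =
      cumulant h S + if S.card = 1 then 1 else 0 := by
    refine cumulant_eq_of_recursion _ (fun T => cumulant h T + if T.card = 1 then 1 else 0)
      (by simp [h0]) (fun S i hi => ?_) (Finset.card_pos.1 (by omega))
    simp only [add_mul, Finset.sum_add_distrib]
    have e1 : ∑ T ∈ S.powerset.filter (i ∈ ·), cumulant h T * ∑ V ∈ (S \ T).powerset, h V =
        ∑ W ∈ S.powerset.filter (i ∈ ·), h W := by
      have : ∀ W ∈ S.powerset.filter (i ∈ ·), h W =
          ∑ T ∈ W.powerset.filter (i ∈ ·), cumulant h T * h (W \ T) := fun W hW =>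
        (cumulant_recursion h h0 (Finset.mem_filter.1 hW).2).symm
      rw [Finset.sum_congr rfl this]
      simp only [Finset.mul_sum]
      rw [Finset.sum_sigma', Finset.sum_sigma']
      refine Finset.sum_bij' (fun x _ => ⟨x.1 ∪ x.2, x.1⟩) (fun y _ => ⟨y.2, y.1 \ y.2⟩)
        ?_ ?_ ?_ ?_ ?_
      · rintro ⟨T, V⟩ hx
        simp only [Finset.mem_sigma, Finset.mem_filter, Finset.mem_powerset] at hx ⊢
        exact ⟨⟨Finset.union_subset hx.1.1 (hx.2.trans Finset.sdiff_subset),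
          Finset.mem_union_left _ hx.1.2⟩, Finset.subset_union_left, hx.1.2⟩
      · rintro ⟨W, T⟩ hx
        simp only [Finset.mem_sigma, Finset.mem_filter, Finset.mem_powerset] at hx ⊢
        exact ⟨⟨hx.2.1.trans hx.1.1, hx.2.2⟩, Finset.sdiff_subset_sdiff hx.1.1 subset_rfl⟩
      · rintro ⟨T, V⟩ hx
        simp only [Finset.mem_sigma, Finset.mem_filter, Finset.mem_powerset] at hx
        have hd : Disjoint T V := (Finset.subset_sdiff.1 hx.2).2.symm
        simp [Finset.union_sdiff_cancel_left hd]
      · rintro ⟨W, T⟩ hx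
        simp only [Finset.mem_sigma, Finset.mem_filter, Finset.mem_powerset] at hx
        simp [Finset.union_sdiff_of_subset hx.2.1]
      · rintro ⟨T, V⟩ hx
        simp only [Finset.mem_sigma, Finset.mem_filter, Finset.mem_powerset] at hx
        have hd : Disjoint T V := (Finset.subset_sdiff.1 hx.2).2.symm
        simp [Finset.union_sdiff_cancel_left hd]
    have e2 : ∑ T ∈ S.powerset.filter (i ∈ ·),
        (if T.card = 1 then (1 : K) else 0) * ∑ V ∈ (S \ T).powerset, h V =
        ∑ W ∈ S.powerset.filter (i ∉ ·), h W := by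
      rw [Finset.sum_eq_single {i}]
      · simp only [Finset.card_singleton, if_true, one_mul]
        refine Finset.sum_congr ?_ fun _ _ => rfl
        ext V
        simp [Finset.subset_sdiff, Finset.disjoint_singleton_right]
      · intro T hT hne
        rw [if_neg, zero_mul]
        intro h1
        obtain ⟨a, rfl⟩ := Finset.card_eq_one.1 h1
        simp only [Finset.mem_filter, Finset.mem_singleton] at hT
        exact hne (by rw [hT.2])
      · intro hn
        simp [hi] at hn
    rw [e1, e2, Finset.sum_filter_add_sum_filter_not]
  rw [key, if_neg (by omega), add_zero]

theorem cumulant_prod_mul (c : α → K) (p : Finset α → K) (S : Finset α) :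
    cumulant (fun S => (∏ u ∈ S, c u) * p S) S = (∏ u ∈ S, c u) * cumulant p S := by
  simp only [cumulant, Finset.mul_sum]
  refine Finset.sum_congr rfl fun π _ => ?_
  have : ∏ T ∈ π.parts, ∏ u ∈ T, c u = ∏ u ∈ S, c u := by
    have h := Finset.prod_biUnion (f := c) (t := id) π.disjoint
    rw [π.biUnion_parts] at h
    exact h.symm
  rw [Finset.prod_mul_distrib, this]
  ring

end Cumulant

/-! ### Cumulants of sums over permutations -/

section PermCumulant

open Equiv

theorem permsOn_apply_mem {α : Type*} {S : Finset α} {σ : Perm α} (h : ∀ u ∉ S, σ u = u) {u : α}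
    (hu : u ∈ S) : σ u ∈ S := by
  by_contra hn
  exact hn (by rwa [σ.injective (h _ hn)])

theorem pow_apply_eq_of_eqOn {α : Type*} {S : Finset α} {σ τ : Perm α} (hτ : ∀ u ∈ S, τ u ∈ S)
    (h : ∀ u ∈ S, σ u = τ u) {u : α} (hu : u ∈ S) (k : ℕ) :
    (σ ^ k) u = (τ ^ k) u ∧ (τ ^ k) u ∈ S := by
  induction k with
  | zero => simpa using hu
  | succ k ih =>
    rw [pow_succ', pow_succ', Perm.mul_apply, Perm.mul_apply, ih.1]
    exact ⟨h _ ih.2, hτ _ ih.2⟩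

theorem sameCycle_of_eqOn {α : Type*} [Finite α] {S : Finset α} {σ τ : Perm α} (hτ : ∀ u ∈ S, τ u ∈ S)
    (h : ∀ u ∈ S, σ u = τ u) {u v : α} (hu : u ∈ S) (huv : τ.SameCycle u v) :
    σ.SameCycle u v ∧ v ∈ S := by
  obtain ⟨k, rfl⟩ := huv.exists_nat_pow_eq
  obtain ⟨h1, h2⟩ := pow_apply_eq_of_eqOn hτ h hu k
  exact ⟨⟨k, by rw [zpow_natCast, h1]⟩, h2⟩

variable {K α : Type*} [Field K] [DecidableEq α] [Fintype α]

/-- The permutations that move only points of `S`. -/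
def permsOn (S : Finset α) : Finset (Perm α) :=
  Finset.univ.filter fun σ => ∀ u ∉ S, σ u = u

open Classical in
/-- The permutations that move only points of `S` and act transitively on `S`. -/
def cyclesOn (S : Finset α) : Finset (Perm α) :=
  Finset.univ.filter fun σ => (∀ u ∉ S, σ u = u) ∧ ∀ x ∈ S, ∀ y ∈ S, σ.SameCycle x y

theorem mem_permsOn {S : Finset α} {σ : Perm α} : σ ∈ permsOn S ↔ ∀ u ∉ S, σ u = u := by
  simp [permsOn]

theorem mem_cyclesOn {S : Finset α} {σ : Perm α} :
    σ ∈ cyclesOn S ↔ (∀ u ∉ S, σ u = u) ∧ ∀ x ∈ S, ∀ y ∈ S, σ.SameCycle x y := by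
  simp [cyclesOn]

-- A permutation of S splits uniquely into its cycle through i, living on the orbit T of i, and a
-- permutation of S \ T. With a multiplicative weight this is the recursion that characterises
-- cumulants.
open Classical in
theorem sum_cyclesOn_mul_sum_permsOn (W : Finset α → Perm α → K)
    (hW : ∀ T U τ ρ, Disjoint T U → (∀ u ∉ T, τ u = u) → (∀ u ∉ U, ρ u = u) →
      W (T ∪ U) (τ * ρ) = W T τ * W U ρ) {S : Finset α} {i : α} (hi : i ∈ S) :
    ∑ T ∈ S.powerset.filter (i ∈ ·),
      (∑ τ ∈ cyclesOn T, W T τ) * (∑ ρ ∈ permsOn (S \ T), W (S \ T) ρ) =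
      ∑ σ ∈ permsOn S, W S σ := by
  simp only [Finset.sum_mul_sum, ← Finset.sum_product']
  rw [Finset.sum_sigma']
  -- The data can be read off from the product: on T it agrees with τ, and T is its orbit through i.
  have fwd : ∀ T : Finset α, ∀ τ ρ : Perm α, T ⊆ S → i ∈ T → (∀ u ∉ T, τ u = u) →
      (∀ x ∈ T, ∀ y ∈ T, τ.SameCycle x y) → (∀ u ∉ S \ T, ρ u = u) →
      (∀ u ∈ T, (τ * ρ) u = τ u) ∧ (∀ u, (τ * ρ).SameCycle i u ↔ u ∈ T) := by
    intro T τ ρ hT hiT h1 h2 h3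
    have hag : ∀ u ∈ T, (τ * ρ) u = τ u := fun u hu => by
      rw [Perm.mul_apply, h3 u fun h => (Finset.mem_sdiff.1 h).2 hu]
    have hmaps : ∀ u ∈ T, τ u ∈ T := fun u hu => permsOn_apply_mem h1 hu
    refine ⟨hag, fun u => ⟨fun h => ?_, fun h => ?_⟩⟩
    · exact (sameCycle_of_eqOn (σ := τ) (τ := τ * ρ) (fun v hv => by rw [hag v hv]; exact hmaps v hv)
        (fun v hv => (hag v hv).symm) hiT h).2
    · exact (sameCycle_of_eqOn hmaps hag hiT (h2 i hiT u h)).1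
  refine Finset.sum_bij' (i := fun x _ => x.2.1 * x.2.2)
    (j := fun σ _ => ⟨S.filter (σ.SameCycle i), σ.cycleOf i, (σ.cycleOf i)⁻¹ * σ⟩)
    ?_ ?_ ?_ ?_ ?_
  · rintro ⟨T, τ, ρ⟩ hx
    simp only [Finset.mem_sigma, Finset.mem_filter, Finset.mem_powerset, Finset.mem_product,
      mem_cyclesOn, mem_permsOn] at hx ⊢
    intro u hu
    rw [Perm.mul_apply, hx.2.2 u fun h => hu (Finset.mem_sdiff.1 h).1, hx.2.1.1 u fun h => hu (hx.1.1 h)]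
  · intro σ hσ
    rw [mem_permsOn] at hσ
    simp only [Finset.mem_sigma, Finset.mem_filter, Finset.mem_powerset, Finset.mem_product,
      mem_cyclesOn, mem_permsOn, Finset.mem_sdiff, not_and]
    have hS : ∀ u, σ.SameCycle i u → u ∈ S := fun u hu =>
      (sameCycle_of_eqOn (σ := σ) (fun v hv => permsOn_apply_mem hσ hv) (fun _ _ => rfl) hi hu).2
    refine ⟨⟨Finset.filter_subset _ _, hi, Perm.SameCycle.refl _ _⟩, ⟨fun u hu => ?_, ?_⟩, ?_⟩
    · rw [Perm.cycleOf_apply, if_neg fun h => hu (hS u h) h]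
    · intro x hx y hy
      refine (sameCycle_of_eqOn (S := S.filter (σ.SameCycle i)) (σ := σ.cycleOf i) (τ := σ)
        (fun v hv => ?_) (fun v hv => ?_) (Finset.mem_filter.2 hx) (hx.2.symm.trans hy.2)).1
      · rw [Finset.mem_filter] at hv ⊢
        exact ⟨permsOn_apply_mem hσ hv.1, Perm.sameCycle_apply_right.2 hv.2⟩
      · rw [Perm.cycleOf_apply, if_pos (Finset.mem_filter.1 hv).2]
    · intro u hu
      rw [Perm.mul_apply, Perm.inv_eq_iff_eq, Perm.cycleOf_apply]
      by_cases hc : σ.SameCycle i u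
      · rw [if_pos hc]
      · rw [if_neg hc]
        by_cases huS : u ∈ S
        · exact (hu huS fun _ => hc).elim
        · exact hσ u huS
  · rintro ⟨T, τ, ρ⟩ hx
    simp only [Finset.mem_sigma, Finset.mem_filter, Finset.mem_powerset, Finset.mem_product,
      mem_cyclesOn, mem_permsOn] at hx
    obtain ⟨hag, hsc⟩ := fwd T τ ρ hx.1.1 hx.1.2 hx.2.1.1 hx.2.1.2 hx.2.2
    have hT : S.filter ((τ * ρ).SameCycle i) = T := by
      ext u
      rw [Finset.mem_filter, hsc]
      exact ⟨fun h => h.2, fun h => ⟨hx.1.1 h, h⟩⟩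
    have hτ : (τ * ρ).cycleOf i = τ := by
      ext u
      rw [Perm.cycleOf_apply]
      split_ifs with h
      · exact hag u ((hsc u).1 h)
      · exact (hx.2.1.1 u fun h' => h ((hsc u).2 h')).symm
    simp only [hT, hτ, inv_mul_cancel_left]
  · intro σ _
    simp
  · rintro ⟨T, τ, ρ⟩ hx
    simp only [Finset.mem_sigma, Finset.mem_filter, Finset.mem_powerset, Finset.mem_product,
      mem_cyclesOn, mem_permsOn] at hx
    rw [← hW T (S \ T) τ ρ Finset.disjoint_sdiff hx.2.1.1 hx.2.2,
      Finset.union_sdiff_of_subset hx.1.1]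

/-- The exponential formula: the cumulant of a sum over permutations is the sum over cycles. -/
theorem cumulant_sum_permsOn (W : Finset α → Perm α → K)
    (hW : ∀ T U τ ρ, Disjoint T U → (∀ u ∉ T, τ u = u) → (∀ u ∉ U, ρ u = u) →
      W (T ∪ U) (τ * ρ) = W T τ * W U ρ) (h1 : W ∅ 1 = 1) {S : Finset α} (hS : S.Nonempty) :
    cumulant (fun S => ∑ σ ∈ permsOn S, W S σ) S = ∑ σ ∈ cyclesOn S, W S σ := by
  refine cumulant_eq_of_recursion _ (fun S => ∑ σ ∈ cyclesOn S, W S σ) ?_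
    (fun S i hi => sum_cyclesOn_mul_sum_permsOn W hW hi) hS
  have : permsOn (∅ : Finset α) = {1} := by
    ext σ
    simp [mem_permsOn, Equiv.ext_iff]
  rw [this, Finset.sum_singleton, h1]

/-- Summing over the `n!` linear orderings counts every cyclic ordering `n` times. -/
theorem sum_conj_finRotate {n : ℕ} (hn : 2 ≤ n) (F : Perm (Fin n) → K) :
    ∑ s : Perm (Fin n), F (s * finRotate n * s⁻¹) =
      n * ∑ σ ∈ cyclesOn (Finset.univ : Finset (Fin n)), F σ := by
  classical
  set c := finRotate n with hc
  have hcyc : c.IsCycle := isCycle_finRotate_of_le hn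
  have hsupp : c.support = Finset.univ := support_finRotate_of_le hn
  -- The transitive permutations are the conjugates of the rotation; `hn` excludes fixed points, so
  -- that the support is everything.
  have hconj : ∀ σ, σ ∈ cyclesOn (Finset.univ : Finset (Fin n)) ↔ IsConj c σ := by
    intro σ
    rw [mem_cyclesOn]
    simp only [Finset.mem_univ, not_true_eq_false, false_imp_iff, implies_true, true_and,
      true_imp_iff]
    constructor
    · intro h
      have hne : ∀ x, σ x ≠ x := by
        intro x hx
        have : Nontrivial (Fin n) := Fin.nontrivial_iff_two_le.2 hn
        obtain ⟨y, hy⟩ := exists_ne x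
        exact hy ((h x y).eq_of_left hx).symm
      have hσ : σ.IsCycle := ⟨⟨0, by omega⟩, hne _, fun y _ => h _ y⟩
      rw [hcyc.isConj_iff hσ, hsupp]
      congr 1
      ext x
      simp [hne x]
    · intro h x y
      obtain ⟨g, rfl⟩ := isConj_iff.1 h
      rw [Perm.sameCycle_conj]
      exact hcyc.sameCycle (Perm.mem_support.1 (by rw [hsupp]; simp))
        (Perm.mem_support.1 (by rw [hsupp]; simp))
  -- A fibre of s ↦ s c s⁻¹ is a coset of the centralizer of the n-cycle c, which has order n.
  have hfib : ∀ σ ∈ cyclesOn (Finset.univ : Finset (Fin n)),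
      (Finset.univ.filter fun s : Perm (Fin n) => s * c * s⁻¹ = σ).card = n := by
    intro σ hσ
    obtain ⟨t, rfl⟩ := isConj_iff.1 ((hconj σ).1 hσ)
    have hcent : Nat.card (Subgroup.centralizer {c}) = n := by
      rw [Perm.nat_card_centralizer, hc, cycleType_finRotate_of_le hn]
      simp
    refine Eq.trans ?_ hcent
    rw [Nat.card_eq_fintype_card, Fintype.card_subtype]
    refine Finset.card_bij' (fun s _ => t⁻¹ * s) (fun s _ => t * s) ?_ ?_ ?_ ?_
    · intro s hs
      simp only [Finset.mem_filter, Finset.mem_univ, true_and, Subgroup.mem_centralizer_iff,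
        Set.mem_singleton_iff, forall_eq] at hs ⊢
      have : s * c = t * c * t⁻¹ * s := by rw [← hs]; group
      calc c * (t⁻¹ * s) = t⁻¹ * (t * c * t⁻¹ * s) := by group
        _ = t⁻¹ * s * c := by rw [← this]; group
    · intro s hs
      simp only [Finset.mem_filter, Finset.mem_univ, true_and, Subgroup.mem_centralizer_iff,
        Set.mem_singleton_iff, forall_eq] at hs ⊢
      calc t * s * c * (t * s)⁻¹ = t * (s * c) * s⁻¹ * t⁻¹ := by group
        _ = t * c * t⁻¹ := by rw [← hs]; group
    · intro s _; simp
    · intro s _; simp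
  rw [← Finset.sum_fiberwise_of_maps_to (s := Finset.univ)
    (t := cyclesOn (Finset.univ : Finset (Fin n))) (g := fun s => s * c * s⁻¹)
    (fun s _ => (hconj _).2 (isConj_iff.2 ⟨s, rfl⟩)), Finset.mul_sum]
  refine Finset.sum_congr rfl fun σ hσ => ?_
  rw [Finset.sum_congr rfl fun s hs => by rw [(Finset.mem_filter.1 hs).2], Finset.sum_const,
    hfib σ hσ, nsmul_eq_mul]

end PermCumulant

/-! ### Traces of cyclic products -/

section Trace

variable {K ι : Type*} [Field K] [Fintype ι] [DecidableEq ι]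

/-- The sum runs over index paths from i to j with interior vertices b; `Fin.cons i b` lists the row
indices of the factors and `Fin.snoc b j` their column indices. -/
theorem prod_ofFn_apply {m : ℕ} (A : Fin (m + 1) → Matrix ι ι K) (i j : ι) :
    (List.ofFn A).prod i j = ∑ b : Fin m → ι,
      ∏ x : Fin (m + 1), A x (Fin.cons (α := fun _ => ι) i b x)
        (Fin.snoc (α := fun _ => ι) b j x) := by
  induction m generalizing i with
  | zero => simp [List.ofFn_succ, Fin.snoc]
  | succ m ih =>
    rw [List.ofFn_succ, List.prod_cons, Matrix.mul_apply,
      ← (Fin.consEquiv (fun _ : Fin (m + 1) => ι)).sum_comp, Fintype.sum_prod_type]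
    refine Finset.sum_congr rfl fun k _ => ?_
    rw [ih, Finset.mul_sum]
    refine Finset.sum_congr rfl fun b _ => ?_
    have hsnoc : Fin.snoc (α := fun _ => ι) ((Fin.consEquiv fun _ => ι) (k, b)) j =
        Fin.cons (α := fun _ => ι) k (Fin.snoc (α := fun _ => ι) b j) :=
      (Fin.cons_snoc_eq_snoc_cons _ _ _).symm
    rw [Fin.prod_univ_succ (n := m + 1)]
    refine congrArg₂ (· * ·) ?_ ?_
    · rw [hsnoc]
      rfl
    · refine Finset.prod_congr rfl fun x _ => ?_
      rw [hsnoc]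
      rfl

theorem trace_prod_ofFn {n : ℕ} (hn : n ≠ 0) (A : Fin n → Matrix ι ι K) :
    (List.ofFn A).prod.trace = ∑ a : Fin n → ι, ∏ x, A x (a x) (a (finRotate n x)) := by
  obtain ⟨m, rfl⟩ := Nat.exists_eq_succ_of_ne_zero hn
  rw [Matrix.trace, ← (Fin.consEquiv (fun _ : Fin (m + 1) => ι)).sum_comp,
    Fintype.sum_prod_type]
  refine Finset.sum_congr rfl fun i _ => ?_
  rw [Matrix.diag_apply, prod_ofFn_apply]
  refine Finset.sum_congr rfl fun b _ => Finset.prod_congr rfl fun x _ => ?_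
  rw [Fin.snoc_eq_cons_rotate]
  rfl

end Trace

/-! ### Cumulants of cyclic sums -/

section CyclicSum

open Equiv

variable {K α ι : Type*} [Field K] [DecidableEq α] [Fintype α] [Fintype ι] [Inhabited ι]

/-- Extension of an index assignment on `S` by a default value. -/
def extendIndex {S : Finset α} (a : S → ι) (v : α) : ι :=
  if h : v ∈ S then a ⟨v, h⟩ else default

/-- The signed sum over index assignments of the products of matrix entries along `σ`. -/
def cyclicWeight (Q : α → α → Matrix ι ι K) (S : Finset α) (σ : Perm α) : K :=
  ((Perm.sign σ : ℤ) : K) *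
    ∑ a : S → ι, ∏ u ∈ S, Q u (σ u) (extendIndex a u) (extendIndex a (σ u))

/-- The product preserves both T and U, so every factor involves indices from one part only and the
sum over assignments on the union factorises. -/
theorem cyclicWeight_mul (Q : α → α → Matrix ι ι K) (T U : Finset α) (τ ρ : Perm α)
    (hTU : Disjoint T U) (hτ : ∀ u ∉ T, τ u = u) (hρ : ∀ u ∉ U, ρ u = u) :
    cyclicWeight Q (T ∪ U) (τ * ρ) = cyclicWeight Q T τ * cyclicWeight Q U ρ := by
  have hTU' := Finset.disjoint_left.1 hTU
  have key : ∑ a : (T ∪ U : Finset α) → ι, ∏ u ∈ T ∪ U,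
      Q u ((τ * ρ) u) (extendIndex a u) (extendIndex a ((τ * ρ) u)) =
      (∑ a : T → ι, ∏ u ∈ T, Q u (τ u) (extendIndex a u) (extendIndex a (τ u))) *
      ∑ a : U → ι, ∏ u ∈ U, Q u (ρ u) (extendIndex a u) (extendIndex a (ρ u)) := by
    rw [Finset.sum_mul_sum, ← Finset.sum_product', Finset.univ_product_univ,
      ← (Equiv.piFinsetUnion (fun _ : α => ι) hTU).sum_comp]
    refine Finset.sum_congr rfl fun x _ => ?_
    have hl : ∀ v ∈ T, extendIndex (Equiv.piFinsetUnion (fun _ : α => ι) hTU x) v =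
        extendIndex x.1 v := fun v hv => by
      rw [extendIndex, extendIndex, dif_pos (Finset.mem_union_left _ hv), dif_pos hv]
      exact Equiv.piFinsetUnion_left (fun _ => ι) hTU hv _
    have hr : ∀ v ∈ U, extendIndex (Equiv.piFinsetUnion (fun _ : α => ι) hTU x) v =
        extendIndex x.2 v := fun v hv => by
      rw [extendIndex, extendIndex, dif_pos (Finset.mem_union_right _ hv), dif_pos hv]
      exact Equiv.piFinsetUnion_right (fun _ => ι) hTU hv _
    rw [Finset.prod_union hTU]
    refine congrArg₂ (· * ·) (Finset.prod_congr rfl fun u hu => ?_)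
      (Finset.prod_congr rfl fun u hu => ?_)
    · rw [Perm.mul_apply, hρ u (hTU' hu), hl u hu, hl _ (permsOn_apply_mem hτ hu)]
    · have hu' := permsOn_apply_mem hρ hu
      rw [Perm.mul_apply, hτ _ fun h => hTU' h hu', hr u hu, hr _ hu']
  rw [cyclicWeight, key, Perm.sign_mul, cyclicWeight, cyclicWeight]
  push_cast
  ring

/-- The exponential formula multiplies permutations of different sets, so all of them are placed in
one group as permutations fixing the complement. -/
theorem sum_perm_subtype_eq (Q : α → α → Matrix ι ι K) (S : Finset α) :
    ∑ σ : Perm S, ((Perm.sign σ : ℤ) : K) *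
      ∑ a : S → ι, ∏ u : S, Q u (σ u) (a u) (a (σ u)) =
    ∑ σ ∈ permsOn S, cyclicWeight Q S σ := by
  rw [Finset.sum_subtype (permsOn S) (p := fun f : Perm α => ∀ a, a ∉ S → f a = a)
    (fun _ => mem_permsOn) (cyclicWeight Q S), ← (Perm.subtypeEquivSubtypePerm (· ∈ S)).sum_comp]
  refine Finset.sum_congr rfl fun σ _ => ?_
  have happ : ∀ u : S, (Perm.subtypeEquivSubtypePerm (· ∈ S) σ).1 u = σ u := fun u =>
    Perm.subtypeEquivSubtypePerm_apply_of_mem σ u.2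
  rw [cyclicWeight]
  refine congrArg₂ (· * ·) ?_ (Finset.sum_congr rfl fun a _ => ?_)
  · exact congrArg (fun s : ℤˣ => ((s : ℤ) : K)) (Perm.sign_ofSubtype σ).symm
  · have hext : ∀ u : S, extendIndex a (u : α) = a u := fun u => by
      rw [extendIndex, dif_pos u.2]
    rw [← Finset.prod_coe_sort S]
    exact Finset.prod_congr rfl fun u _ => by rw [happ, hext, hext]

/-- The connected part of a signed sum over permutations of cyclic matrix products is the sum of
the traces over the cyclic orderings. -/
theorem connected_eq_trace_sum [CharZero K] [DecidableEq ι] {n : ℕ} (hn : 2 ≤ n)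
    (Q : Fin n → Fin n → Matrix ι ι K) (p : Finset (Fin n) → K)
    (hp : ∀ S, p S = ∑ σ : Perm S, ((Perm.sign σ : ℤ) : K) *
      ∑ a : S → ι, ∏ u : S, Q u (σ u) (a u) (a (σ u))) :
    connected p = (-1) ^ (n - 1) * ((1 / (n : K)) * ∑ s : Perm (Fin n),
      (List.ofFn fun x : Fin n => Q (s x) (s (finRotate n x))).prod.trace) := by
  have hne : (Finset.univ : Finset (Fin n)).Nonempty := ⟨⟨0, by omega⟩, Finset.mem_univ _⟩
  have hn0 : (n : K) ≠ 0 := Nat.cast_ne_zero.2 (by omega)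
  rw [connected_eq_cumulant, show p = fun S => ∑ σ ∈ permsOn S, cyclicWeight Q S σ from
    funext fun S => (hp S).trans (sum_perm_subtype_eq Q S),
    cumulant_sum_permsOn _ (cyclicWeight_mul Q) (by simp [cyclicWeight]) hne,
    ← mul_right_inj' hn0, ← sum_conj_finRotate hn (cyclicWeight Q Finset.univ)]
  have : ∀ s : Perm (Fin n), cyclicWeight Q Finset.univ (s * finRotate n * s⁻¹) =
      (-1) ^ (n - 1) *
        (List.ofFn fun x : Fin n => Q (s x) (s (finRotate n x))).prod.trace := by
    intro s
    have hs : Perm.sign (s * finRotate n * s⁻¹) = (-1) ^ (n - 1) := by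
      rw [Perm.sign_mul, Perm.sign_mul, Perm.sign_inv, mul_right_comm, Int.units_mul_self,
        one_mul, sign_finRotate]
    rw [cyclicWeight, hs, trace_prod_ofFn (by omega)]
    congr 1
    · simp
    · refine Fintype.sum_equiv
        ((Equiv.subtypeUnivEquiv Finset.mem_univ).arrowCongr (Equiv.refl ι) |>.trans
          (s.symm.arrowCongr (Equiv.refl ι))) _ _ fun a => ?_
      rw [← Equiv.prod_comp s]
      refine Finset.prod_congr rfl fun x _ => ?_
      simp [extendIndex, Equiv.arrowCongr]
  rw [Finset.sum_congr rfl fun s _ => this s, ← Finset.mul_sum]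
  field_simp

end CyclicSum

/-! ### Correlations of the `c = -2` fields -/

section LCFT

open Equiv

/-- The rational form dispenses with polar coordinates; at d = 0 both sides are zero because
division by zero gives zero. -/
theorem angularN_eq (d : ℂ) : angularN d = (-(1 / (2 * Real.pi))) •
    !![(d.re ^ 2 - d.im ^ 2) / (d.re ^ 2 + d.im ^ 2) ^ 2,
        2 * d.re * d.im / (d.re ^ 2 + d.im ^ 2) ^ 2;
      2 * d.re * d.im / (d.re ^ 2 + d.im ^ 2) ^ 2,
        -((d.re ^ 2 - d.im ^ 2) / (d.re ^ 2 + d.im ^ 2) ^ 2)] := by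
  rcases eq_or_ne d 0 with rfl | hd
  · ext i j
    fin_cases i <;> fin_cases j <;> simp [angularN]
  have hr : ‖d‖ ≠ 0 := norm_ne_zero_iff.2 hd
  have hs : d.re ^ 2 + d.im ^ 2 = ‖d‖ ^ 2 := by
    rw [← Complex.normSq_eq_norm_sq, Complex.normSq_apply]; ring
  have hc : Real.cos (2 * d.arg) = (d.re ^ 2 - d.im ^ 2) / ‖d‖ ^ 2 := by
    rw [Real.cos_two_mul, Complex.cos_arg hd]
    field_simp
    linarith
  have hsn : Real.sin (2 * d.arg) = 2 * d.re * d.im / ‖d‖ ^ 2 := by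
    rw [Real.sin_two_mul, Complex.cos_arg hd, Complex.sin_arg]
    field_simp
  have hpi := Real.pi_ne_zero
  rw [angularN, hs, hc, hsn]
  ext i j
  fin_cases i <;> fin_cases j <;> simp <;> field_simp

/-- The change of basis from the coordinates to the pair of Wirtinger directions. -/
def wirtingerBasis : Matrix (Fin 2) (Fin 2) ℂ := !![1, Complex.I; 1, -Complex.I]

/-- The inverse of `wirtingerBasis`. -/
def wirtingerBasisInv : Matrix (Fin 2) (Fin 2) ℂ :=
  !![1 / 2, 1 / 2; -Complex.I / 2, Complex.I / 2]

theorem wirtingerBasis_mul_inv : wirtingerBasis * wirtingerBasisInv = 1 := by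
  ext i j
  fin_cases i <;> fin_cases j <;>
    simp [wirtingerBasis, wirtingerBasisInv, Matrix.mul_apply, Fin.sum_univ_two] <;>
    ring_nf <;> simp <;> norm_num

theorem wirtingerBasisInv_mul : wirtingerBasisInv * wirtingerBasis = 1 :=
  mul_eq_one_comm.1 wirtingerBasis_mul_inv

/-- The basis change turns the symmetric form M_u into c_kk + c_ll off the diagonal and c_kk - c_ll
± 2i c_kl on it, which are 2πA and 2π(B₁ ± iB₂). -/
theorem term_field_eq (L : LocalBondModification) :
    L.field.term = (-(1 / (2 * Real.pi) : ℂ)) •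
      (wirtingerBasis * L.M.map (fun x : ℝ => (x : ℂ)) * wirtingerBasis.transpose) := by
  have hpi : (Real.pi : ℂ) ≠ 0 := Complex.ofReal_ne_zero.2 Real.pi_ne_zero
  have hI : Complex.I ^ 2 = -1 := Complex.I_sq
  ext i j
  simp only [Matrix.smul_apply, Matrix.mul_apply, Fin.sum_univ_two, Matrix.transpose_apply,
    Matrix.map_apply]
  fin_cases i <;> fin_cases j <;>
    simp [wirtingerBasis, LCFTField.term, LocalBondModification.field, LocalBondModification.M]
      <;> field_simp <;> ring_nf <;> rw [hI] <;> ring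

/-- N is the Hessian of (1/2π) log r. The rows of the transposed inverse basis are ∂ = (∂_x -
i∂_y)/2 and ∂̄. The mixed entries are multiples of the Laplacian of log r, which vanishes away from
0, and ∂² log r = -1/(2d²). -/
theorem contraction_eq {z w : ℂ} (h : z ≠ w) : contraction z w =
    (2 * Real.pi : ℂ) • (wirtingerBasisInv.transpose *
      (angularN (w - z)).map (fun x : ℝ => (x : ℂ)) * wirtingerBasisInv) := by
  have hpi : (Real.pi : ℂ) ≠ 0 := Complex.ofReal_ne_zero.2 Real.pi_ne_zero
  have hI : Complex.I ^ 2 = -1 := Complex.I_sq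
  have hI4 : Complex.I ^ 4 = 1 := Complex.I_pow_four
  set d := w - z with hd
  have hd0 : d ≠ 0 := sub_ne_zero.2 h.symm
  have hzw : z - w = -d := by rw [hd]; ring
  have hconj : (starRingEnd ℂ) d ≠ 0 := (map_ne_zero _).2 hd0
  have h1 : ((d.re : ℂ) ^ 2 + (d.im : ℂ) ^ 2) = d * (starRingEnd ℂ) d := by
    rw [Complex.mul_conj, Complex.normSq_apply]; push_cast; ring
  have h2 : (d.re : ℂ) = (d + (starRingEnd ℂ) d) / 2 := by rw [Complex.re_eq_add_conj]
  have h3 : (d.im : ℂ) = -Complex.I * (d - (starRingEnd ℂ) d) / 2 := by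
    rw [Complex.im_eq_sub_conj]
    field_simp
    rw [hI]; ring
  have hcontr : contraction z w =
      !![-1 / (2 * d ^ 2), 0; 0, -1 / (2 * ((starRingEnd ℂ) d) ^ 2)] := by
    rw [contraction, hzw, map_neg, neg_sq, neg_sq]
  rw [angularN_eq, hcontr]
  ext i j
  fin_cases i <;> fin_cases j <;>
    simp [wirtingerBasisInv, Matrix.mul_apply, Fin.sum_univ_two] <;>
    rw [h1, h2, h3] <;> field_simp <;> ring_nf <;> simp only [hI, hI4] <;> ring

theorem list_prod_map_conj {R : Type*} [CommRing R] {m : Type*} [Fintype m] [DecidableEq m]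
    (c : R) {P P' : Matrix m m R} (h : P * P' = 1) (h' : P' * P = 1) (l : List (Matrix m m R)) :
    (l.map fun A => c • (P * A * P')).prod = c ^ l.length • (P * l.prod * P') := by
  induction l with
  | nil => simp [h]
  | cons A l ih =>
    rw [List.map_cons, List.prod_cons, ih, List.prod_cons, List.length_cons, pow_succ',
      Matrix.smul_mul, Matrix.mul_smul, smul_smul]
    congr 1
    calc P * A * P' * (P * l.prod * P') = P * A * (P' * P) * l.prod * P' := by
          simp only [Matrix.mul_assoc]
      _ = P * (A * l.prod) * P' := by rw [h', Matrix.mul_one]; simp only [Matrix.mul_assoc]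

/-- Summing over the derivative a on θ turns coefficient and contraction into a matrix product.
Normal ordering is encoded by a zero diagonal block, which kills every σ with a fixed point. -/
theorem lcftCorrelation_eq {n : ℕ} (φ : Fin n → LCFTField) (w : Fin n → ℂ)
    (S : Finset (Fin n)) :
    lcftCorrelation φ w S = ∑ σ : Perm S, ((Perm.sign σ : ℤ) : ℂ) *
      ∑ b : S → Fin 2, ∏ u : S, ((φ u).term.transpose *
        (if u = σ u then 0 else contraction (w u) (w (σ u))))
          (b u) (b (σ u)) := by
  have step : ∀ σ : Perm S, ((Perm.sign σ : ℤ) : ℂ) *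
      ∑ b : S → Fin 2, ∏ u : S, ((φ u).term.transpose *
        (if u = σ u then 0 else contraction (w u) (w (σ u))))
          (b u) (b (σ u)) = ∑ a : S → Fin 2, ∑ b : S → Fin 2,
          (∏ u : S, (φ u.1).term (a u) (b u)) * if ∀ u, σ u ≠ u then
      ((Equiv.Perm.sign σ : ℤ) : ℂ) * ∏ u : S, contraction (w u.1) (w (σ u).1) (a u) (b (σ u))
    else 0 := by
    intro σ
    rw [Finset.sum_comm, Finset.mul_sum]
    refine Finset.sum_congr rfl fun b _ => ?_
    simp only [Matrix.mul_apply]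
    rw [Finset.prod_univ_sum, Fintype.piFinset_univ, Finset.mul_sum]
    refine Finset.sum_congr rfl fun a _ => ?_
    rw [Finset.prod_mul_distrib]
    simp only [Matrix.transpose_apply]
    by_cases h : ∀ u, σ u ≠ u
    · rw [if_pos h]
      simp only [if_neg (h _).symm]
      ring
    · rw [if_neg h]
      push Not at h
      obtain ⟨u, hu⟩ := h
      rw [Finset.prod_eq_zero (i := u) (f := fun u => (if u = σ u then (0 : Matrix _ _ ℂ) else
        contraction (w u) (w (σ u))) (a u) (b (σ u))) (Finset.mem_univ u) (by
          rw [if_pos hu.symm]; rfl)]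
      ring
  rw [Finset.sum_congr rfl fun σ _ => step σ, lcftCorrelation]
  simp only [Finset.mul_sum]
  rw [Finset.sum_comm (s := (Finset.univ : Finset (Perm S)))]
  exact Finset.sum_congr rfl fun a _ => Finset.sum_comm

theorem finRotate_ne_self {n : ℕ} (hn : 2 ≤ n) (x : Fin n) : finRotate n x ≠ x := by
  rw [← Perm.mem_support, support_finRotate_of_le hn]
  exact Finset.mem_univ x

/-- The traces are the connected correlations of the fields. -/
theorem cyclicTraceSum_eq_lcftConnected {n : ℕ} (hn : 2 ≤ n) (L : Fin n → LocalBondModification)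
    (w : Fin n → ℂ) (hw : Function.Injective w) :
    ((-cyclicTraceSum (fun u => (L u).M) w : ℝ) : ℂ) =
      lcftConnected (fun u => (L u).field) w := by
  have hpi : (Real.pi : ℂ) ≠ 0 := Complex.ofReal_ne_zero.2 Real.pi_ne_zero
  rw [lcftConnected, connected_eq_trace_sum hn (fun u v => (L u).field.term.transpose *
    (if u = v then 0 else contraction (w u) (w v))) _ fun S => by
      rw [lcftCorrelation_eq]; simp only [Subtype.ext_iff]]
  -- Each factor is -W M N W⁻¹: the scalars -1/(2π) and 2π leave -1, and Wᵀ cancels against its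
  -- inverse. The resulting (-1)^n meets the sign (-1)^(n-1) of an n-cycle and leaves an overall
  -- minus.
  have key : ∀ s : Perm (Fin n), (List.ofFn fun x : Fin n =>
      (L (s x)).field.term.transpose * (if s x = s (finRotate n x) then 0 else
        contraction (w (s x)) (w (s (finRotate n x))))).prod.trace =
      (-1) ^ n * (((List.ofFn fun x : Fin n => (L (s x)).M *
        angularN (w (s (finRotate n x)) - w (s x))).prod.trace : ℝ) : ℂ) := by
    intro s
    have h1 : (List.ofFn fun x : Fin n =>
      (L (s x)).field.term.transpose * (if s x = s (finRotate n x) then 0 else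
        contraction (w (s x)) (w (s (finRotate n x))))) =
        (List.ofFn fun x : Fin n => (Complex.ofRealHom.mapMatrix ((L (s x)).M *
          angularN (w (s (finRotate n x)) - w (s x))))).map fun A => (-1 : ℂ) •
            (wirtingerBasis * A * wirtingerBasisInv) := by
      rw [List.map_ofFn]
      congr 1
      funext x
      have hne : s x ≠ s (finRotate n x) := fun h => finRotate_ne_self hn x (s.injective h).symm
      have hsymm : (L (s x)).field.term.transpose = (L (s x)).field.term := by
        ext i j
        fin_cases i <;> fin_cases j <;> rfl
      have hcancel : wirtingerBasis.transpose * wirtingerBasisInv.transpose = 1 := by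
        rw [← Matrix.transpose_mul, wirtingerBasisInv_mul, Matrix.transpose_one]
      rw [if_neg hne, hsymm, term_field_eq, contraction_eq fun h => hne (hw h), Function.comp,
        map_mul, Matrix.smul_mul, Matrix.mul_smul, smul_smul]
      congr 1
      · field_simp
      · calc _ = wirtingerBasis * (L (s x)).M.map (fun x : ℝ => (x : ℂ)) *
              (wirtingerBasis.transpose * wirtingerBasisInv.transpose) *
              (angularN (w (s (finRotate n x)) - w (s x))).map (fun x : ℝ => (x : ℂ)) *
              wirtingerBasisInv := by simp only [Matrix.mul_assoc]
          _ = _ := by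
            rw [hcancel, Matrix.mul_one, ← Matrix.mul_assoc]
            rfl
    rw [h1, list_prod_map_conj _ wirtingerBasis_mul_inv wirtingerBasisInv_mul, List.length_ofFn,
      Matrix.trace_smul, Matrix.trace_mul_comm, ← Matrix.mul_assoc, wirtingerBasisInv_mul,
      Matrix.one_mul, smul_eq_mul]
    congr 1
    have h2 := map_list_prod (Complex.ofRealHom.mapMatrix (m := Fin 2)) (List.ofFn fun x : Fin n =>
      (L (s x)).M * angularN (w (s (finRotate n x)) - w (s x)))
    rw [List.map_ofFn] at h2
    change Matrix.trace (List.prod (List.ofFn (_ ∘ _))) = _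
    rw [← h2]
    simp [Matrix.trace]
  rw [Finset.sum_congr rfl fun s _ => key s, ← Finset.mul_sum, cyclicTraceSum]
  obtain ⟨m, rfl⟩ : ∃ m, n = m + 1 := ⟨n - 1, by omega⟩
  have hsq : ((-1 : ℂ) ^ m) * (-1) ^ m = 1 := by rw [← mul_pow]; norm_num
  push_cast
  rw [pow_succ]
  linear_combination (1 / ((m : ℂ) + 1) * ∑ s : Perm (Fin (m + 1)), ((List.ofFn fun x =>
    (L (s x)).M * angularN (w (s (finRotate (m + 1) x)) - w (s x))).prod.trace : ℂ)) * hsq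

theorem contraction_smul {c : ℝ} (z w : ℂ) :
    contraction (c * z) (c * w) = ((c : ℂ) ^ 2)⁻¹ • contraction z w := by
  ext i j
  fin_cases i <;> fin_cases j <;>
    simp [contraction, ← mul_sub, mul_pow, div_eq_mul_inv] <;> ring

theorem lcftCorrelation_smul {n : ℕ} (φ : Fin n → LCFTField) (w : Fin n → ℂ)
    (S : Finset (Fin n)) (c : ℝ) :
    lcftCorrelation φ (fun u => (c : ℂ) * w u) S =
      lcftCorrelation φ w S / (c : ℂ) ^ (2 * S.card) := by
  simp only [lcftCorrelation, contraction_smul, Matrix.smul_apply, smul_eq_mul,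
    Finset.prod_mul_distrib, Finset.prod_const, Finset.card_univ, Fintype.card_coe,
    Finset.sum_div]
  refine Finset.sum_congr rfl fun a _ => Finset.sum_congr rfl fun b _ => ?_
  rw [mul_div_assoc, Finset.sum_div]
  congr 1
  refine Finset.sum_congr rfl fun σ _ => ?_
  split_ifs
  · rw [pow_mul, inv_pow, div_eq_mul_inv]
    ring
  · simp

end LCFT

/-! ### The lattice Green function as a single integral -/

section DecayRate

open Real

/-- The positive solution `α` of `cosh α = 2 - cos p`: the rate at which the partial Fourier
transform of the Green function decays. -/
def decayRate (p : ℝ) : ℝ := 2 * arsinh |sin (p / 2)|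

theorem continuous_decayRate : Continuous decayRate := by
  exact continuous_const.mul (Real.differentiable_arsinh.continuous.comp (by fun_prop))

theorem decayRate_nonneg (p : ℝ) : 0 ≤ decayRate p :=
  mul_nonneg zero_le_two (arsinh_nonneg_iff.2 (abs_nonneg _))

theorem cosh_decayRate (p : ℝ) : cosh (decayRate p) = 2 - cos p := by
  have h1 := cosh_sq (arsinh |sin (p / 2)|)
  have h2 : cos p = 1 - 2 * sin (p / 2) ^ 2 := by
    have := cos_two_mul (p / 2)
    rw [mul_div_cancel₀ p (two_ne_zero' ℝ), cos_sq'] at this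
    linarith
  rw [decayRate, cosh_two_mul, h1, sinh_arsinh, sq_abs, h2]
  ring

theorem sinh_le_add_sq {t : ℝ} (h0 : 0 ≤ t) (h1 : t ≤ 1) : sinh t ≤ t + t ^ 2 / 2 := by
  have h2 := abs_exp_sub_one_sub_id_le (x := t) (by rwa [abs_of_nonneg h0])
  have h3 := add_one_le_exp (-t)
  rw [sinh_eq]
  linarith [(abs_le.1 h2).2]

/-- In terms of t = α/2 the defining equation of α is sinh t = sin(p/2). The comparisons of α and
sinh α with p below follow from elementary bounds on sinh and sin. -/
theorem half_decayRate_bounds {p : ℝ} (h0 : 0 ≤ p) (h1 : p ≤ π) : decayRate p / 2 ≤ sin (p / 2) ∧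
    sin (p / 2) ≤ decayRate p / 2 + (decayRate p / 2) ^ 2 / 2 ∧ decayRate p / 2 ≤ 1 ∧
    sinh (decayRate p / 2) = sin (p / 2) := by
  have hs : 0 ≤ sin (p / 2) := sin_nonneg_of_nonneg_of_le_pi (by linarith) (by linarith)
  have e : decayRate p / 2 = arsinh (sin (p / 2)) := by
    rw [decayRate, abs_of_nonneg hs]; ring
  have hsinh : sinh (decayRate p / 2) = sin (p / 2) := by rw [e, sinh_arsinh]
  have ha : 0 ≤ decayRate p / 2 := by linarith [decayRate_nonneg p]
  have h2 : decayRate p / 2 ≤ sin (p / 2) := hsinh ▸ self_le_sinh_iff.2 ha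
  have h3 : decayRate p / 2 ≤ 1 := h2.trans (sin_le_one _)
  exact ⟨h2, hsinh ▸ sinh_le_add_sq ha h3, h3, hsinh⟩

theorem decayRate_le {p : ℝ} (h0 : 0 ≤ p) (h1 : p ≤ π) : decayRate p ≤ p := by
  have := half_decayRate_bounds h0 h1
  have := sin_le (x := p / 2) (by linarith)
  linarith

theorem le_decayRate {p : ℝ} (h0 : 0 ≤ p) (h1 : p ≤ π) : p / π ≤ decayRate p := by
  obtain ⟨-, h2, h3, -⟩ := half_decayRate_bounds h0 h1
  have h4 := mul_le_sin (x := p / 2) (by linarith) (by linarith)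
  have h5 : 2 / π * (p / 2) = p / π := by ring
  have h6 := decayRate_nonneg p
  nlinarith

theorem sub_decayRate_le {p : ℝ} (h0 : 0 ≤ p) (h1 : p ≤ π) : p - decayRate p ≤ p ^ 2 / 2 := by
  obtain ⟨h2, h3, h4, -⟩ := half_decayRate_bounds h0 h1
  have h5 := sin_ge_sub_cube (x := p / 2) (by linarith)
  have h6 := decayRate_le h0 h1
  have h7 := decayRate_nonneg p
  have h8 : p ≤ 4 := h1.trans pi_le_four
  nlinarith [mul_nonneg (sq_nonneg p) (sub_nonneg.2 h8)]

theorem le_sinh_decayRate {p : ℝ} (h0 : 0 ≤ p) (h1 : p ≤ π) : p / π ≤ sinh (decayRate p) :=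
  (le_decayRate h0 h1).trans (self_le_sinh_iff.2 (decayRate_nonneg p))

theorem abs_sinh_decayRate_sub_le {p : ℝ} (h0 : 0 ≤ p) (h1 : p ≤ π) : |sinh (decayRate p) - p| ≤ p ^ 2 / 2 := by
  obtain ⟨h2, h3, h4, h5⟩ := half_decayRate_bounds h0 h1
  have h6 := sub_decayRate_le h0 h1
  have h7 := self_le_sinh_iff.2 (decayRate_nonneg p)
  have h8 : sinh (decayRate p) = 2 * sin (p / 2) * cosh (decayRate p / 2) := by
    rw [← h5, ← sinh_two_mul]
    congr 1
    ring
  have h9 : cosh (decayRate p / 2) ≤ 1 + sin (p / 2) := by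
    have := cosh_sub_sinh (decayRate p / 2)
    have h10 : exp (-(decayRate p / 2)) ≤ 1 := exp_le_one_iff.2 (by linarith [decayRate_nonneg p])
    linarith
  have h11 := sin_le (x := p / 2) (by linarith)
  have h12 : 0 ≤ sin (p / 2) := sin_nonneg_of_nonneg_of_le_pi (by linarith) (by linarith)
  rw [abs_le]
  constructor
  · linarith
  · rw [h8]
    nlinarith

theorem sinh_decayRate_pos {p : ℝ} (h0 : 0 < p) (h1 : p ≤ π) : 0 < sinh (decayRate p) :=
  (div_pos h0 pi_pos).trans_le (le_sinh_decayRate h0.le h1)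

end DecayRate

/-! ### Fourier coefficients of 1/(2 cosh c - 2 cos q). -/

section InnerIntegral

open Real intervalIntegral

theorem two_cosh_sub_two_cos_pos {c : ℝ} (hc : 0 < c) (q : ℝ) : 0 < 2 * cosh c - 2 * cos q := by
  have h1 := one_lt_cosh.2 hc.ne'
  have h2 := cos_le_one q
  linarith

theorem continuous_cos_div {c : ℝ} (hc : 0 < c) (y : ℝ) :
    Continuous fun q => cos (q * y) / (2 * cosh c - 2 * cos q) :=
  Continuous.div (by fun_prop) (by fun_prop) fun q => (two_cosh_sub_two_cos_pos hc q).ne'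

theorem integral_cos_nat_mul (k : ℕ) :
    ∫ q in (-π)..π, cos (q * k) = if k = 0 then 2 * π else 0 := by
  split_ifs with h
  · subst h
    simp
    ring
  · have hk : (k : ℝ) ≠ 0 := Nat.cast_ne_zero.2 h
    rw [integral_comp_mul_right (fun q => cos q) hk, integral_cos, neg_mul, sin_neg, mul_comm π,
      sin_nat_mul_pi]
    simp

/-- From cos((k+2)q) + cos(kq) = 2 cos q cos((k+1)q): the difference of the two sides is the
integral of cos((k+1)q) over a period, which is zero. -/
theorem integral_cos_div_succ_succ {c : ℝ} (hc : 0 < c) (k : ℕ) :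
    (∫ q in (-π)..π, cos (q * (k + 2 : ℕ)) / (2 * cosh c - 2 * cos q)) +
      ∫ q in (-π)..π, cos (q * k) / (2 * cosh c - 2 * cos q) =
    2 * cosh c * ∫ q in (-π)..π, cos (q * (k + 1 : ℕ)) / (2 * cosh c - 2 * cos q) := by
  have hint : ∀ y : ℝ, IntervalIntegrable (fun q => cos (q * y) / (2 * cosh c - 2 * cos q))
      MeasureTheory.volume (-π) π := fun y => (continuous_cos_div hc y).intervalIntegrable _ _
  have h0 : ∫ q in (-π)..π, cos (q * (k + 1 : ℕ)) = 0 := by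
    rw [integral_cos_nat_mul, if_neg (Nat.succ_ne_zero k)]
  rw [← integral_const_mul, ← integral_add (hint _) (hint _), ← sub_eq_zero,
    ← integral_sub ((hint _).add (hint _)) ((hint _).const_mul _), ← neg_eq_zero,
    ← intervalIntegral.integral_neg, ← h0]
  refine integral_congr fun q _ => ?_
  have hne : cosh c - cos q ≠ 0 := ne_of_gt (by linarith [two_cosh_sub_two_cos_pos hc q])
  have e1 : cos (q * (k + 2 : ℕ)) = cos (q * (k + 1 : ℕ)) * cos q - sin (q * (k + 1 : ℕ)) * sin q := by
    rw [← cos_add]; push_cast; ring_nf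
  have e2 : cos (q * k) = cos (q * (k + 1 : ℕ)) * cos q + sin (q * (k + 1 : ℕ)) * sin q := by
    rw [← cos_sub]; push_cast; ring_nf
  simp only [e1, e2]
  field_simp
  ring

theorem integral_cos_div_one {c : ℝ} (hc : 0 < c) :
    2 * (∫ q in (-π)..π, cos (q * (1 : ℕ)) / (2 * cosh c - 2 * cos q)) =
    2 * cosh c * (∫ q in (-π)..π, cos (q * (0 : ℕ)) / (2 * cosh c - 2 * cos q)) - 2 * π := by
  have hint : ∀ y : ℝ, IntervalIntegrable (fun q => cos (q * y) / (2 * cosh c - 2 * cos q))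
      MeasureTheory.volume (-π) π := fun y => (continuous_cos_div hc y).intervalIntegrable _ _
  have h0 : ∫ q in (-π)..π, (1 : ℝ) = 2 * π := by simp; ring
  rw [← integral_const_mul, ← integral_const_mul, ← h0,
    ← integral_sub ((hint _).const_mul _) (by simp)]
  refine integral_congr fun q _ => ?_
  have hne : cosh c - cos q ≠ 0 := ne_of_gt (by linarith [two_cosh_sub_two_cos_pos hc q])
  simp
  field_simp
  ring

/-- The recurrence has the solutions exp(±ck). The coefficients are bounded in k, which excludes the
growing one, and the equation relating k = 0 and k = 1 fixes the amplitude. -/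
theorem integral_cos_div_nat {c : ℝ} (hc : 0 < c) (k : ℕ) :
    ∫ q in (-π)..π, cos (q * k) / (2 * cosh c - 2 * cos q) = π * exp (-c * k) / sinh c := by
  set J : ℕ → ℝ := fun k => ∫ q in (-π)..π, cos (q * k) / (2 * cosh c - 2 * cos q) with hJ
  have hrec : ∀ k, J (k + 2) + J k = 2 * cosh c * J (k + 1) := integral_cos_div_succ_succ hc
  have hone : 2 * J 1 = 2 * cosh c * J 0 - 2 * π := integral_cos_div_one hc
  obtain ⟨B, hB⟩ : ∃ B, ∀ k, |J k| ≤ B := by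
    refine ⟨1 / (2 * cosh c - 2) * |π - -π|, fun k => ?_⟩
    refine norm_integral_le_of_norm_le_const (f := fun q => cos (q * k) / (2 * cosh c - 2 * cos q))
      fun q _ => ?_
    have h1 := one_lt_cosh.2 hc.ne'
    rw [norm_div, norm_eq_abs, norm_eq_abs, abs_of_pos (two_cosh_sub_two_cos_pos hc q)]
    refine div_le_div₀ zero_le_one (abs_cos_le_one _) (by linarith) ?_
    linarith [cos_le_one q]
  have hcosh : 2 * cosh c = exp c + exp (-c) := by rw [cosh_eq]; ring
  have hmul : exp c * exp (-c) = 1 := by rw [← exp_add]; simp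
  have he : ∀ k, J (k + 1) - exp (-c) * J k = exp c ^ k * (J 1 - exp (-c) * J 0) := by
    intro k
    induction k with
    | zero => simp
    | succ k ih =>
      rw [pow_succ', mul_assoc, ← ih]
      have := hrec k
      rw [hcosh] at this
      linear_combination this + J k * hmul
  have h0 : J 1 - exp (-c) * J 0 = 0 := by
    by_contra hne
    have hlim : Tendsto (fun k : ℕ => exp c ^ k * |J 1 - exp (-c) * J 0|) atTop atTop :=
      (tendsto_pow_atTop_atTop_of_one_lt (one_lt_exp_iff.2 hc)).atTop_mul_const
        (abs_pos.2 hne)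
    obtain ⟨k, hk⟩ := (hlim.eventually_gt_atTop (2 * B)).exists
    have h2 : |J (k + 1) - exp (-c) * J k| ≤ 2 * B := by
      have h3 : |exp (-c) * J k| ≤ B := by
        rw [abs_mul, abs_of_pos (exp_pos _)]
        have : exp (-c) ≤ 1 := exp_le_one_iff.2 (by linarith)
        nlinarith [hB k, abs_nonneg (J k), exp_pos (-c)]
      linarith [abs_sub (J (k + 1)) (exp (-c) * J k), hB (k + 1)]
    rw [he k, abs_mul, abs_of_pos (pow_pos (exp_pos c) k)] at h2
    linarith
  have hJ0 : J 0 = π / sinh c := by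
    rw [eq_div_iff (sinh_pos_iff.2 hc).ne', sinh_eq]
    linear_combination (-1 / 2) * hone + h0 - (1 / 2) * J 0 * hcosh
  have hgeom : ∀ k, J k = exp (-c) ^ k * J 0 := by
    intro k
    induction k with
    | zero => simp
    | succ k ih =>
      have := he k
      rw [h0, mul_zero] at this
      rw [pow_succ', mul_assoc, ← ih]
      linarith
  change J k = _
  rw [hgeom k, hJ0, ← exp_nat_mul]
  rw [show -c * (k : ℝ) = k * -c by ring]
  ring

theorem integral_cos_div_int {c : ℝ} (hc : 0 < c) (y : ℤ) :
    ∫ q in (-π)..π, cos (q * y) / (2 * cosh c - 2 * cos q) =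
      π * exp (-c * |(y : ℝ)|) / sinh c := by
  have h : |(y : ℝ)| = (y.natAbs : ℝ) := by rw [Nat.cast_natAbs, Int.cast_abs]
  rw [h, ← integral_cos_div_nat hc, ← h]
  refine integral_congr fun q _ => ?_
  rcases abs_choice (y : ℝ) with h' | h' <;> simp [h']

theorem integral_sin_div {c : ℝ} (y : ℝ) :
    ∫ q in (-π)..π, sin (q * y) / (2 * cosh c - 2 * cos q) = 0 := by
  have h := integral_comp_neg (a := -π) (b := π)
    (fun q => sin (q * y) / (2 * cosh c - 2 * cos q))
  simp only [neg_mul, sin_neg, cos_neg, neg_div, neg_neg, intervalIntegral.integral_neg] at h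
  linarith

end InnerIntegral

/-! ### Integrating out one momentum. -/

section SingleIntegral

open Real intervalIntegral

/-- The partial Fourier transform of the Green function at `d`. -/
def greenKernel (d : ℤ × ℤ) (p : ℝ) : ℝ :=
  (cos (p * d.1) * exp (-decayRate p * |(d.2 : ℝ)|) - 1) / sinh (decayRate p)

theorem inner_integral_eq (d : ℤ × ℤ) {p : ℝ} (h0 : 0 < p) (h1 : p ≤ π) :
    ∫ q in (-π)..π, (cos (p * d.1 + q * d.2) - 1) / (4 - 2 * cos p - 2 * cos q) =
      π * greenKernel d p := by
  have hc : 0 < decayRate p := (div_pos h0 pi_pos).trans_le (le_decayRate h0.le h1)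
  have hden : 4 - 2 * cos p = 2 * cosh (decayRate p) := by rw [cosh_decayRate]; ring
  have hcont := continuous_cos_div hc
  have hconts : Continuous fun q => sin (q * d.2) / (2 * cosh (decayRate p) - 2 * cos q) :=
    Continuous.div (by fun_prop) (by fun_prop) fun q => (two_cosh_sub_two_cos_pos hc q).ne'
  rw [hden]
  have hcongr : ∀ q, (cos (p * d.1 + q * d.2) - 1) / (2 * cosh (decayRate p) - 2 * cos q) =
      cos (p * d.1) * (cos (q * d.2) / (2 * cosh (decayRate p) - 2 * cos q)) -
      sin (p * d.1) * (sin (q * d.2) / (2 * cosh (decayRate p) - 2 * cos q)) -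
      cos (q * (0 : ℤ)) / (2 * cosh (decayRate p) - 2 * cos q) := by
    intro q
    rw [cos_add, Int.cast_zero, mul_zero, cos_zero]
    ring
  simp only [hcongr]
  rw [integral_sub, integral_sub, intervalIntegral.integral_const_mul,
    intervalIntegral.integral_const_mul, integral_sin_div,
    integral_cos_div_int hc, integral_cos_div_int hc, greenKernel]
  · simp
    ring
  · exact ((hcont _).const_mul _).intervalIntegrable _ _
  · exact (hconts.const_mul _).intervalIntegrable _ _
  · exact (((hcont _).const_mul _).sub (hconts.const_mul _)).intervalIntegrable _ _
  · exact (hcont _).intervalIntegrable _ _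

/-- The numerator is O(p) and sinh α ≥ p/π, so the kernel is bounded down to p = 0; this gives its
integrability. -/
theorem abs_greenKernel_le (d : ℤ × ℤ) {p : ℝ} (h0 : 0 < p) (h1 : p ≤ π) :
    |greenKernel d p| ≤ π * (|(d.1 : ℝ)| + |(d.2 : ℝ)|) := by
  have hs := sinh_decayRate_pos h0 h1
  have hp := le_sinh_decayRate h0.le h1
  rw [div_le_iff₀ pi_pos] at hp
  rw [greenKernel, abs_div, abs_of_pos hs, div_le_iff₀ hs]
  have e1 : |exp (-decayRate p * |(d.2 : ℝ)|) - 1| ≤ p * |(d.2 : ℝ)| := by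
    have h2 := add_one_le_exp (-decayRate p * |(d.2 : ℝ)|)
    have h3 : exp (-decayRate p * |(d.2 : ℝ)|) ≤ 1 := exp_le_one_iff.2 (by
      nlinarith [decayRate_nonneg p, abs_nonneg (d.2 : ℝ)])
    rw [abs_sub_comm, abs_of_nonneg (by linarith)]
    nlinarith [decayRate_le h0.le h1, abs_nonneg (d.2 : ℝ)]
  have e2 : |cos (p * d.1) - 1| ≤ p * |(d.1 : ℝ)| := by
    have := abs_cos_sub_cos_le (p * d.1) 0
    simpa [abs_mul, abs_of_pos h0] using this
  have e3 : |cos (p * d.1) * exp (-decayRate p * |(d.2 : ℝ)|) - 1| ≤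
      p * (|(d.1 : ℝ)| + |(d.2 : ℝ)|) := by
    calc |cos (p * d.1) * exp (-decayRate p * |(d.2 : ℝ)|) - 1|
        = |cos (p * d.1) * (exp (-decayRate p * |(d.2 : ℝ)|) - 1) + (cos (p * d.1) - 1)| := by
          congr 1; ring
      _ ≤ |cos (p * d.1)| * |exp (-decayRate p * |(d.2 : ℝ)|) - 1| + |cos (p * d.1) - 1| := by
          rw [← abs_mul]; exact abs_add_le _ _
      _ ≤ 1 * (p * |(d.2 : ℝ)|) + p * |(d.1 : ℝ)| := by
          gcongr
          exact abs_cos_le_one _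
      _ = _ := by ring
  calc _ ≤ p * (|(d.1 : ℝ)| + |(d.2 : ℝ)|) := e3
    _ ≤ sinh (decayRate p) * π * (|(d.1 : ℝ)| + |(d.2 : ℝ)|) := by gcongr
    _ = _ := by ring

theorem measurable_greenKernel (d : ℤ × ℤ) : Measurable (greenKernel d) := by
  have := continuous_decayRate.measurable
  unfold greenKernel
  fun_prop

theorem intervalIntegrable_greenKernel (d : ℤ × ℤ) :
    IntervalIntegrable (greenKernel d) MeasureTheory.volume 0 π := by
  rw [intervalIntegrable_iff_integrableOn_Ioc_of_le pi_pos.le]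
  refine MeasureTheory.Measure.integrableOn_of_bounded (M := π * (|(d.1 : ℝ)| + |(d.2 : ℝ)|))
    (by simp) (measurable_greenKernel d).aestronglyMeasurable ?_
  exact (MeasureTheory.ae_restrict_iff' measurableSet_Ioc).2
    (Eventually.of_forall fun p hp => abs_greenKernel_le d hp.1 hp.2)

/-- The integrand is invariant under (p, q) ↦ (-p, -q), so the half p > 0 suffices; there the inner
integral is a Fourier coefficient with decay rate α(p) > 0. -/
theorem latticeGreen_eq (d : ℤ × ℤ) :
    latticeGreen d = 1 / (2 * π) * ∫ p in (0 : ℝ)..π, greenKernel d p := by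
  have hpos : ∫ p in (0 : ℝ)..π, (∫ q in (-π)..π,
      (cos (p * d.1 + q * d.2) - 1) / (4 - 2 * cos p - 2 * cos q)) =
      π * ∫ p in (0 : ℝ)..π, greenKernel d p := by
    rw [← intervalIntegral.integral_const_mul]
    refine intervalIntegral.integral_congr_ae (Eventually.of_forall fun p hp => ?_)
    rw [Set.uIoc_of_le pi_pos.le] at hp
    exact inner_integral_eq d hp.1 hp.2
  have heven : ∀ p : ℝ, (∫ q in (-π)..π,
      (cos (-p * d.1 + q * d.2) - 1) / (4 - 2 * cos (-p) - 2 * cos q)) =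
      ∫ q in (-π)..π, (cos (p * d.1 + q * d.2) - 1) / (4 - 2 * cos p - 2 * cos q) := by
    intro p
    have h := integral_comp_neg (a := -π) (b := π)
      (fun q => (cos (p * d.1 + q * d.2) - 1) / (4 - 2 * cos p - 2 * cos q))
    rw [neg_neg] at h
    rw [← h]
    refine integral_congr fun q _ => ?_
    simp only [cos_neg]
    rw [← cos_neg (-p * d.1 + q * d.2)]
    ring_nf
  have hneg : ∫ p in (-π)..0, (∫ q in (-π)..π,
      (cos (p * d.1 + q * d.2) - 1) / (4 - 2 * cos p - 2 * cos q)) =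
      π * ∫ p in (0 : ℝ)..π, greenKernel d p := by
    rw [← hpos]
    have h := integral_comp_neg (a := -π) (b := 0) (fun p => ∫ q in (-π)..π,
      (cos (p * d.1 + q * d.2) - 1) / (4 - 2 * cos p - 2 * cos q))
    rw [neg_neg, neg_zero] at h
    rw [← h]
    exact integral_congr fun p _ => (heven p).symm
  have hint : IntervalIntegrable (fun p => ∫ q in (-π)..π,
      (cos (p * d.1 + q * d.2) - 1) / (4 - 2 * cos p - 2 * cos q)) MeasureTheory.volume 0 π := by
    refine ((intervalIntegrable_greenKernel d).const_mul π).congr fun p hp => ?_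
    rw [Set.uIoc_of_le pi_pos.le] at hp
    exact (inner_integral_eq d hp.1 hp.2).symm
  have hint' : IntervalIntegrable (fun p => ∫ q in (-π)..π,
      (cos (p * d.1 + q * d.2) - 1) / (4 - 2 * cos p - 2 * cos q))
      MeasureTheory.volume (-π) 0 := by
    have := (IntervalIntegrable.iff_comp_neg).1 hint
    rw [neg_zero] at this
    exact (this.congr fun p _ => heven p).symm
  rw [latticeGreen, ← integral_add_adjacent_intervals hint' hint, hpos, hneg]
  have := pi_ne_zero
  field_simp
  ring

end SingleIntegral

/-! ### Elementary properties of the lattice Green function -/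

section GreenProperties

open Real intervalIntegral

theorem latticeGreen_zero : latticeGreen 0 = 0 := by
  simp [latticeGreen_eq, greenKernel]

theorem latticeGreen_neg_fst (x y : ℤ) : latticeGreen (-x, y) = latticeGreen (x, y) := by
  simp [latticeGreen_eq, greenKernel]

theorem latticeGreen_neg_snd (x y : ℤ) : latticeGreen (x, -y) = latticeGreen (x, y) := by
  simp [latticeGreen_eq, greenKernel]

theorem latticeGreen_neg (d : ℤ × ℤ) : latticeGreen (-d) = latticeGreen d := by
  obtain ⟨x, y⟩ := d
  rw [Prod.neg_mk, latticeGreen_neg_fst, latticeGreen_neg_snd]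

theorem abs_latticeGreen_sub_le {d d' : ℤ × ℤ} {c : ℝ}
    (h : ∀ p ∈ Set.Ioc 0 π, |greenKernel d p - greenKernel d' p| ≤ c) :
    |latticeGreen d - latticeGreen d'| ≤ c / 2 := by
  rw [latticeGreen_eq, latticeGreen_eq, ← mul_sub,
    ← integral_sub (intervalIntegrable_greenKernel d) (intervalIntegrable_greenKernel d'),
    abs_mul, abs_of_pos (by positivity)]
  have h1 := norm_integral_le_of_norm_le_const (a := 0) (b := π)
    (f := fun p => greenKernel d p - greenKernel d' p) (C := c) fun p hp =>
      h p (by rwa [Set.uIoc_of_le pi_pos.le] at hp)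
  rw [sub_zero, abs_of_pos pi_pos, norm_eq_abs] at h1
  have := pi_pos
  calc _ ≤ 1 / (2 * π) * (c * π) := by gcongr
    _ = c / 2 := by field_simp

theorem abs_exp_sub_exp_le {x y : ℝ} (hx : x ≤ 0) (hy : y ≤ 0) :
    |exp x - exp y| ≤ |x - y| := by
  wlog h : y ≤ x generalizing x y
  · rw [abs_sub_comm, abs_sub_comm x]
    exact this hy hx (le_of_not_ge h)
  rw [abs_of_nonneg (sub_nonneg.2 (exp_le_exp.2 h)), abs_of_nonneg (sub_nonneg.2 h)]
  have h1 := add_one_le_exp (y - x)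
  have h2 : exp y = exp x * exp (y - x) := by rw [← exp_add]; ring_nf
  have h3 : exp x ≤ 1 := exp_le_one_iff.2 hx
  rw [h2]
  nlinarith [exp_pos x]

/-- Bounded increments are the growth condition in the uniqueness statement `even_harmonic_eq`. The
numerator changes by at most p ≤ π sinh α. -/
theorem abs_latticeGreen_step_fst (x y : ℤ) :
    |latticeGreen (x + 1, y) - latticeGreen (x, y)| ≤ π / 2 := by
  refine abs_latticeGreen_sub_le fun p hp => ?_
  have hs := sinh_decayRate_pos hp.1 hp.2
  have hb := le_sinh_decayRate hp.1.le hp.2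
  rw [div_le_iff₀ pi_pos] at hb
  rw [greenKernel, greenKernel, ← sub_div, abs_div, abs_of_pos hs, div_le_iff₀ hs]
  have e1 : |cos (p * (x + 1 : ℤ)) - cos (p * x)| ≤ p := by
    refine (abs_cos_sub_cos_le _ _).trans (le_of_eq ?_)
    push_cast
    rw [show p * ((x : ℝ) + 1) - p * x = p by ring, abs_of_pos hp.1]
  have e2 : exp (-decayRate p * |(y : ℝ)|) ≤ 1 := exp_le_one_iff.2 (by
      nlinarith [decayRate_nonneg p, abs_nonneg (y : ℝ)])
  calc _ = |cos (p * (x + 1 : ℤ)) - cos (p * x)| * exp (-decayRate p * |(y : ℝ)|) := by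
        rw [← abs_of_pos (exp_pos (-decayRate p * |(y : ℝ)|)), ← abs_mul,
          abs_of_pos (exp_pos (-decayRate p * |(y : ℝ)|))]
        congr 1
        simp only
        ring
    _ ≤ p * 1 := by gcongr; exact hp.1.le
    _ ≤ _ := by linarith

theorem abs_latticeGreen_step_snd (x y : ℤ) :
    |latticeGreen (x, y + 1) - latticeGreen (x, y)| ≤ π / 2 := by
  refine abs_latticeGreen_sub_le fun p hp => ?_
  have hs := sinh_decayRate_pos hp.1 hp.2
  have hb := le_sinh_decayRate hp.1.le hp.2
  rw [div_le_iff₀ pi_pos] at hb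
  have hα := decayRate_nonneg p
  rw [greenKernel, greenKernel, ← sub_div, abs_div, abs_of_pos hs, div_le_iff₀ hs]
  have e1 : |exp (-decayRate p * |((y + 1 : ℤ) : ℝ)|) - exp (-decayRate p * |(y : ℝ)|)| ≤ p := by
    refine (abs_exp_sub_exp_le ?_ ?_).trans ?_
    · nlinarith [abs_nonneg ((y + 1 : ℤ) : ℝ)]
    · nlinarith [abs_nonneg (y : ℝ)]
    · rw [← mul_sub, abs_mul, abs_neg, abs_of_nonneg hα]
      have h1 : |(|((y + 1 : ℤ) : ℝ)| - |(y : ℝ)|)| ≤ 1 := by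
        refine (abs_abs_sub_abs_le _ _).trans (le_of_eq ?_)
        push_cast
        simp
      have h2 := decayRate_le hp.1.le hp.2
      nlinarith
  calc _ = |cos (p * x)| *
      |exp (-decayRate p * |((y + 1 : ℤ) : ℝ)|) - exp (-decayRate p * |(y : ℝ)|)| := by
        rw [← abs_mul]
        congr 1
        simp only
        ring
    _ ≤ 1 * p := by gcongr; exact abs_cos_le_one _
    _ ≤ _ := by linarith

theorem integral_cos_int_mul (x : ℤ) :
    ∫ p in (0 : ℝ)..π, cos (p * x) = if x = 0 then π else 0 := by
  split_ifs with h
  · simp [h]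
  · have hx : (x : ℝ) ≠ 0 := Int.cast_ne_zero.2 h
    rw [integral_comp_mul_right (fun q => cos q) hx, integral_cos, mul_comm π, sin_int_mul_pi]
    simp

/-- Horizontal neighbours contribute the factor 2 cos p and vertical ones 2 cosh α, and these add up
to 4. Only the kink of |y| at y = 0 survives; it leaves 2 cos(px), whose integral over [0, π] is 2π
for x = 0 and zero otherwise. -/
theorem latticeGreen_laplacian (x y : ℤ) :
    4 * latticeGreen (x, y) - latticeGreen (x + 1, y) - latticeGreen (x - 1, y) -
      latticeGreen (x, y + 1) - latticeGreen (x, y - 1) = if (x, y) = 0 then 1 else 0 := by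
  have hi := intervalIntegrable_greenKernel
  simp only [latticeGreen_eq]
  have : ∫ p in (0 : ℝ)..π, (4 * greenKernel (x, y) p - greenKernel (x + 1, y) p -
      greenKernel (x - 1, y) p - greenKernel (x, y + 1) p - greenKernel (x, y - 1) p) =
      if y = 0 then ∫ p in (0 : ℝ)..π, 2 * cos (p * x) else 0 := by
    have hpt : ∀ p ∈ Set.Ioc 0 π, 4 * greenKernel (x, y) p - greenKernel (x + 1, y) p -
      greenKernel (x - 1, y) p - greenKernel (x, y + 1) p - greenKernel (x, y - 1) p =
      if y = 0 then 2 * cos (p * x) else 0 := by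
      intro p hp
      have hs := (sinh_decayRate_pos hp.1 hp.2).ne'
      have hc := cosh_decayRate p
      have hcos : cos (p * (x + 1 : ℤ)) + cos (p * (x - 1 : ℤ)) = 2 * cos p * cos (p * x) := by
        push_cast
        rw [mul_add, mul_sub, mul_one, cos_add, cos_sub]
        ring
      have hexp : exp (-decayRate p * |((y + 1 : ℤ) : ℝ)|) +
          exp (-decayRate p * |((y - 1 : ℤ) : ℝ)|) =
          2 * cosh (decayRate p) * exp (-decayRate p * |(y : ℝ)|) -
            if y = 0 then 2 * sinh (decayRate p) else 0 := by
        rw [cosh_eq, sinh_eq]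
        rcases lt_trichotomy y 0 with hy | rfl | hy
        · have h1 : ((y + 1 : ℤ) : ℝ) ≤ 0 := by exact_mod_cast (by omega : y + 1 ≤ 0)
          have h2 : ((y - 1 : ℤ) : ℝ) ≤ 0 := by exact_mod_cast (by omega : y - 1 ≤ 0)
          have h3 : (y : ℝ) ≤ 0 := by exact_mod_cast hy.le
          rw [abs_of_nonpos h1, abs_of_nonpos h2, abs_of_nonpos h3, if_neg hy.ne]
          push_cast
          rw [show 2 * ((exp (decayRate p) + exp (-decayRate p)) / 2) *
            exp (-decayRate p * -(y : ℝ)) - 0 = exp (decayRate p) * exp (-decayRate p * -(y : ℝ)) +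
            exp (-decayRate p) * exp (-decayRate p * -(y : ℝ)) by ring, ← exp_add, ← exp_add]
          ring_nf
        · simp
          ring
        · have h1 : 0 ≤ ((y + 1 : ℤ) : ℝ) := by exact_mod_cast (by omega : 0 ≤ y + 1)
          have h2 : 0 ≤ ((y - 1 : ℤ) : ℝ) := by exact_mod_cast (by omega : 0 ≤ y - 1)
          have h3 : 0 ≤ (y : ℝ) := by exact_mod_cast hy.le
          rw [abs_of_nonneg h1, abs_of_nonneg h2, abs_of_nonneg h3, if_neg hy.ne']
          push_cast
          rw [show 2 * ((exp (decayRate p) + exp (-decayRate p)) / 2) *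
            exp (-decayRate p * (y : ℝ)) - 0 = exp (decayRate p) * exp (-decayRate p * (y : ℝ)) +
            exp (-decayRate p) * exp (-decayRate p * (y : ℝ)) by ring, ← exp_add, ← exp_add]
          ring_nf
      simp only [greenKernel]
      rw [show (if y = 0 then 2 * cos (p * (x : ℝ)) else 0) =
        cos (p * x) * (if y = 0 then 2 * sinh (decayRate p) else 0) / sinh (decayRate p) by
          split_ifs
          · field_simp
          · simp]
      rw [← mul_div_assoc, ← sub_div, ← sub_div, ← sub_div, ← sub_div]
      congr 1
      rw [hc] at hexp
      linear_combination -exp (-decayRate p * |(y : ℝ)|) * hcos - cos (p * x) * hexp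
    rw [intervalIntegral.integral_congr_ae (g := fun p => if y = 0 then 2 * cos (p * x) else 0)
      (Eventually.of_forall fun p hp => hpt p (by rwa [Set.uIoc_of_le pi_pos.le] at hp))]
    split_ifs <;> simp
  rw [integral_sub, integral_sub, integral_sub, integral_sub,
    intervalIntegral.integral_const_mul] at this
  · have hpi := pi_ne_zero
    rw [show ∀ a b c d e : ℝ, 4 * (1 / (2 * π) * a) - 1 / (2 * π) * b - 1 / (2 * π) * c -
      1 / (2 * π) * d - 1 / (2 * π) * e = 1 / (2 * π) * (4 * a - b - c - d - e) from
      fun a b c d e => by ring, this, intervalIntegral.integral_const_mul, integral_cos_int_mul]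
    by_cases hy : y = 0
    · by_cases hx : x = 0
      · simp [hx, hy]
        field_simp
      · simp [hx, hy]
    · simp [hy]
  · exact (hi _).const_mul _
  · exact hi _
  · exact ((hi _).const_mul _).sub (hi _)
  · exact hi _
  · exact (((hi _).const_mul _).sub (hi _)).sub (hi _)
  · exact hi _
  · exact ((((hi _).const_mul _).sub (hi _)).sub (hi _)).sub (hi _)
  · exact hi _

end GreenProperties

/-! ### Harmonic functions on the square lattice -/

section Harmonic

/-- The lattice Laplacian (with the sign of the toppling matrix). -/
def latticeLaplacian (f : ℤ × ℤ → ℝ) (i : ℤ × ℤ) : ℝ :=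
  4 * f i - f (i.1 + 1, i.2) - f (i.1 - 1, i.2) - f (i.1, i.2 + 1) - f (i.1, i.2 - 1)

theorem latticeLaplacian_sub (f g : ℤ × ℤ → ℝ) (i : ℤ × ℤ) :
    latticeLaplacian (fun i => f i - g i) i = latticeLaplacian f i - latticeLaplacian g i := by
  simp only [latticeLaplacian]
  ring

theorem latticeLaplacian_translate (f : ℤ × ℤ → ℝ) (d i : ℤ × ℤ) :
    latticeLaplacian (fun i => f (i + d)) i = latticeLaplacian f (i + d) := by
  obtain ⟨x, y⟩ := i
  obtain ⟨a, b⟩ := d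
  simp only [latticeLaplacian, Prod.mk_add_mk, sub_add_eq_add_sub, add_right_comm]

theorem latticeLaplacian_neg_arg (f : ℤ × ℤ → ℝ) (i : ℤ × ℤ) :
    latticeLaplacian (fun i => f (-i)) i = latticeLaplacian f (-i) := by
  obtain ⟨x, y⟩ := i
  simp only [latticeLaplacian, Prod.neg_mk, neg_add, neg_sub', sub_neg_eq_add,
    ← sub_eq_add_neg]
  ring

theorem latticeLaplacian_swap (f : ℤ × ℤ → ℝ) (i : ℤ × ℤ) :
    latticeLaplacian (fun i => f i.swap) i = latticeLaplacian f i.swap := by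
  obtain ⟨x, y⟩ := i
  simp only [latticeLaplacian, Prod.swap_prod_mk]
  ring

theorem latticeLaplacian_latticeGreen (i : ℤ × ℤ) :
    latticeLaplacian latticeGreen i = if i = 0 then 1 else 0 :=
  latticeGreen_laplacian i.1 i.2

/-- The lattice is connected. -/
theorem lattice_induction {P : ℤ × ℤ → Prop} (h0 : P 0)
    (h1 : ∀ x y, P (x, y) ↔ P (x + 1, y)) (h2 : ∀ x y, P (x, y) ↔ P (x, y + 1)) (i : ℤ × ℤ) :
    P i := by
  obtain ⟨x, y⟩ := i
  have hx : P (x, 0) := by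
    induction x using Int.induction_on with
    | zero => exact h0
    | succ k ih => exact (h1 _ _).1 ih
    | pred k ih => exact (h1 _ _).2 (by rwa [sub_add_cancel])
  induction y using Int.induction_on with
  | zero => exact hx
  | succ k ih => exact (h2 _ _).1 ih
  | pred k ih => exact (h2 _ _).2 (by rwa [sub_add_cancel])

theorem eq_of_steps_eq {f : ℤ × ℤ → ℝ} (h1 : ∀ x y, f (x + 1, y) = f (x, y))
    (h2 : ∀ x y, f (x, y + 1) = f (x, y)) (i : ℤ × ℤ) : f i = f 0 :=
  lattice_induction (P := fun i => f i = f 0) rfl (fun x y => by rw [h1]) (fun x y => by rw [h2]) i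

/-- The horizontal increment g is again bounded and harmonic. If its supremum M were positive, then
near a point where g almost attains M the next points to the right would also have g close to M, the
deficit growing at most fourfold per step. Then f would rise by almost K·M along K steps,
contradicting its bound. -/
theorem harmonic_step_le {f : ℤ × ℤ → ℝ} {C : ℝ} (hC : ∀ i, |f i| ≤ C)
    (hf : ∀ i, latticeLaplacian f i = 0) (x y : ℤ) : f (x + 1, y) - f (x, y) ≤ 0 := by
  set g : ℤ × ℤ → ℝ := fun i => f (i.1 + 1, i.2) - f i with hg
  have hgh : ∀ i, latticeLaplacian g i = 0 := fun i => by
    have h1 := hf i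
    have h2 := hf (i.1 + 1, i.2)
    simp only [latticeLaplacian, hg] at *
    rw [show i.1 - 1 + 1 = i.1 + 1 - 1 by ring]
    linarith
  have hbdd : BddAbove (Set.range g) := ⟨2 * C, by
    rintro _ ⟨i, rfl⟩
    have h1 := (abs_le.1 (hC i)).1
    have h2 := (abs_le.1 (hC (i.1 + 1, i.2))).2
    simp only [hg]
    linarith⟩
  set M := sSup (Set.range g) with hM
  have hle : ∀ i, g i ≤ M := fun i => le_csSup hbdd ⟨i, rfl⟩
  change g (x, y) ≤ 0
  by_contra hpos
  have hMpos : 0 < M := lt_of_lt_of_le (not_le.1 hpos) (hle _)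
  obtain ⟨K, hK⟩ := exists_nat_gt ((2 * C + 1) / M)
  rw [div_lt_iff₀ hMpos] at hK
  -- Chosen so that the accumulated deficit K·4^K·ε is at most 1; with K·M > 2C + 1 the rise of f
  -- then exceeds 2C.
  set ε : ℝ := 1 / (K * 4 ^ K + 1) with hε
  have hεpos : 0 < ε := by positivity
  obtain ⟨_, ⟨i, rfl⟩, hi⟩ := exists_lt_of_lt_csSup (Set.range_nonempty g)
    (show M - ε < M by linarith)
  have hstep : ∀ k : ℕ, M - 4 ^ k * ε ≤ g (i.1 + k, i.2) := by
    intro k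
    induction k with
    | zero => simpa using hi.le
    | succ k ih =>
      have h := hgh (i.1 + k, i.2)
      simp only [latticeLaplacian] at h
      have h1 := hle (i.1 + k - 1, i.2)
      have h2 := hle (i.1 + k, i.2 + 1)
      have h3 := hle (i.1 + k, i.2 - 1)
      have h4 : (i.1 + (k + 1 : ℕ), i.2) = (i.1 + k + 1, i.2) := by push_cast; ring_nf
      rw [h4, pow_succ]
      linarith
  have hsum : ∀ k : ℕ, k ≤ K → k * (M - 4 ^ K * ε) ≤ f (i.1 + k, i.2) - f i := by
    intro k
    induction k with
    | zero => intro _; simp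
    | succ k ih =>
      intro hk
      have h1 := ih (by omega)
      have h2 := hstep k
      have h3 : (4 : ℝ) ^ k * ε ≤ 4 ^ K * ε := by
        gcongr
        · norm_num
        · omega
      have h4 : (i.1 + (k + 1 : ℕ), i.2) = (i.1 + k + 1, i.2) := by push_cast; ring_nf
      simp only [hg] at h2
      rw [h4]
      push_cast
      linarith
  have h1 := hsum K le_rfl
  have h2 := (abs_le.1 (hC i)).1
  have h3 := (abs_le.1 (hC (i.1 + K, i.2))).2
  have h4 : K * (4 ^ K * ε) ≤ 1 := by
    rw [hε, ← mul_assoc, mul_one_div, div_le_one (by positivity)]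
    linarith
  linarith

/-- Liouville's theorem on the square lattice. -/
theorem harmonic_eq_of_bounded {f : ℤ × ℤ → ℝ} {C : ℝ} (hC : ∀ i, |f i| ≤ C)
    (hf : ∀ i, latticeLaplacian f i = 0) (i : ℤ × ℤ) : f i = f 0 := by
  have key : ∀ {f : ℤ × ℤ → ℝ}, (∀ i, |f i| ≤ C) → (∀ i, latticeLaplacian f i = 0) →
      ∀ x y, f (x + 1, y) = f (x, y) := by
    intro f hC hf x y
    have h1 := harmonic_step_le hC hf x y
    have h2 := harmonic_step_le (f := fun i => -f i) (fun i => by rw [abs_neg]; exact hC i)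
      (fun i => by
        have := hf i
        simp only [latticeLaplacian] at *
        linarith) x y
    linarith
  refine eq_of_steps_eq (key hC hf) (fun x y => ?_) i
  exact key (f := fun i => f i.swap) (fun i => hC _)
    (fun i => by rw [latticeLaplacian_swap, hf]) y x

/-- An even harmonic function with bounded increments is constant. -/
theorem even_harmonic_eq {f : ℤ × ℤ → ℝ} {C : ℝ}
    (h1 : ∀ x y, |f (x + 1, y) - f (x, y)| ≤ C) (h2 : ∀ x y, |f (x, y + 1) - f (x, y)| ≤ C)
    (hf : ∀ i, latticeLaplacian f i = 0) (heven : ∀ i, f (-i) = f i) (i : ℤ × ℤ) :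
    f i = f 0 := by
  have hstep : ∀ d : ℤ × ℤ, (∀ i, |f (i + d) - f i| ≤ C) → ∀ i, f (i + d) = f i := by
    intro d hd i
    -- The increment by d is a constant. Evaluated at 0 and at -d it is f(d) - f(0) and f(0) -
    -- f(-d); by evenness these are opposite, so it vanishes.
    have hconst := harmonic_eq_of_bounded (f := fun i => f (i + d) - f i) hd fun i => by
      rw [latticeLaplacian_sub, latticeLaplacian_translate, hf, hf, sub_zero]
    have e1 := hconst i
    have e2 := hconst (-d)
    have e3 := heven d
    simp only [zero_add, neg_add_cancel] at e1 e2
    linarith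
  exact eq_of_steps_eq
    (fun x y => by simpa using hstep (1, 0) (fun ⟨x, y⟩ => by simpa using h1 x y) (x, y))
    (fun x y => by simpa using hstep (0, 1) (fun ⟨x, y⟩ => by simpa using h2 x y) (x, y)) i

/-- The single integral treats the two coordinates differently and hides this symmetry. The point
sources cancel in the difference of the two sides, which is therefore even and harmonic with bounded
increments. The symmetry carries the asymptotics over to the sector |y| ≤ |x|. -/
theorem latticeGreen_swap (x y : ℤ) : latticeGreen (y, x) = latticeGreen (x, y) := by
  have h := even_harmonic_eq (f := fun i => latticeGreen i.swap - latticeGreen i)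
    (C := Real.pi / 2 + Real.pi / 2) (fun x y => ?_) (fun x y => ?_) (fun i => ?_) (fun i => ?_)
    (x, y)
  · simp only [Prod.swap_prod_mk, Prod.swap_zero, sub_self] at h
    linarith
  · have a := abs_latticeGreen_step_fst x y
    have b := abs_latticeGreen_step_snd y x
    simp only [Prod.swap_prod_mk]
    rw [show ∀ a b c d : ℝ, a - b - (c - d) = (a - c) - (b - d) from fun a b c d => by ring]
    exact (abs_sub _ _).trans (add_le_add b a)
  · have a := abs_latticeGreen_step_snd x y
    have b := abs_latticeGreen_step_fst y x
    simp only [Prod.swap_prod_mk]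
    rw [show ∀ a b c d : ℝ, a - b - (c - d) = (a - c) - (b - d) from fun a b c d => by ring]
    exact (abs_sub _ _).trans (add_le_add b a)
  · rw [latticeLaplacian_sub, latticeLaplacian_swap, latticeLaplacian_latticeGreen,
      latticeLaplacian_latticeGreen]
    have : i.swap = 0 ↔ i = 0 := by
      obtain ⟨x, y⟩ := i
      simp [Prod.ext_iff, and_comm]
    simp [this]
  · simp only [Prod.swap_neg, latticeGreen_neg]

end Harmonic

/-! ### The Green function of a box -/

section BoxGreen

theorem mem_box {N : ℕ} {i : ℤ × ℤ} :
    i ∈ box N ↔ (-(N : ℤ) ≤ i.1 ∧ i.1 ≤ N) ∧ -(N : ℤ) ≤ i.2 ∧ i.2 ≤ N := by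
  rw [box, Finset.mem_Icc, Prod.le_def, Prod.le_def]
  tauto

theorem neg_mem_box {N : ℕ} {i : ℤ × ℤ} : -i ∈ box N ↔ i ∈ box N := by
  simp only [mem_box, Prod.fst_neg, Prod.snd_neg]
  omega

theorem eventually_mem_box (i : ℤ × ℤ) : ∀ᶠ N : ℕ in atTop, i ∈ box N := by
  filter_upwards [eventually_ge_atTop (i.1.natAbs + i.2.natAbs)] with N hN
  rw [mem_box]
  omega

theorem topplingMatrix_eq (i k : ℤ × ℤ) : topplingMatrix i k =
    4 * (if i = k then 1 else 0) - (if (i.1 + 1, i.2) = k then 1 else 0) -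
      (if (i.1 - 1, i.2) = k then 1 else 0) - (if (i.1, i.2 + 1) = k then 1 else 0) -
      (if (i.1, i.2 - 1) = k then 1 else 0) := by
  obtain ⟨x, y⟩ := i
  obtain ⟨a, b⟩ := k
  have habs : |x - a| + |y - b| = 1 ↔ ((x + 1 = a ∧ y = b) ∨ (x - 1 = a ∧ y = b)) ∨
      (x = a ∧ y + 1 = b) ∨ (x = a ∧ y - 1 = b) := by
    rcases abs_cases (x - a) with h | h <;> rcases abs_cases (y - b) with h' | h' <;> omega
  simp only [topplingMatrix, habs, Prod.mk.injEq]
  by_cases c0 : x = a ∧ y = b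
  · rw [if_pos c0, if_pos c0, if_neg (by omega), if_neg (by omega), if_neg (by omega),
      if_neg (by omega)]
    norm_num
  rw [if_neg c0, if_neg c0]
  by_cases c1 : x + 1 = a ∧ y = b
  · rw [if_pos (by omega), if_pos c1, if_neg (by omega), if_neg (by omega), if_neg (by omega)]
    norm_num
  by_cases c2 : x - 1 = a ∧ y = b
  · rw [if_pos (by omega), if_neg c1, if_pos c2, if_neg (by omega), if_neg (by omega)]
    norm_num
  by_cases c3 : x = a ∧ y + 1 = b
  · rw [if_pos (by omega), if_neg c1, if_neg c2, if_pos c3, if_neg (by omega)]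
    norm_num
  by_cases c4 : x = a ∧ y - 1 = b
  · rw [if_pos (by omega), if_neg c1, if_neg c2, if_neg c3, if_pos c4]
    norm_num
  rw [if_neg (by omega), if_neg c1, if_neg c2, if_neg c3, if_neg c4]
  norm_num

theorem topplingMatrix_symm (i k : ℤ × ℤ) : topplingMatrix i k = topplingMatrix k i := by
  simp only [topplingMatrix, eq_comm, abs_sub_comm]

theorem sum_topplingMatrix_mul {N : ℕ} {v : ℤ × ℤ → ℝ} (hv : ∀ k ∉ box N, v k = 0)
    (i : ℤ × ℤ) : ∑ k ∈ box N, topplingMatrix i k * v k = latticeLaplacian v i := by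
  have h : ∀ a, ∑ k ∈ box N, (if a = k then 1 else 0) * v k = v a := by
    intro a
    simp only [ite_mul, one_mul, zero_mul, Finset.sum_ite_eq]
    split_ifs with ha
    · rfl
    · exact (hv a ha).symm
  simp only [topplingMatrix_eq, sub_mul, Finset.sum_sub_distrib, mul_assoc, ← Finset.mul_sum, h]
  rfl

/-- The maximum principle on a box, with an exceptional set `E`. -/
theorem box_max_principle {N : ℕ} {f : ℤ × ℤ → ℝ} (E : Set (ℤ × ℤ)) {m : ℝ} (hm : 0 ≤ m)
    (h0 : ∀ i ∉ box N, f i = 0) (hE : ∀ i ∈ E, f i ≤ m)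
    (hf : ∀ i ∈ box N, i ∉ E → latticeLaplacian f i ≤ 0) (i : ℤ × ℤ) : f i ≤ m := by
  by_contra hi
  push Not at hi
  have hbox : (box N).Nonempty := ⟨i, by_contra fun h => by rw [h0 i h] at hi; linarith⟩
  obtain ⟨k, hk, hmax⟩ := Finset.exists_max_image (box N) f hbox
  have hall : ∀ j, f j ≤ f k := by
    intro j
    by_cases hj : j ∈ box N
    · exact hmax j hj
    · have : f i ≤ f k := hmax i (by_contra fun h => by rw [h0 i h] at hi; linarith)
      rw [h0 j hj]
      linarith
  have hmk : m < f k := hi.trans_le (hall i)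
  -- At the rightmost maximum, subharmonicity forces the right neighbour to be a maximum too; it is
  -- either outside the box, where f = 0 ≤ m, or further to the right.
  obtain ⟨j, hj, hjmax⟩ := Finset.exists_max_image ((box N).filter fun j => f j = f k)
    (fun j => j.1) ⟨k, Finset.mem_filter.2 ⟨hk, rfl⟩⟩
  rw [Finset.mem_filter] at hj
  have hjE : j ∉ E := fun h => by linarith [hE j h, hj.2]
  have hlap := hf j hj.1 hjE
  simp only [latticeLaplacian] at hlap
  have e1 := hall (j.1 + 1, j.2)
  have e2 := hall (j.1 - 1, j.2)
  have e3 := hall (j.1, j.2 + 1)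
  have e4 := hall (j.1, j.2 - 1)
  have heq : f (j.1 + 1, j.2) = f k := by linarith [hj.2]
  have hmem : (j.1 + 1, j.2) ∈ box N := by
    by_contra h
    rw [h0 _ h] at heq
    linarith
  have := hjmax _ (Finset.mem_filter.2 ⟨hmem, heq⟩)
  simp at this

theorem box_harmonic_eq_zero {N : ℕ} {f : ℤ × ℤ → ℝ} (h0 : ∀ i ∉ box N, f i = 0)
    (hf : ∀ i ∈ box N, latticeLaplacian f i = 0) (i : ℤ × ℤ) : f i = 0 := by
  refine le_antisymm (box_max_principle ∅ le_rfl h0 (by simp) (fun i hi _ => (hf i hi).le) i) ?_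
  have := box_max_principle (N := N) (f := fun i => -f i) ∅ le_rfl
    (fun i hi => by rw [h0 i hi, neg_zero]) (by simp) (fun i hi _ => by
      have := hf i hi
      simp only [latticeLaplacian] at *
      linarith) i
  simpa using this

/-- The toppling matrix of the box. -/
abbrev boxToppling (N : ℕ) : Matrix (box N) (box N) ℝ :=
  topplingMatrix.submatrix Subtype.val Subtype.val

theorem sum_boxToppling {N : ℕ} (v : ℤ × ℤ → ℝ) (hv : ∀ k ∉ box N, v k = 0) (i : box N) :
    ∑ k : box N, boxToppling N i k * v k = latticeLaplacian v i := by
  rw [← sum_topplingMatrix_mul hv]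
  exact Finset.sum_coe_sort (box N) fun k => topplingMatrix i k * v k

theorem isUnit_det_boxToppling (N : ℕ) : IsUnit (boxToppling N).det := by
  rw [isUnit_iff_ne_zero]
  intro hdet
  obtain ⟨v, hv, hmul⟩ := Matrix.exists_mulVec_eq_zero_iff.2 hdet
  apply hv
  set f : ℤ × ℤ → ℝ := fun i => if h : i ∈ box N then v ⟨i, h⟩ else 0 with hf
  have h0 : ∀ i ∉ box N, f i = 0 := fun i hi => dif_neg hi
  have hfv : ∀ k : box N, f k = v k := fun k => dif_pos k.2
  have := box_harmonic_eq_zero h0 fun i hi => by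
    rw [← sum_boxToppling f h0 ⟨i, hi⟩]
    have := congrFun hmul ⟨i, hi⟩
    simp only [hfv]
    exact this
  funext k
  rw [← hfv, this]
  rfl

/-- The Green function of the box, extended by zero. -/
def boxGreen (N : ℕ) (i j : ℤ × ℤ) : ℝ :=
  if h : i ∈ box N ∧ j ∈ box N then (boxToppling N)⁻¹ ⟨i, h.1⟩ ⟨j, h.2⟩ else 0

theorem boxGreen_eq_zero_left {N : ℕ} {i : ℤ × ℤ} (hi : i ∉ box N) (j : ℤ × ℤ) :
    boxGreen N i j = 0 := dif_neg fun h => hi h.1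

theorem boxGreen_coe {N : ℕ} (i j : box N) : boxGreen N i j = (boxToppling N)⁻¹ i j :=
  dif_pos ⟨i.2, j.2⟩

theorem boxGreen_comm (N : ℕ) (i j : ℤ × ℤ) : boxGreen N i j = boxGreen N j i := by
  have hsymm : ((boxToppling N)⁻¹).transpose = (boxToppling N)⁻¹ := by
    rw [Matrix.transpose_nonsing_inv]
    congr 1
    ext a b
    exact topplingMatrix_symm _ _
  by_cases hi : i ∈ box N
  · by_cases hj : j ∈ box N
    · have := congrFun (congrFun hsymm ⟨i, hi⟩) ⟨j, hj⟩
      rw [boxGreen, boxGreen, dif_pos ⟨hi, hj⟩, dif_pos ⟨hj, hi⟩, ← this]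
      rfl
    · rw [boxGreen, boxGreen, dif_neg fun h => hj h.2, dif_neg fun h => hj h.1]
  · rw [boxGreen, boxGreen, dif_neg fun h => hi h.1, dif_neg fun h => hi h.2]

theorem latticeLaplacian_boxGreen {N : ℕ} {i j : ℤ × ℤ} (hi : i ∈ box N) (hj : j ∈ box N) :
    latticeLaplacian (fun i => boxGreen N i j) i = if i = j then 1 else 0 := by
  rw [← sum_boxToppling (fun i => boxGreen N i j) (fun k hk => boxGreen_eq_zero_left hk j) ⟨i, hi⟩]
  have h := congrFun (congrFun (Matrix.mul_nonsing_inv _ (isUnit_det_boxToppling N)) ⟨i, hi⟩)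
    ⟨j, hj⟩
  rw [Matrix.mul_apply, Matrix.one_apply] at h
  simp only [Subtype.mk.injEq] at h
  rw [← h]
  exact Finset.sum_congr rfl fun k _ => by rw [← boxGreen_coe]

theorem boxGreen_neg_neg (N : ℕ) {j : ℤ × ℤ} (hj : j ∈ box N) (i : ℤ × ℤ) :
    boxGreen N (-i) (-j) = boxGreen N i j := by
  have := box_harmonic_eq_zero (N := N) (f := fun i => boxGreen N (-i) (-j) - boxGreen N i j)
    (fun i hi => by
      rw [boxGreen_eq_zero_left hi, boxGreen_eq_zero_left fun h => hi (neg_mem_box.1 h), sub_zero])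
    (fun i hi => by
      rw [latticeLaplacian_sub, latticeLaplacian_boxGreen hi hj,
        latticeLaplacian_neg_arg (fun i => boxGreen N i (-j)),
        latticeLaplacian_boxGreen (neg_mem_box.2 hi) (neg_mem_box.2 hj)]
      simp) i
  linarith

theorem boxGreen_nonneg {N : ℕ} {j : ℤ × ℤ} (hj : j ∈ box N) (i : ℤ × ℤ) :
    0 ≤ boxGreen N i j := by
  have := box_max_principle (N := N) (f := fun i => -boxGreen N i j) ∅ le_rfl
    (fun i hi => by rw [boxGreen_eq_zero_left hi, neg_zero]) (by simp) (fun i hi _ => by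
      have := latticeLaplacian_boxGreen hi hj
      have h2 : (0 : ℝ) ≤ if i = j then 1 else 0 := by positivity
      simp only [latticeLaplacian] at *
      linarith) i
  simpa using this

theorem boxGreen_le_diag {N : ℕ} {j : ℤ × ℤ} (hj : j ∈ box N) (i : ℤ × ℤ) :
    boxGreen N i j ≤ boxGreen N j j :=
  box_max_principle (N := N) (f := fun i => boxGreen N i j) {j} (boxGreen_nonneg hj j)
    (fun i hi => boxGreen_eq_zero_left hi j) (by simp) (fun i hi hij => by
      rw [latticeLaplacian_boxGreen hi hj, if_neg (by simpa using hij)]) i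

/-- The Laplacian at j equals 1 and is the sum of the four differences to the neighbours, each
nonnegative because the maximum is on the diagonal. -/
theorem boxGreen_diag_sub_le {N : ℕ} {j : ℤ × ℤ} (hj : j ∈ box N) {k : ℤ × ℤ}
    (hk : k = (j.1 + 1, j.2) ∨ k = (j.1 - 1, j.2) ∨ k = (j.1, j.2 + 1) ∨ k = (j.1, j.2 - 1)) :
    boxGreen N j j - boxGreen N k j ≤ 1 := by
  have h := latticeLaplacian_boxGreen hj hj
  rw [if_pos rfl] at h
  simp only [latticeLaplacian] at h
  have h1 := boxGreen_le_diag hj (j.1 + 1, j.2)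
  have h2 := boxGreen_le_diag hj (j.1 - 1, j.2)
  have h3 := boxGreen_le_diag hj (j.1, j.2 + 1)
  have h4 := boxGreen_le_diag hj (j.1, j.2 - 1)
  rcases hk with rfl | rfl | rfl | rfl <;> linarith

/-- The difference is subharmonic away from j, and at j it is controlled by symmetry and the
diagonal bound. The bound is uniform in N and i, which provides the compactness for the
infinite-volume limit. -/
theorem boxGreen_sub_le {N : ℕ} {j k : ℤ × ℤ} (hj : j ∈ box N) (hk : k ∈ box N)
    (hjk : k = (j.1 + 1, j.2) ∨ k = (j.1 - 1, j.2) ∨ k = (j.1, j.2 + 1) ∨ k = (j.1, j.2 - 1))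
    (i : ℤ × ℤ) : boxGreen N i j - boxGreen N i k ≤ 1 := by
  refine box_max_principle (N := N) (f := fun i => boxGreen N i j - boxGreen N i k) {j}
    zero_le_one (fun i hi => by rw [boxGreen_eq_zero_left hi, boxGreen_eq_zero_left hi, sub_zero])
    ?_ (fun i hi hij => ?_) i
  · rintro _ rfl
    rw [boxGreen_comm N _ k]
    exact boxGreen_diag_sub_le hj hjk
  · rw [latticeLaplacian_sub, latticeLaplacian_boxGreen hi hj, latticeLaplacian_boxGreen hi hk,
      if_neg (by simpa using hij), zero_sub, neg_nonpos]
    positivity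

theorem abs_boxGreen_step_fst {N : ℕ} {x y : ℤ} (h : (x, y) ∈ box N) (h' : (x + 1, y) ∈ box N)
    (i : ℤ × ℤ) : |boxGreen N i (x + 1, y) - boxGreen N i (x, y)| ≤ 1 := by
  rw [abs_le]
  have h1 := boxGreen_sub_le h h' (Or.inl rfl) i
  have h2 := boxGreen_sub_le h' h (Or.inr (Or.inl (by simp))) i
  constructor <;> linarith

theorem abs_boxGreen_step_snd {N : ℕ} {x y : ℤ} (h : (x, y) ∈ box N) (h' : (x, y + 1) ∈ box N)
    (i : ℤ × ℤ) : |boxGreen N i (x, y + 1) - boxGreen N i (x, y)| ≤ 1 := by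
  rw [abs_le]
  have h1 := boxGreen_sub_le h h' (Or.inr (Or.inr (Or.inl rfl))) i
  have h2 := boxGreen_sub_le h' h (Or.inr (Or.inr (Or.inr (by simp)))) i
  constructor <;> linarith

end BoxGreen

/-! ### The infinite-volume limit of the Green function -/

section Limit

theorem eventually_abs_boxGreen_sub_le (j : ℤ × ℤ) :
    ∃ C : ℝ, ∀ᶠ N : ℕ in atTop, ∀ i, |boxGreen N i j - boxGreen N i 0| ≤ C := by
  refine lattice_induction (P := fun j => ∃ C : ℝ, ∀ᶠ N : ℕ in atTop, ∀ i,
    |boxGreen N i j - boxGreen N i 0| ≤ C) ⟨0, by simp⟩ (fun x y => ?_) (fun x y => ?_) j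
  · constructor <;> rintro ⟨C, hC⟩ <;> refine ⟨C + 1, ?_⟩ <;>
      filter_upwards [hC, eventually_mem_box (x, y), eventually_mem_box (x + 1, y)]
        with N h1 h2 h3 i
    all_goals
      have h4 := abs_le.1 (abs_boxGreen_step_fst h2 h3 i)
      have h5 := abs_le.1 (h1 i)
      rw [abs_le]
      constructor <;> linarith
  · constructor <;> rintro ⟨C, hC⟩ <;> refine ⟨C + 1, ?_⟩ <;>
      filter_upwards [hC, eventually_mem_box (x, y), eventually_mem_box (x, y + 1)]
        with N h1 h2 h3 i
    all_goals
      have h4 := abs_le.1 (abs_boxGreen_step_snd h2 h3 i)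
      have h5 := abs_le.1 (h1 i)
      rw [abs_le]
      constructor <;> linarith

theorem tendsto_latticeLaplacian {l : Filter ℕ} {a : ℕ → ℤ × ℤ → ℝ} {b : ℤ × ℤ → ℝ}
    (h : ∀ i, Tendsto (fun N => a N i) l (𝓝 (b i))) (i : ℤ × ℤ) :
    Tendsto (fun N => latticeLaplacian (a N) i) l (𝓝 (latticeLaplacian b i)) :=
  (((((h i).const_mul 4).sub (h _)).sub (h _)).sub (h _)).sub (h _)

/-- The Green function of the box converges, up to a divergent constant. -/
theorem tendsto_boxGreen_sub (i j : ℤ × ℤ) :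
    Tendsto (fun N => boxGreen N i j - boxGreen N 0 0) atTop (𝓝 (latticeGreen (i - j))) := by
  -- Along an ultrafilter boundedness already gives a limit, so it remains only to identify the
  -- limit b.
  rw [tendsto_iff_ultrafilter]
  intro U hU
  have hlim : ∀ i j : ℤ × ℤ, ∃ b : ℝ,
      Tendsto (fun N => boxGreen N i j - boxGreen N 0 0) U (𝓝 b) := by
    intro i j
    obtain ⟨C, hC⟩ := eventually_abs_boxGreen_sub_le j
    obtain ⟨D, hD⟩ := eventually_abs_boxGreen_sub_le i
    have hmem : ∀ᶠ N in (U : Filter ℕ),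
        boxGreen N i j - boxGreen N 0 0 ∈ Set.Icc (-(C + D)) (C + D) := by
      filter_upwards [hU hC, hU hD] with N h1 h2
      have h3 := abs_le.1 (h1 i)
      have h4 := abs_le.1 (h2 0)
      rw [boxGreen_comm N 0 i] at h4
      constructor <;> linarith
    obtain ⟨b, -, hb⟩ := isCompact_Icc.ultrafilter_le_nhds
      (U.map fun N => boxGreen N i j - boxGreen N 0 0) (by
        rw [le_principal_iff]
        exact hmem)
    exact ⟨b, hb⟩
  choose b hb using hlim
  have hev : ∀ i, ∀ᶠ N in (U : Filter ℕ), i ∈ box N := fun i => hU (eventually_mem_box i)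
  have hcomm : ∀ i j, b i j = b j i := fun i j =>
    tendsto_nhds_unique (hb i j) ((hb j i).congr fun N => by rw [boxGreen_comm])
  have hneg : ∀ i j, b (-i) (-j) = b i j := fun i j =>
    tendsto_nhds_unique (hb (-i) (-j)) ((hb i j).congr' ((hev j).mono fun N hN => by
      simp only [boxGreen_neg_neg N hN]))
  have hzero : b 0 0 = 0 :=
    tendsto_nhds_unique (hb 0 0) (tendsto_const_nhds.congr fun N => by rw [sub_self])
  have hlap : ∀ i j, latticeLaplacian (fun i => b i j) i = if i = j then 1 else 0 := by
    intro i j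
    refine tendsto_nhds_unique (tendsto_latticeLaplacian (fun i => hb i j) i)
      (tendsto_const_nhds.congr' ?_)
    filter_upwards [hev i, hev j] with N h1 h2
    rw [latticeLaplacian_sub (fun i => boxGreen N i j) (fun _ => boxGreen N 0 0),
      latticeLaplacian_boxGreen h1 h2]
    simp only [latticeLaplacian]
    ring
  have hfst : ∀ i x y, |b i (x + 1, y) - b i (x, y)| ≤ 1 := by
    intro i x y
    refine le_of_tendsto ((hb i (x + 1, y)).sub (hb i (x, y))).abs ?_
    filter_upwards [hev (x, y), hev (x + 1, y)] with N h1 h2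
    rw [sub_sub_sub_cancel_right]
    exact abs_boxGreen_step_fst h1 h2 i
  have hsnd : ∀ i x y, |b i (x, y + 1) - b i (x, y)| ≤ 1 := by
    intro i x y
    refine le_of_tendsto ((hb i (x, y + 1)).sub (hb i (x, y))).abs ?_
    filter_upwards [hev (x, y), hev (x, y + 1)] with N h1 h2
    rw [sub_sub_sub_cancel_right]
    exact abs_boxGreen_step_snd h1 h2 i
  set c : ℤ × ℤ → ℤ × ℤ → ℝ := fun i j => b i j - latticeGreen (i - j) with hc
  have hccomm : ∀ i j, c i j = c j i := fun i j => by
    simp only [hc]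
    rw [hcomm, ← latticeGreen_neg, neg_sub]
  have hcneg : ∀ i j, c (-i) (-j) = c i j := fun i j => by
    simp only [hc]
    rw [hneg, ← latticeGreen_neg (i - j)]
    congr 2
    abel
  have hclap : ∀ i j, latticeLaplacian (fun i => c i j) i = 0 := by
    intro i j
    simp only [hc]
    rw [latticeLaplacian_sub (fun i => b i j) (fun i => latticeGreen (i - j)), hlap]
    simp only [sub_eq_add_neg (_ : ℤ × ℤ) j]
    rw [latticeLaplacian_translate latticeGreen, latticeLaplacian_latticeGreen,
      ← sub_eq_add_neg i j]
    simp only [sub_eq_zero, sub_self]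
  have hcfst : ∀ i x y, |c i (x + 1, y) - c i (x, y)| ≤ 1 + Real.pi / 2 := by
    intro i x y
    have h1 := abs_latticeGreen_step_fst (x - i.1) (y - i.2)
    rw [← latticeGreen_neg, ← latticeGreen_neg (x - i.1, _)] at h1
    have e1 : -(x - i.1 + 1, y - i.2) = i - (x + 1, y) := by
      ext
      · simp
        ring
      · simp
    have e2 : -(x - i.1, y - i.2) = i - (x, y) := by
      ext <;> simp
    rw [e1, e2] at h1
    have h2 := hfst i x y
    simp only [hc]
    rw [sub_sub_sub_comm]
    exact (abs_sub _ _).trans (add_le_add h2 h1)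
  have hcsnd : ∀ i x y, |c i (x, y + 1) - c i (x, y)| ≤ 1 + Real.pi / 2 := by
    intro i x y
    have h1 := abs_latticeGreen_step_snd (x - i.1) (y - i.2)
    rw [← latticeGreen_neg, ← latticeGreen_neg (x - i.1, _)] at h1
    have e1 : -(x - i.1, y - i.2 + 1) = i - (x, y + 1) := by
      ext
      · simp
      · simp
        ring
    have e2 : -(x - i.1, y - i.2) = i - (x, y) := by
      ext <;> simp
    rw [e1, e2] at h1
    have h2 := hsnd i x y
    simp only [hc]
    rw [sub_sub_sub_comm]
    exact (abs_sub _ _).trans (add_le_add h2 h1)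
  -- The increment of c in its second argument is bounded and harmonic in the first, hence
  -- independent of it by Liouville; so c is a sum of functions of one variable.
  have hsplit : ∀ i j, c i j = c i 0 + c 0 j := by
    intro i j
    have h00 : c 0 0 = 0 := by simp [hc, hzero, latticeGreen_zero]
    have := eq_of_steps_eq (f := fun j => c i j - c 0 j) (fun x y => ?_) (fun x y => ?_) j
    · simp only [h00] at this
      linarith
    · have h := harmonic_eq_of_bounded (f := fun i => c i (x + 1, y) - c i (x, y))
        (fun i => hcfst i x y) (fun i => by
          rw [latticeLaplacian_sub (fun i => c i (x + 1, y)) (fun i => c i (x, y)), hclap, hclap,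
            sub_zero]) i
      linarith
    · have h := harmonic_eq_of_bounded (f := fun i => c i (x, y + 1) - c i (x, y))
        (fun i => hcsnd i x y) (fun i => by
          rw [latticeLaplacian_sub (fun i => c i (x, y + 1)) (fun i => c i (x, y)), hclap, hclap,
            sub_zero]) i
      linarith
  have hconst : ∀ i, c i 0 = 0 := by
    intro i
    have h := even_harmonic_eq (f := fun i => c i 0) (C := 1 + Real.pi / 2)
      (fun x y => by rw [hccomm _ 0, hccomm _ 0]; exact hcfst 0 x y)
      (fun x y => by rw [hccomm _ 0, hccomm _ 0]; exact hcsnd 0 x y)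
      (fun i => hclap i 0) (fun i => by simpa using hcneg i 0) i
    rw [h]
    simp [hc, hzero, latticeGreen_zero]
  have hfinal : c i j = 0 := by rw [hsplit, hconst, hccomm, hconst, add_zero]
  have : b i j = latticeGreen (i - j) := sub_eq_zero.1 hfinal
  rw [← this]
  exact hb i j

end Limit

/-! ### The infinite-volume limit of the correlations -/

section InfiniteVolume

variable {n : ℕ} (L : Fin n → LocalBondModification) (z : Fin n → ℤ × ℤ) (S : Finset (Fin n))

/-- The position on the lattice of a site of a modification. -/
def blockSite (a : BlockSites L S) : ℤ × ℤ := z a.1.1 + a.2.1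

variable {L S}

theorem blockB_mk_mk (u : S) (s t : (L u.1).sites) :
    blockB L S ⟨u, s⟩ ⟨u, t⟩ = (L u.1).block s t := by
  rw [blockB, Matrix.blockDiagonal'_apply_eq]

theorem sum_blockB_mul (u : S) (s : (L u.1).sites) (f : BlockSites L S → ℝ) :
    ∑ b, blockB L S ⟨u, s⟩ b * f b = ∑ t, (L u.1).block s t * f ⟨u, t⟩ := by
  rw [Fintype.sum_sigma, Finset.sum_eq_single u]
  · simp only [blockB_mk_mk]
  · intro v _ hv
    refine Finset.sum_eq_zero fun t _ => ?_
    rw [blockB, Matrix.blockDiagonal'_apply_ne _ _ _ hv.symm, zero_mul]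
  · simp

theorem LocalBondModification.block_sum (L : LocalBondModification) (s : L.sites) :
    ∑ t, L.block s t = 0 := by
  rw [← L.row_sum s.1]
  exact Finset.sum_coe_sort L.sites fun t => L.B s t

theorem LocalBondModification.block_transpose (L : LocalBondModification) :
    L.block.transpose = L.block := by
  ext i j
  exact L.symm.apply _ _

theorem sum_blockB (a : BlockSites L S) : ∑ b, blockB L S a b = 0 := by
  obtain ⟨u, s⟩ := a
  have := sum_blockB_mul u s fun _ => (1 : ℝ)
  simp only [mul_one, (L u.1).block_sum s] at this
  exact this

theorem LocalBondModification.B_eq_sum (L : LocalBondModification) (z i j : ℤ × ℤ) :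
    L.B (i - z) (j - z) = ∑ s : L.sites, (if i = z + s.1 then 1 else 0) *
      ∑ t : L.sites, L.block s t * (if j = z + t.1 then 1 else 0) := by
  have hi : ∀ s : ℤ × ℤ, i = z + s ↔ i - z = s := fun s => by
    rw [sub_eq_iff_eq_add, add_comm]
  have hj : ∀ s : ℤ × ℤ, j = z + s ↔ j - z = s := fun s => by
    rw [sub_eq_iff_eq_add, add_comm]
  simp only [hi, hj, block, Matrix.submatrix_apply, mul_ite, mul_one, mul_zero, ite_mul, one_mul,
    zero_mul]
  rw [Finset.sum_coe_sort L.sites fun s => if i - z = s then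
    ∑ t : L.sites, (if j - z = t.1 then L.B s t.1 else 0) else 0, Finset.sum_ite_eq,
    Finset.sum_coe_sort L.sites fun t => if j - z = t then L.B (i - z) t else 0,
    Finset.sum_ite_eq]
  by_cases h : L.B (i - z) (j - z) = 0
  · simp [h]
  · rw [if_pos (L.support _ _ h).1, if_pos (L.support _ _ h).2]

variable (L S) in
/-- The incidence matrix between the box and the sites of the modifications. -/
def siteIncidence (N : ℕ) : Matrix (box N) (BlockSites L S) ℝ := fun i a =>
  if i.1 = blockSite L z S a then 1 else 0

theorem modifiedToppling_eq (N : ℕ) :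
    (modifiedToppling L z S).submatrix (Subtype.val : box N → ℤ × ℤ) Subtype.val =
      boxToppling N + siteIncidence L z S N * (blockB L S * (siteIncidence L z S N).transpose) := by
  ext i j
  rw [Matrix.add_apply, Matrix.submatrix_apply, modifiedToppling, Matrix.mul_apply,
    Fintype.sum_sigma]
  congr 1
  rw [← Finset.sum_coe_sort S]
  refine Finset.sum_congr rfl fun u _ => ?_
  rw [LocalBondModification.B_eq_sum]
  refine Finset.sum_congr rfl fun s _ => ?_
  rw [Matrix.mul_apply, sum_blockB_mul]
  rfl

theorem transpose_siteIncidence_mul {N : ℕ} (hN : ∀ a, blockSite L z S a ∈ box N) :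
    (siteIncidence L z S N).transpose * ((boxToppling N)⁻¹ * siteIncidence L z S N) =
      fun a b => boxGreen N (blockSite L z S a) (blockSite L z S b) := by
  ext a b
  have h : ∀ (a : BlockSites L S) (f : box N → ℝ),
      ∑ k, (if k.1 = blockSite L z S a then 1 else 0) * f k = f ⟨_, hN a⟩ := by
    intro a f
    rw [Finset.sum_eq_single ⟨_, hN a⟩]
    · simp
    · intro k _ hk
      rw [if_neg fun h => hk (Subtype.ext h), zero_mul]
    · simp
  rw [Matrix.mul_apply]
  refine (h a _).trans ?_
  rw [Matrix.mul_apply, Finset.sum_congr rfl fun k _ => mul_comm _ _]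
  refine (h b _).trans ?_
  exact (boxGreen_coe _ _).symm

variable (L S) in
/-- The Green function of the box between the sites of the modifications, up to a constant. -/
def boxG (N : ℕ) : Matrix (BlockSites L S) (BlockSites L S) ℝ := fun a b =>
  boxGreen N (blockSite L z S a) (blockSite L z S b) - boxGreen N 0 0

/-- Δ' = Δ + U B Uᵀ with U the incidence matrix, and Sylvester's identity moves det(1 + Δ⁻¹ U B Uᵀ)
to the sites of the modifications. The constant G_N(0,0) may be subtracted because the rows of B sum
to zero. -/
theorem boxDet_div_eq {N : ℕ} (hN : ∀ a, blockSite L z S a ∈ box N) :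
    boxDet (modifiedToppling L z S) N / boxDet topplingMatrix N =
      (1 + blockB L S * boxG L z S N).det := by
  have hu := isUnit_det_boxToppling N
  have hB : blockB L S * boxG L z S N =
      blockB L S * (siteIncidence L z S N).transpose * ((boxToppling N)⁻¹ *
        siteIncidence L z S N) := by
    rw [Matrix.mul_assoc, transpose_siteIncidence_mul z hN]
    ext a b
    simp only [Matrix.mul_apply, boxG, mul_sub, Finset.sum_sub_distrib]
    rw [← Finset.sum_mul, sum_blockB, zero_mul, sub_zero]
    rfl
  rw [hB, Matrix.det_one_add_mul_comm, boxDet, boxDet, modifiedToppling_eq,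
    div_eq_iff hu.ne_zero, mul_comm, ← Matrix.det_mul, Matrix.mul_add, Matrix.mul_one,
    Matrix.mul_assoc (boxToppling N)⁻¹, Matrix.mul_nonsing_inv_cancel_left _ _ hu]

theorem tendsto_boxDet_div : Tendsto
    (fun N : ℕ => boxDet (modifiedToppling L z S) N / boxDet topplingMatrix N)
    atTop (𝓝 (lbmCorrelation L z S)) := by
  have hmem : ∀ᶠ N : ℕ in atTop, ∀ a, blockSite L z S a ∈ box N :=
    eventually_all.2 fun a => eventually_mem_box _
  have hlim : Tendsto (boxG L z S) atTop (𝓝 (blockG L z S)) := by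
    refine tendsto_pi_nhds.2 fun a => tendsto_pi_nhds.2 fun b => ?_
    have := tendsto_boxGreen_sub (blockSite L z S a) (blockSite L z S b)
    rwa [← latticeGreen_neg, neg_sub] at this
  have hcont : Continuous fun G : Matrix (BlockSites L S) (BlockSites L S) ℝ =>
      (1 + blockB L S * G).det :=
    (continuous_const.add (continuous_const.matrix_mul continuous_id)).matrix_det
  refine ((hcont.tendsto _).comp hlim).congr' ?_
  filter_upwards [hmem] with N hN
  rw [boxDet_div_eq z hN]
  rfl

end InfiniteVolume

/-! ### Second differences of the lattice Green function far from the origin -/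

section Asymptotics

open MeasureTheory
open scoped Real

/-- The Fourier weight of an increment by `(a, b)`. -/
def stepWeight (a b p : ℝ) : ℂ := Complex.exp (p * a * Complex.I - decayRate p * b) - 1

/-- The linearization of `stepWeight` at zero frequency. -/
def stepSlope (a b : ℝ) : ℂ := a * Complex.I - b

theorem exists_stepWeight_bound (a b : ℝ) : ∃ C : ℝ, 0 ≤ C ∧ ∀ p, 0 < p → p ≤ π →
    ‖stepWeight a b p - p * stepSlope a b‖ ≤ C * p ^ 2 := by
  set J := |a| + |b| with hJ
  have hJ0 : 0 ≤ J := by positivity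
  -- The first term is the Taylor remainder of exp, since |ζ| ≤ pJ ≤ πJ; the |b| pays for replacing
  -- α by p.
  refine ⟨J ^ 2 * Real.exp (π * J) + |b|, by positivity, fun p h0 h1 => ?_⟩
  set ζ : ℂ := p * a * Complex.I - decayRate p * b with hζ
  have hα := decayRate_nonneg p
  have hαp := decayRate_le h0.le h1
  have hnorm : ‖ζ‖ ≤ p * J := by
    have e1 : ‖(p * a * Complex.I : ℂ)‖ = p * |a| := by simp [abs_of_pos h0]
    have e2 : ‖(decayRate p * b : ℂ)‖ ≤ p * |b| := by
      simp only [norm_mul, Complex.norm_real, Real.norm_eq_abs, abs_of_nonneg hα]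
      gcongr
    calc ‖ζ‖ ≤ p * |a| + p * |b| := (norm_sub_le _ _).trans (add_le_add e1.le e2)
      _ = p * J := by rw [hJ]; ring
  have hexp : ‖Complex.exp ζ - (1 + ζ)‖ ≤ (p * J) ^ 2 * Real.exp (π * J) := by
    have h := Complex.norm_exp_sub_sum_le_norm_mul_exp ζ 2
    simp only [Finset.sum_range_succ, Finset.sum_range_zero, pow_zero, Nat.factorial, pow_one] at h
    norm_num at h
    refine h.trans ?_
    gcongr
    exact hnorm.trans (by gcongr)
  have hlin : ‖((p - decayRate p : ℝ) : ℂ) * b‖ ≤ p ^ 2 * |b| := by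
    have := sub_decayRate_le h0.le h1
    simp only [norm_mul, Complex.norm_real, Real.norm_eq_abs]
    rw [abs_of_nonneg (sub_nonneg.2 hαp)]
    gcongr
    nlinarith [sq_nonneg p]
  calc ‖stepWeight a b p - p * stepSlope a b‖
      = ‖(Complex.exp ζ - (1 + ζ)) + ((p - decayRate p : ℝ) : ℂ) * b‖ := by
        congr 1
        rw [stepWeight, stepSlope, hζ]
        push_cast
        ring
    _ ≤ (p * J) ^ 2 * Real.exp (π * J) + p ^ 2 * |b| := (norm_add_le _ _).trans (add_le_add hexp hlin)
    _ = _ := by ring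

/-- The Fourier weight of a second difference. -/
def diffWeight (i j : ℤ × ℤ) (p : ℝ) : ℂ :=
  stepWeight j.1 j.2 p * stepWeight (-i.1) (-i.2) p / Real.sinh (decayRate p)

/-- The linearization of `diffWeight` at zero frequency. -/
def diffSlope (i j : ℤ × ℤ) : ℂ := stepSlope j.1 j.2 * stepSlope (-i.1) (-i.2)

theorem exists_diffWeight_bound (i j : ℤ × ℤ) : ∃ C : ℝ, 0 ≤ C ∧ ∀ p, 0 < p → p ≤ π →
    ‖diffWeight i j p - p * diffSlope i j‖ ≤ C * p ^ 2 := by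
  obtain ⟨C₁, hC₁, h₁⟩ := exists_stepWeight_bound j.1 j.2
  obtain ⟨C₂, hC₂, h₂⟩ := exists_stepWeight_bound (-i.1) (-i.2)
  set w₁ := stepSlope j.1 j.2 with hw₁
  set w₂ := stepSlope (-i.1) (-i.2) with hw₂
  set D := C₁ * (‖w₂‖ + C₂ * π) + ‖w₁‖ * C₂ with hD
  have hpi := Real.pi_pos
  have hD0 : 0 ≤ D := by positivity
  refine ⟨π * D + π / 2 * ‖w₁ * w₂‖, by positivity, fun p h0 hp => ?_⟩
  set s := Real.sinh (decayRate p) with hs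
  have hspos : 0 < s := sinh_decayRate_pos h0 hp
  have hsp : p / π ≤ s := le_sinh_decayRate h0.le hp
  have hsinv : 1 / s ≤ π / p := by
    rw [div_le_div_iff₀ hspos h0]
    rw [div_le_iff₀ hpi] at hsp
    linarith
  have hsC : (s : ℂ) ≠ 0 := Complex.ofReal_ne_zero.2 hspos.ne'
  set A := stepWeight j.1 j.2 p with hA
  set B := stepWeight (-i.1) (-i.2) p with hB
  have hBn : ‖B‖ ≤ p * (‖w₂‖ + C₂ * π) := by
    have : B = (B - p * w₂) + p * w₂ := by ring
    rw [this]
    refine (norm_add_le _ _).trans ?_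
    have h3 := h₂ p h0 hp
    have h4 : ‖(p : ℂ) * w₂‖ = p * ‖w₂‖ := by simp [abs_of_pos h0]
    have h5 : C₂ * p ^ 2 ≤ C₂ * (p * π) := by gcongr; nlinarith
    rw [h4]
    nlinarith
  have e1 : ‖A * B - p ^ 2 * (w₁ * w₂)‖ ≤ p ^ 3 * D := by
    calc ‖A * B - p ^ 2 * (w₁ * w₂)‖ = ‖(A - p * w₁) * B + p * w₁ * (B - p * w₂)‖ := by
          congr 1; ring
      _ ≤ ‖A - p * w₁‖ * ‖B‖ + p * ‖w₁‖ * ‖B - p * w₂‖ := by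
          refine (norm_add_le _ _).trans (le_of_eq ?_)
          simp [abs_of_pos h0]
      _ ≤ (C₁ * p ^ 2) * (p * (‖w₂‖ + C₂ * π)) + p * ‖w₁‖ * (C₂ * p ^ 2) := by
          have := h₁ p h0 hp
          have := h₂ p h0 hp
          gcongr
      _ = _ := by rw [hD]; ring
  have e2 : ‖(p - s : ℂ)‖ ≤ p ^ 2 / 2 := by
    rw [← Complex.ofReal_sub, Complex.norm_real, Real.norm_eq_abs, abs_sub_comm]
    exact abs_sinh_decayRate_sub_le h0.le hp
  calc ‖diffWeight i j p - p * diffSlope i j‖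
      = ‖((A * B - p ^ 2 * (w₁ * w₂)) + p * (w₁ * w₂) * (p - s)) / s‖ := by
        congr 1
        rw [show diffWeight i j p = A * B / s from rfl, show diffSlope i j = w₁ * w₂ from rfl]
        field_simp
        ring
    _ = ‖(A * B - p ^ 2 * (w₁ * w₂)) + p * (w₁ * w₂) * (p - s)‖ * (1 / s) := by
        rw [norm_div, Complex.norm_real, Real.norm_eq_abs, abs_of_pos hspos, div_eq_mul_one_div]
    _ ≤ (p ^ 3 * D + p * ‖w₁ * w₂‖ * (p ^ 2 / 2)) * (π / p) := by
        gcongr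
        refine (norm_add_le _ _).trans (add_le_add e1 ?_)
        rw [norm_mul, norm_mul, Complex.norm_real, Real.norm_eq_abs, abs_of_pos h0]
        gcongr
    _ = _ := by field_simp

/-- Replacing exp(-αy) by exp(-py) costs a factor y p², because p - α ≤ p²/2, and multiplies the
linear weight; this gives y p³. Linearizing the weight costs p². The bound α ≥ p/π makes exp(-yp/π)
a common majorant. -/
theorem exists_integrand_bound (i j : ℤ × ℤ) : ∃ C : ℝ, 0 ≤ C ∧ ∀ x y p : ℝ, 0 ≤ y → 0 < p →
    p ≤ π → ‖Complex.exp (p * x * Complex.I - decayRate p * y) * diffWeight i j p -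
      p * Complex.exp (-((y - x * Complex.I) * p)) * diffSlope i j‖ ≤
      C * ((y * p ^ 3 + p ^ 2) * Real.exp (-(y / π * p))) := by
  obtain ⟨C, hC, h⟩ := exists_diffWeight_bound i j
  have hpi := Real.pi_pos
  refine ⟨‖diffSlope i j‖ + C, by positivity, fun x y p hy h0 hp => ?_⟩
  have hα := decayRate_nonneg p
  have hαp := decayRate_le h0.le hp
  have hαl := le_decayRate h0.le hp
  have hαs := sub_decayRate_le h0.le hp
  have hE1 : Real.exp (-(decayRate p * y)) ≤ Real.exp (-(y / π * p)) := by
    rw [Real.exp_le_exp]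
    have : p / π * y ≤ decayRate p * y := by gcongr
    have e : y / π * p = p / π * y := by ring
    linarith
  have hn1 : ‖Complex.exp (p * x * Complex.I - decayRate p * y)‖ =
      Real.exp (-(decayRate p * y)) := by
    rw [Complex.norm_exp]
    simp
  have hdiff : ‖Complex.exp (p * x * Complex.I - decayRate p * y) -
      Complex.exp (-((y - x * Complex.I) * p))‖ ≤ y * p ^ 2 * Real.exp (-(y / π * p)) := by
    have e : Complex.exp (-((y - x * Complex.I) * p)) =
        Complex.exp (p * x * Complex.I - decayRate p * y) *
          (Real.exp (-((p - decayRate p) * y)) : ℝ) := by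
      rw [Complex.ofReal_exp, ← Complex.exp_add]
      congr 1
      push_cast
      ring
    have e2 : Complex.exp (p * x * Complex.I - decayRate p * y) -
      Complex.exp (-((y - x * Complex.I) * p)) =
      Complex.exp (p * x * Complex.I - decayRate p * y) *
        ((1 - Real.exp (-((p - decayRate p) * y)) : ℝ) : ℂ) := by
      rw [e]
      push_cast
      ring
    rw [e2, norm_mul, hn1, Complex.norm_real, Real.norm_eq_abs, mul_comm]
    gcongr
    have h1 := Real.add_one_le_exp (-((p - decayRate p) * y))
    have h2 : Real.exp (-((p - decayRate p) * y)) ≤ 1 := Real.exp_le_one_iff.2 (by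
      have := mul_nonneg (sub_nonneg.2 hαp) hy
      linarith)
    rw [abs_of_nonneg (by linarith)]
    have h3 : (p - decayRate p) * y ≤ p ^ 2 / 2 * y := by gcongr
    nlinarith [sq_nonneg p, mul_nonneg (sq_nonneg p) hy]
  calc _ = ‖Complex.exp (p * x * Complex.I - decayRate p * y) *
          (diffWeight i j p - p * diffSlope i j) +
        (Complex.exp (p * x * Complex.I - decayRate p * y) -
          Complex.exp (-((y - x * Complex.I) * p))) * (p * diffSlope i j)‖ := by
        congr 1; ring
    _ ≤ Real.exp (-(y / π * p)) * (C * p ^ 2) +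
        y * p ^ 2 * Real.exp (-(y / π * p)) * (p * ‖diffSlope i j‖) := by
        refine (norm_add_le _ _).trans (add_le_add ?_ ?_)
        · rw [norm_mul, hn1]
          gcongr
          exact h p h0 hp
        · rw [norm_mul, norm_mul, Complex.norm_real, Real.norm_eq_abs, abs_of_pos h0]
          gcongr
    _ ≤ _ := by
        have hE := Real.exp_pos (-(y / π * p))
        have k1 : 0 ≤ ‖diffSlope i j‖ * (p ^ 2 * Real.exp (-(y / π * p))) := by positivity
        have k2 : 0 ≤ C * (y * p ^ 3 * Real.exp (-(y / π * p))) := by positivity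
        nlinarith

theorem integrableOn_pow_mul_exp {b : ℝ} (hb : 0 < b) (k : ℕ) :
    IntegrableOn (fun p : ℝ => p ^ k * Real.exp (-(b * p))) (Set.Ioi 0) := by
  have h := integrableOn_rpow_mul_exp_neg_mul_rpow (p := 1) (s := k) (b := b)
    (by have := Nat.cast_nonneg (α := ℝ) k; linarith) one_pos hb
  simpa [Real.rpow_natCast, neg_mul] using h

theorem integral_pow_mul_exp {b : ℝ} (hb : 0 < b) (k : ℕ) :
    ∫ p in Set.Ioi (0 : ℝ), p ^ k * Real.exp (-(b * p)) = k.factorial / b ^ (k + 1) := by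
  have h := Real.integral_rpow_mul_exp_neg_mul_Ioi (a := k + 1) (r := b) (by positivity) hb
  rw [add_sub_cancel_right, Real.Gamma_nat_eq_factorial] at h
  have e : ((k : ℝ) + 1) = ((k + 1 : ℕ) : ℝ) := by push_cast; ring
  rw [e, Real.rpow_natCast] at h
  simp only [Real.rpow_natCast] at h
  rw [h, one_div, inv_pow, mul_comm, div_eq_mul_inv]

theorem norm_cexp_neg_mul (x y p : ℝ) :
    ‖Complex.exp (-((y - x * Complex.I) * p))‖ = Real.exp (-(y * p)) := by
  rw [Complex.norm_exp]
  simp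

theorem integrableOn_mul_cexp (x : ℝ) {y : ℝ} (hy : 0 < y) :
    IntegrableOn (fun p : ℝ => (p : ℂ) * Complex.exp (-((y - x * Complex.I) * p)))
      (Set.Ioi 0) := by
  refine Integrable.mono' (integrableOn_pow_mul_exp hy 1)
    (Continuous.aestronglyMeasurable (by fun_prop)) ?_
  refine (ae_restrict_iff' measurableSet_Ioi).2 (Eventually.of_forall fun p hp => ?_)
  rw [norm_mul, norm_cexp_neg_mul, Complex.norm_real, Real.norm_eq_abs, abs_of_pos hp, pow_one]

theorem integral_mul_cexp (x : ℝ) {y : ℝ} (hy : 0 < y) :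
    ∫ p in Set.Ioi (0 : ℝ), (p : ℂ) * Complex.exp (-((y - x * Complex.I) * p)) =
      1 / (y - x * Complex.I) ^ 2 := by
  set s : ℂ := y - x * Complex.I with hs
  have hs0 : s ≠ 0 := fun h => by
    have := congrArg Complex.re h
    simp [hs] at this
    exact hy.ne' this
  have hderiv : ∀ p ∈ Set.Ici (0 : ℝ), HasDerivAt
      (fun p : ℝ => -((p : ℂ) / s + 1 / s ^ 2) * Complex.exp (-(s * p)))
      ((p : ℂ) * Complex.exp (-(s * p))) p := by
    intro p _
    have h1 : HasDerivAt (fun p : ℝ => (p : ℂ)) 1 p := Complex.ofRealCLM.hasDerivAt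
    have h2 := ((h1.const_mul s).fun_neg.cexp)
    have h3 := ((h1.div_const s).add_const (1 / s ^ 2)).fun_neg.fun_mul h2
    refine h3.congr_deriv ?_
    field_simp
    ring
  have hlim : Tendsto (fun p : ℝ => -((p : ℂ) / s + 1 / s ^ 2) * Complex.exp (-(s * p))) atTop
      (𝓝 0) := by
    rw [tendsto_zero_iff_norm_tendsto_zero]
    have h1 := (Real.tendsto_pow_mul_exp_neg_atTop_nhds_zero 1).comp
      (tendsto_id.const_mul_atTop hy)
    have h0 := (Real.tendsto_pow_mul_exp_neg_atTop_nhds_zero 0).comp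
      (tendsto_id.const_mul_atTop hy)
    have h2 := (h1.const_mul (1 / (y * ‖s‖))).add (h0.const_mul (1 / ‖s‖ ^ 2))
    rw [mul_zero, mul_zero, add_zero] at h2
    refine squeeze_zero' (Eventually.of_forall fun _ => norm_nonneg _) ?_ h2
    filter_upwards [eventually_gt_atTop 0] with p hp
    have hsn : 0 < ‖s‖ := norm_pos_iff.2 hs0
    rw [norm_mul, norm_neg, hs, norm_cexp_neg_mul, ← hs]
    simp only [Function.comp, id, pow_one, pow_zero]
    have h3 : ‖(p : ℂ) / s + 1 / s ^ 2‖ ≤ p / ‖s‖ + 1 / ‖s‖ ^ 2 := by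
      refine (norm_add_le _ _).trans (le_of_eq ?_)
      simp [abs_of_pos hp]
    calc _ ≤ (p / ‖s‖ + 1 / ‖s‖ ^ 2) * Real.exp (-(y * p)) := by gcongr
      _ = _ := by field_simp
  have := integral_Ioi_of_hasDerivAt_of_tendsto' hderiv (integrableOn_mul_cexp x hy) hlim
  rw [this]
  simp

theorem measurable_diffWeight (i j : ℤ × ℤ) : Measurable (diffWeight i j) := by
  have := continuous_decayRate.measurable
  unfold diffWeight stepWeight
  fun_prop

theorem exists_integral_bound (i j : ℤ × ℤ) : ∃ C : ℝ, 0 ≤ C ∧ ∀ x y : ℝ, 0 < y →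
    IntegrableOn (fun p : ℝ => Complex.exp (p * x * Complex.I - decayRate p * y) *
      diffWeight i j p) (Set.Ioc 0 π) ∧
    ‖(∫ p in Set.Ioc 0 π, Complex.exp (p * x * Complex.I - decayRate p * y) * diffWeight i j p) -
      diffSlope i j / (y - x * Complex.I) ^ 2‖ ≤ C / y ^ 3 := by
  obtain ⟨C, hC, h⟩ := exists_integrand_bound i j
  have hpi := Real.pi_pos
  set κ := ‖diffSlope i j‖ with hκ
  have hκ0 : 0 ≤ κ := norm_nonneg _
  -- The integrals of y p³ exp(-yp/π) and p² exp(-yp/π) are 6π⁴/y³ and 2π³/y³. The summand κ pays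
  -- for extending the leading integral beyond π, where p ≥ 1 gives p ≤ p².
  refine ⟨(C + κ) * (6 * π ^ 4 + 2 * π ^ 3), by positivity, fun x y hy => ?_⟩
  set F : ℝ → ℂ := fun p => Complex.exp (p * x * Complex.I - decayRate p * y) * diffWeight i j p
    with hF
  set F₀ : ℝ → ℂ := fun p => p * Complex.exp (-((y - x * Complex.I) * p)) * diffSlope i j with hF₀
  set bd : ℝ → ℝ := fun p => (y * p ^ 3 + p ^ 2) * Real.exp (-(y / π * p)) with hbd
  have hb : 0 < y / π := by positivity
  have hbdeq : bd = fun p => y * (p ^ 3 * Real.exp (-(y / π * p))) +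
      p ^ 2 * Real.exp (-(y / π * p)) := by
    funext p
    rw [hbd]
    ring
  have hbdint : IntegrableOn bd (Set.Ioi 0) := by
    rw [hbdeq]
    exact ((integrableOn_pow_mul_exp hb 3).const_mul y).add (integrableOn_pow_mul_exp hb 2)
  have hbdval : ∫ p in Set.Ioi (0 : ℝ), bd p = (6 * π ^ 4 + 2 * π ^ 3) / y ^ 3 := by
    rw [hbdeq, integral_add ((integrableOn_pow_mul_exp hb 3).const_mul y)
      (integrableOn_pow_mul_exp hb 2), integral_const_mul, integral_pow_mul_exp hb,
      integral_pow_mul_exp hb]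
    norm_num [Nat.factorial]
    field_simp
  have hF₀int : IntegrableOn F₀ (Set.Ioi 0) := (integrableOn_mul_cexp x hy).mul_const _
  have hFmeas : Measurable F := by
    have := continuous_decayRate.measurable
    have := measurable_diffWeight i j
    fun_prop
  have hsub : Set.Ioc (0 : ℝ) π ⊆ Set.Ioi 0 := fun p hp => hp.1
  have hFint : IntegrableOn F (Set.Ioc 0 π) := by
    refine Integrable.mono' (g := fun p => C * bd p + ‖F₀ p‖)
      (((hbdint.mono_set hsub).const_mul C).add (hF₀int.mono_set hsub).norm)
      hFmeas.aestronglyMeasurable ?_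
    refine (ae_restrict_iff' measurableSet_Ioc).2 (Eventually.of_forall fun p hp => ?_)
    have h1 := h x y p hy.le hp.1 hp.2
    have h2 := norm_sub_norm_le (F p) (F₀ p)
    simp only [hF, hF₀, hbd] at *
    linarith
  refine ⟨hFint, ?_⟩
  have hFi : Integrable ((Set.Ioc (0 : ℝ) π).indicator F) (volume.restrict (Set.Ioi 0)) := by
    rw [integrable_indicator_iff measurableSet_Ioc, IntegrableOn,
      Measure.restrict_restrict measurableSet_Ioc, Set.inter_eq_left.2 hsub]
    exact hFint
  have e1 : ∫ p in Set.Ioc 0 π, F p = ∫ p in Set.Ioi 0, (Set.Ioc (0 : ℝ) π).indicator F p := by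
    rw [integral_indicator measurableSet_Ioc, Measure.restrict_restrict measurableSet_Ioc,
      Set.inter_eq_left.2 hsub]
  have e2 : diffSlope i j / (y - x * Complex.I) ^ 2 = ∫ p in Set.Ioi 0, F₀ p := by
    rw [hF₀, integral_mul_const, integral_mul_cexp x hy]
    ring
  rw [e1, e2, ← integral_sub hFi hF₀int]
  have hle : ∀ᵐ p ∂(volume.restrict (Set.Ioi (0 : ℝ))),
      ‖(Set.Ioc (0 : ℝ) π).indicator F p - F₀ p‖ ≤ (C + κ) * bd p := by
    refine (ae_restrict_iff' measurableSet_Ioi).2 (Eventually.of_forall fun p hp => ?_)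
    have hp0 : (0 : ℝ) < p := hp
    have hbd0 : 0 ≤ bd p := by simp only [hbd]; positivity
    by_cases hpπ : p ≤ π
    · rw [Set.indicator_of_mem (show p ∈ Set.Ioc 0 π from ⟨hp0, hpπ⟩)]
      refine (h x y p hy.le hp0 hpπ).trans ?_
      exact mul_le_mul_of_nonneg_right (le_add_of_nonneg_right hκ0) hbd0
    · rw [Set.indicator_of_notMem (fun hm => hpπ hm.2), zero_sub, norm_neg]
      have hp1 : 1 ≤ p := by linarith [Real.pi_gt_three]
      have hE : Real.exp (-(y * p)) ≤ Real.exp (-(y / π * p)) := by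
        rw [Real.exp_le_exp]
        have : y / π ≤ y := div_le_self hy.le (by linarith [Real.pi_gt_three])
        have := mul_le_mul_of_nonneg_right this hp0.le
        linarith
      have h3 : ‖F₀ p‖ ≤ κ * bd p := by
        simp only [hF₀, hbd]
        rw [norm_mul, norm_mul, norm_cexp_neg_mul, Complex.norm_real, Real.norm_eq_abs,
          abs_of_pos hp0, mul_comm, ← hκ]
        gcongr
        have : 0 ≤ y * p ^ 3 := by positivity
        nlinarith
      refine h3.trans ?_
      gcongr
      linarith
  refine (norm_integral_le_of_norm_le (hbdint.const_mul (C + κ)) hle).trans (le_of_eq ?_)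
  rw [integral_const_mul, hbdval]
  ring

end Asymptotics

/-! ### Asymptotics of the second differences -/

section MixedDifference

open MeasureTheory
open scoped Real

/-- The second difference of the lattice Green function at `d`, with increments `-i` and `j`. -/
def mixedDiff (d i j : ℤ × ℤ) : ℝ :=
  latticeGreen (d + j - i) - latticeGreen (d - i) - latticeGreen (d + j) + latticeGreen d

/-- The leading term of `mixedDiff`: a second derivative of the continuum Green function. -/
def mixedLead (d i j : ℤ × ℤ) : ℝ :=
  -(1 / (2 * π)) * ((((i.1 * j.1 - i.2 * j.2 : ℤ) : ℝ) * ((d.1 : ℝ) ^ 2 - (d.2 : ℝ) ^ 2) +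
    ((i.1 * j.2 + i.2 * j.1 : ℤ) : ℝ) * (2 * d.1 * d.2)) / ((d.1 : ℝ) ^ 2 + (d.2 : ℝ) ^ 2) ^ 2)

theorem greenKernel_eq_re {x y : ℤ} (hy : 0 ≤ y) (p : ℝ) :
    greenKernel (x, y) p =
      ((Complex.exp (p * x * Complex.I - decayRate p * y)).re - 1) / Real.sinh (decayRate p) := by
  have hy' : (0 : ℝ) ≤ y := by exact_mod_cast hy
  rw [greenKernel, Complex.exp_re]
  simp only [abs_of_nonneg hy']
  simp
  ring

/-- The sign conditions keep the four points in the upper half plane, where |y| = y and each kernel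
is the real part of one exponential; there the second difference factorises and the constants -1
cancel. -/
theorem mixedDiff_eq_integral {x y : ℤ} (i j : ℤ × ℤ) (h0 : 0 ≤ y) (h1 : 0 ≤ y + j.2 - i.2)
    (h2 : 0 ≤ y - i.2) (h3 : 0 ≤ y + j.2)
    (hint : IntegrableOn (fun p : ℝ => Complex.exp (p * (x : ℝ) * Complex.I -
      decayRate p * (y : ℝ)) * diffWeight i j p) (Set.Ioc 0 π)) :
    mixedDiff (x, y) i j = 1 / (2 * π) * (∫ p in Set.Ioc 0 π,
      Complex.exp (p * (x : ℝ) * Complex.I - decayRate p * (y : ℝ)) * diffWeight i j p).re := by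
  have hI := intervalIntegrable_greenKernel
  have e : (∫ p in Set.Ioc 0 π, Complex.exp (p * (x : ℝ) * Complex.I - decayRate p * (y : ℝ)) *
      diffWeight i j p).re = ∫ p in Set.Ioc 0 π, (Complex.exp (p * (x : ℝ) * Complex.I -
        decayRate p * (y : ℝ)) * diffWeight i j p).re := by
    have := integral_re (𝕜 := ℂ) hint
    simpa using this.symm
  rw [e, ← intervalIntegral.integral_of_le Real.pi_pos.le, mixedDiff, latticeGreen_eq,
    latticeGreen_eq, latticeGreen_eq, latticeGreen_eq, ← mul_sub, ← mul_sub, ← mul_add,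
    ← intervalIntegral.integral_sub (hI _) (hI _),
    ← intervalIntegral.integral_sub ((hI _).sub (hI _)) (hI _),
    ← intervalIntegral.integral_add (((hI _).sub (hI _)).sub (hI _)) (hI _)]
  congr 1
  refine intervalIntegral.integral_congr fun p _ => ?_
  obtain ⟨i1, i2⟩ := i
  obtain ⟨j1, j2⟩ := j
  simp only [Prod.mk_add_mk, Prod.mk_sub_mk] at *
  rw [greenKernel_eq_re h1, greenKernel_eq_re h2, greenKernel_eq_re h3, greenKernel_eq_re h0,
    diffWeight, stepWeight, stepWeight]
  set E := fun a b : ℤ => Complex.exp (p * a * Complex.I - decayRate p * b) with hE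
  have hadd : ∀ a b a' b' : ℤ, E (a + a') (b + b') = E a b * E a' b' := fun a b a' b' => by
    simp only [hE, ← Complex.exp_add]
    congr 1
    push_cast
    ring
  have q0 : Complex.exp (p * (x : ℝ) * Complex.I - decayRate p * (y : ℝ)) = E x y := by simp [hE]
  have q1 : Complex.exp (p * (j1 : ℝ) * Complex.I - decayRate p * (j2 : ℝ)) = E j1 j2 := by
    simp [hE]
  have q2 : Complex.exp (p * ((-i1 : ℝ) : ℂ) * Complex.I - decayRate p * ((-i2 : ℝ) : ℂ)) =
      E (-i1) (-i2) := by
    simp [hE]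
  change ((E (x + j1 - i1) (y + j2 - i2)).re - 1) / _ - ((E (x - i1) (y - i2)).re - 1) / _ -
    ((E (x + j1) (y + j2)).re - 1) / _ + ((E x y).re - 1) / _ = _
  rw [q0, q1, q2, sub_eq_add_neg (x + j1), sub_eq_add_neg (y + j2), sub_eq_add_neg x,
    sub_eq_add_neg y, hadd (x + j1), hadd x y j1, hadd x y (-i1), ← mul_div_assoc,
    Complex.div_ofReal_re, ← sub_div, ← sub_div, ← add_div]
  congr 1
  rw [show E x y * ((E j1 j2 - 1) * (E (-i1) (-i2) - 1)) =
    E x y * E j1 j2 * E (-i1) (-i2) - E x y * E (-i1) (-i2) - E x y * E j1 j2 + E x y by ring]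
  simp only [Complex.add_re, Complex.sub_re]
  ring

theorem mixedLead_eq (x y : ℤ) (i j : ℤ × ℤ) :
    mixedLead (x, y) i j =
      1 / (2 * π) * (diffSlope i j / ((y : ℝ) - (x : ℝ) * Complex.I) ^ 2).re := by
  have e : ((y : ℝ) - (x : ℝ) * Complex.I : ℂ) ^ 2 =
      (((y : ℝ) ^ 2 - (x : ℝ) ^ 2 : ℝ) : ℂ) + ((-(2 * x * y) : ℝ) : ℂ) * Complex.I := by
    push_cast
    linear_combination (x : ℂ) ^ 2 * Complex.I_sq
  have hn : Complex.normSq ((((y : ℝ) ^ 2 - (x : ℝ) ^ 2 : ℝ) : ℂ) +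
      ((-(2 * x * y) : ℝ) : ℂ) * Complex.I) = ((x : ℝ) ^ 2 + (y : ℝ) ^ 2) ^ 2 := by
    rw [Complex.normSq_add_mul_I]
    ring
  have r1 : ∀ A B : ℝ, ((A : ℂ) + B * Complex.I).re = A := by simp
  have r2 : ∀ A B : ℝ, ((A : ℂ) + B * Complex.I).im = B := by simp
  rw [e, Complex.div_re, hn, r1, r2, ← add_div, mixedLead, neg_mul, ← mul_neg, ← neg_div]
  congr 2
  simp [diffSlope, stepSlope]
  ring

theorem siteToComplex_sub (i j : ℤ × ℤ) :
    siteToComplex (i - j) = siteToComplex i - siteToComplex j := by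
  apply Complex.ext <;> simp [siteToComplex]

theorem norm_siteToComplex (d : ℤ × ℤ) :
    ‖siteToComplex d‖ = √((d.1 : ℝ) ^ 2 + (d.2 : ℝ) ^ 2) := by
  rw [Complex.norm_def, Complex.normSq_apply, siteToComplex]
  congr 1
  ring

theorem exists_mixedDiff_bound_upper (i j : ℤ × ℤ) : ∃ C R : ℝ, 0 ≤ C ∧ 0 < R ∧
    ∀ x y : ℤ, |x| ≤ y → R ≤ ‖siteToComplex (x, y)‖ →
      |mixedDiff (x, y) i j - mixedLead (x, y) i j| ≤ C / ‖siteToComplex (x, y)‖ ^ 3 := by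
  obtain ⟨C, hC, h⟩ := exists_integral_bound i j
  -- In the sector |x| ≤ y one has ‖d‖ ≤ 2y, whence the factor 2³; the radius keeps all four points
  -- of the second difference in the upper half plane.
  refine ⟨C * 8, 2 * (1 + |(i.2 : ℝ)| + |(j.2 : ℝ)|), by positivity, by positivity, ?_⟩
  intro x y hxy hR
  have hxy' : |(x : ℝ)| ≤ y := by exact_mod_cast hxy
  have hy0 : (0 : ℝ) ≤ y := (abs_nonneg _).trans hxy'
  have hle : ‖siteToComplex (x, y)‖ ≤ 2 * y := by
    rw [norm_siteToComplex]
    refine Real.sqrt_le_iff.2 ⟨by positivity, ?_⟩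
    have h2 : (x : ℝ) ^ 2 ≤ (y : ℝ) ^ 2 := sq_le_sq.2 (by rwa [abs_of_nonneg hy0])
    simp only
    nlinarith
  have hbig : 1 + |(i.2 : ℝ)| + |(j.2 : ℝ)| ≤ y := by linarith
  have hbig' : 1 + |i.2| + |j.2| ≤ y := by exact_mod_cast hbig
  have a1 := neg_abs_le j.2
  have a2 := le_abs_self i.2
  have a3 := abs_nonneg i.2
  have a4 := abs_nonneg j.2
  have hy1 : (0 : ℝ) < y := by
    have : (0 : ℤ) < y := by omega
    exact_mod_cast this
  obtain ⟨hint, hb⟩ := h x y hy1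
  rw [mixedDiff_eq_integral i j (by omega) (by omega) (by omega) (by omega) hint, mixedLead_eq,
    ← mul_sub, ← Complex.sub_re, abs_mul]
  have hpi : |1 / (2 * π)| ≤ 1 := by
    rw [abs_of_pos (by positivity), div_le_one (by positivity)]
    linarith [Real.pi_gt_three]
  have hpos : 0 < ‖siteToComplex (x, y)‖ := lt_of_lt_of_le (by positivity) hR
  calc _ ≤ 1 * (C / (y : ℝ) ^ 3) :=
        mul_le_mul hpi ((Complex.abs_re_le_norm _).trans hb) (abs_nonneg _) zero_le_one
    _ = C * 8 / (2 * y) ^ 3 := by field_simp; ring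
    _ ≤ C * 8 / ‖siteToComplex (x, y)‖ ^ 3 := by gcongr

theorem mixedDiff_neg_snd (x y i1 i2 j1 j2 : ℤ) :
    mixedDiff (x, -y) (i1, -i2) (j1, -j2) = mixedDiff (x, y) (i1, i2) (j1, j2) := by
  simp only [mixedDiff, Prod.mk_add_mk, Prod.mk_sub_mk]
  rw [← latticeGreen_neg_snd _ (y + j2 - i2), ← latticeGreen_neg_snd _ (y - i2),
    ← latticeGreen_neg_snd _ (y + j2), ← latticeGreen_neg_snd _ y]
  ring_nf

theorem mixedDiff_swap (x y i1 i2 j1 j2 : ℤ) :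
    mixedDiff (y, x) (i2, i1) (j2, j1) = mixedDiff (x, y) (i1, i2) (j1, j2) := by
  simp only [mixedDiff, Prod.mk_add_mk, Prod.mk_sub_mk]
  rw [latticeGreen_swap (x + j1 - i1), latticeGreen_swap (x - i1), latticeGreen_swap (x + j1),
    latticeGreen_swap x]

theorem exists_mixedDiff_bound_sector (i j : ℤ × ℤ) : ∃ C R : ℝ, 0 ≤ C ∧ 0 < R ∧
    ∀ x y : ℤ, |x| ≤ |y| → R ≤ ‖siteToComplex (x, y)‖ →
      |mixedDiff (x, y) i j - mixedLead (x, y) i j| ≤ C / ‖siteToComplex (x, y)‖ ^ 3 := by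
  obtain ⟨C, R, hC, hR, h⟩ := exists_mixedDiff_bound_upper i j
  obtain ⟨C', R', hC', hR', h'⟩ := exists_mixedDiff_bound_upper (i.1, -i.2) (j.1, -j.2)
  refine ⟨max C C', max R R', hC.trans (le_max_left _ _), hR.trans_le (le_max_left _ _), ?_⟩
  intro x y hxy hr
  rcases le_total 0 y with hy | hy
  · rw [abs_of_nonneg hy] at hxy
    refine (h x y hxy ((le_max_left _ _).trans hr)).trans ?_
    gcongr
    exact le_max_left _ _
  · rw [abs_of_nonpos hy] at hxy
    have hn : ‖siteToComplex (x, -y)‖ = ‖siteToComplex (x, y)‖ := by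
      simp [norm_siteToComplex]
    have hl : mixedLead (x, -y) (i.1, -i.2) (j.1, -j.2) = mixedLead (x, y) i j := by
      simp only [mixedLead]
      push_cast
      ring_nf
    have := h' x (-y) hxy (by rw [hn]; exact (le_max_right _ _).trans hr)
    rw [hn, hl, mixedDiff_neg_snd] at this
    refine this.trans ?_
    gcongr
    exact le_max_right _ _

/-- The second differences of the lattice Green function are asymptotic to those of
`(1 / 2π) log r`, up to terms of order `r⁻³`. -/
theorem exists_mixedDiff_bound (i j : ℤ × ℤ) : ∃ C R : ℝ, 0 ≤ C ∧ 0 < R ∧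
    ∀ d : ℤ × ℤ, R ≤ ‖siteToComplex d‖ →
      |mixedDiff d i j - mixedLead d i j| ≤ C / ‖siteToComplex d‖ ^ 3 := by
  obtain ⟨C, R, hC, hR, h⟩ := exists_mixedDiff_bound_sector i j
  obtain ⟨C', R', hC', hR', h'⟩ := exists_mixedDiff_bound_sector i.swap j.swap
  refine ⟨max C C', max R R', hC.trans (le_max_left _ _), hR.trans_le (le_max_left _ _), ?_⟩
  rintro ⟨x, y⟩ hr
  rcases le_total |x| |y| with hxy | hxy
  · refine (h x y hxy ((le_max_left _ _).trans hr)).trans ?_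
    gcongr
    exact le_max_left _ _
  · have hn : ‖siteToComplex (y, x)‖ = ‖siteToComplex (x, y)‖ := by
      simp [norm_siteToComplex, add_comm]
    have hl : mixedLead (y, x) i.swap j.swap = mixedLead (x, y) i j := by
      simp only [mixedLead, Prod.fst_swap, Prod.snd_swap]
      push_cast
      ring_nf
    have := h' y x hxy (by rw [hn]; exact (le_max_right _ _).trans hr)
    rw [hn, hl, show mixedDiff (y, x) i.swap j.swap = mixedDiff (x, y) i j from
      mixedDiff_swap _ _ _ _ _ _] at this
    refine this.trans ?_
    gcongr
    exact le_max_right _ _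

/-- The coordinates of a site. -/
def siteVec (i : ℤ × ℤ) : Fin 2 → ℝ := ![(i.1 : ℝ), (i.2 : ℝ)]

theorem mixedLead_eq_angularN (d i j : ℤ × ℤ) : mixedLead d i j =
    ∑ a, ∑ b, siteVec i a * angularN (siteToComplex d) a b * siteVec j b := by
  rw [angularN_eq]
  simp [Fin.sum_univ_two, siteVec, siteToComplex, mixedLead]
  ring

theorem abs_angularN_le (d : ℂ) (a b : Fin 2) : |angularN d a b| ≤ 1 / ‖d‖ ^ 2 := by
  rw [angularN, Matrix.smul_apply, smul_eq_mul, abs_mul, abs_neg]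
  have h1 : |1 / (2 * π * ‖d‖ ^ 2)| ≤ 1 / ‖d‖ ^ 2 := by
    rw [abs_of_nonneg (by positivity)]
    rcases (norm_nonneg d).eq_or_lt with h | h
    · simp [← h]
    · have := Real.pi_gt_three
      gcongr
      nlinarith [pow_pos h 2]
  have h2 : |(!![Real.cos (2 * d.arg), Real.sin (2 * d.arg);
       Real.sin (2 * d.arg), -Real.cos (2 * d.arg)] : Matrix (Fin 2) (Fin 2) ℝ) a b| ≤ 1 := by
    fin_cases a <;> fin_cases b <;> simp [Real.abs_cos_le_one, Real.abs_sin_le_one]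
  calc _ ≤ 1 / ‖d‖ ^ 2 * 1 := mul_le_mul h1 h2 (abs_nonneg _) (by positivity)
    _ = _ := mul_one _

end MixedDifference

/-! ### Principal minors -/

section Minors

variable {R m ι : Type*} [CommRing R] [DecidableEq m] [DecidableEq ι] {s : ι → Type*}
  [∀ u, Fintype (s u)]

/-- The principal minor of `K` on the rows and columns in `W`. -/
def principalMinor (K : Matrix m m R) (W : Finset m) : R :=
  (K.submatrix (Subtype.val : W → m) Subtype.val).det

theorem det_one_add_eq_sum_principalMinor [Fintype m] (K : Matrix m m R) :
    (1 + K).det = ∑ W : Finset m, principalMinor K W := by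
  rw [add_comm]
  have h := (Matrix.detRowAlternating : (m → R) [⋀^m]→ₗ[R] R).map_add_univ (fun i => K i)
    (fun i => (1 : Matrix m m R) i)
  refine Eq.trans h ?_
  exact Finset.sum_congr rfl fun W _ => Matrix.det_piecewise_one_eq_submatrix_det K W

theorem principalMinor_univ [Fintype m] (K : Matrix m m R) : principalMinor K Finset.univ = K.det :=
  Matrix.det_submatrix_equiv_self (Equiv.subtypeUnivEquiv (p := (· ∈ Finset.univ))
    Finset.mem_univ) K

theorem principalMinor_map {m' : Type*} [Fintype m'] [DecidableEq m'] (K : Matrix m m R)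
    (e : m' ↪ m) (W : Finset m') :
    principalMinor K (W.map e) = principalMinor (K.submatrix e e) W := by
  let e' : W ≃ W.map e := Equiv.ofBijective
    (fun x => ⟨e x, Finset.mem_map_of_mem e x.2⟩)
    ⟨fun x y h => Subtype.ext (e.injective (congrArg Subtype.val h)), fun y => by
      obtain ⟨x, hx, hxy⟩ := Finset.mem_map.1 y.2
      exact ⟨⟨x, hx⟩, Subtype.ext hxy⟩⟩
  rw [principalMinor, ← Matrix.det_submatrix_equiv_self e']
  rfl

/-- The sum of the principal minors on the sets of indices with exactly one element in each of the
blocks in `V`. -/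
def sectionMinors (K : Matrix (Σ u, s u) (Σ u, s u) R) (V : Finset ι) : R :=
  ∑ i : (u : V) → s u, (Matrix.of fun u v : V => K ⟨u, i u⟩ ⟨v, i v⟩).det

/-- The sum of the principal minors on sections of a matrix that factors through `κ` in each
block. -/
theorem sectionMinors_factor {κ : Type*} [Fintype κ] [DecidableEq κ]
    (K : Matrix (Σ u, s u) (Σ u, s u) R) (X F : (u : ι) → Matrix (s u) κ R)
    (N : ι → ι → Matrix κ κ R)
    (hK : ∀ u v i j, K ⟨u, i⟩ ⟨v, j⟩ = ∑ α, ∑ β, X u i α * N u v α β * F v j β)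
    (V : Finset ι) :
    sectionMinors K V = ∑ σ : Equiv.Perm V, ((Equiv.Perm.sign σ : ℤ) : R) *
      ∑ b : V → κ, ∏ u : V, ((F u).transpose * X u * N u (σ u)) (b u) (b (σ u)) := by
  simp only [sectionMinors]
  have hdet : ∀ i : (u : V) → s u, (Matrix.of fun u v : V => K ⟨u, i u⟩ ⟨v, i v⟩).det =
      ∑ σ : Equiv.Perm V, ((Equiv.Perm.sign σ : ℤ) : R) *
        ∏ u : V, K ⟨u, i u⟩ ⟨σ u, i (σ u)⟩ := fun i => by
    rw [← Matrix.det_transpose, Matrix.det_apply']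
    rfl
  rw [Finset.sum_congr rfl fun i _ => hdet i, Finset.sum_comm]
  refine Finset.sum_congr rfl fun σ _ => ?_
  rw [← Finset.mul_sum]
  congr 1
  have h1 : ∀ i : (u : V) → s u, ∏ u : V, K ⟨u, i u⟩ ⟨σ u, i (σ u)⟩ =
      ∑ b : V → κ, ∑ a : V → κ, (∏ u : V, N u (σ u) (a u) (b (σ u))) *
        ∏ u : V, F u (i u) (b u) * X u (i u) (a u) := fun i => by
    have e1 : ∏ u : V, K ⟨u, i u⟩ ⟨σ u, i (σ u)⟩ = ∑ b : V → κ, ∏ u : V,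
        ∑ α, X u (i u) α * N u (σ u) α (b u) * F (σ u) (i (σ u)) (b u) := by
      rw [← Fintype.prod_sum fun (u : V) (β : κ) =>
        ∑ α, X u (i u) α * N u (σ u) α β * F (σ u) (i (σ u)) β]
      refine Finset.prod_congr rfl fun u _ => ?_
      rw [hK, Finset.sum_comm]
    -- Reindexing by σ attaches the column index of each factor to its own block, so that the site
    -- of block u occurs only in F u and X u and can be summed out.
    rw [e1, ← (Equiv.arrowCongr σ (Equiv.refl κ)).symm.sum_comp]
    refine Finset.sum_congr rfl fun b _ => ?_
    rw [Fintype.prod_sum]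
    refine Finset.sum_congr rfl fun a _ => ?_
    rw [Finset.prod_mul_distrib, Finset.prod_mul_distrib]
    have e2 : ∏ u : V, F (σ u) (i (σ u)) (b (σ u)) = ∏ u : V, F u (i u) (b u) :=
      Equiv.prod_comp σ fun u : V => F u (i u) (b u)
    simp only [Equiv.arrowCongr_symm, Equiv.arrowCongr_apply, Equiv.symm_symm, Equiv.refl_symm,
      Equiv.coe_refl, Function.comp_apply, id]
    rw [e2, Finset.prod_mul_distrib]
    ring
  rw [Finset.sum_congr rfl fun i _ => h1 i, Finset.sum_comm]
  refine Finset.sum_congr rfl fun b _ => ?_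
  rw [Finset.sum_comm]
  have h2 : ∏ u : V, ((F u).transpose * X u * N u (σ u)) (b u) (b (σ u)) =
      ∑ a : V → κ, ∏ u : V, ((F u).transpose * X u) (b u) (a u) * N u (σ u) (a u) (b (σ u)) := by
    rw [← Fintype.prod_sum fun (u : V) (α : κ) =>
      ((F u).transpose * X u) (b u) α * N u (σ u) α (b (σ u))]
    exact Finset.prod_congr rfl fun u _ => Matrix.mul_apply
  rw [h2]
  refine Finset.sum_congr rfl fun a _ => ?_
  rw [← Finset.mul_sum, Finset.prod_mul_distrib, mul_comm]
  congr 1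
  rw [← Fintype.prod_sum fun (u : V) (i : s u) => F u i (b u) * X u i (a u)]
  exact Finset.prod_congr rfl fun u _ => by rw [Matrix.mul_apply]; rfl

variable [Fintype ι] [∀ u, DecidableEq (s u)]

/-- The sum of the principal minors on the sets of indices that meet exactly the blocks in `V`. -/
def blockMinors (K : Matrix (Σ u, s u) (Σ u, s u) R) (V : Finset ι) : R :=
  ∑ W : Finset (Σ u, s u) with W.image Sigma.fst = V, principalMinor K W

/-- The inclusion of some of the blocks. -/
def blockEmbedding (S : Finset ι) : (Σ u : S, s u) ↪ Σ u, s u where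
  toFun a := ⟨a.1, a.2⟩
  inj' := by
    rintro ⟨⟨u, hu⟩, i⟩ ⟨⟨v, hv⟩, j⟩ h
    obtain ⟨h1, h2⟩ := Sigma.mk.inj_iff.1 h
    dsimp only at h1 h2
    subst h1
    rw [eq_of_heq h2]

/-- Principal minors are sorted by the set of blocks that they meet; this puts the correlations in
the form required by `cumulant_sum_powerset`. -/
theorem det_one_add_submatrix (K : Matrix (Σ u, s u) (Σ u, s u) R) (S : Finset ι) :
    (1 + K.submatrix (blockEmbedding S) (blockEmbedding S)).det =
      ∑ V ∈ S.powerset, blockMinors K V := by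
  have h : ∑ V ∈ S.powerset, blockMinors K V =
      ∑ W : Finset (Σ u, s u) with W.image Sigma.fst ⊆ S, principalMinor K W := by
    rw [← Finset.sum_fiberwise_of_maps_to (t := S.powerset)
      (g := fun W : Finset (Σ u, s u) => W.image Sigma.fst)
      (fun W hW => Finset.mem_powerset.2 (Finset.mem_filter.1 hW).2)]
    refine Finset.sum_congr rfl fun V hV => Finset.sum_congr ?_ fun _ _ => rfl
    ext W
    simp only [Finset.mem_filter, Finset.mem_univ, true_and]
    exact ⟨fun h => ⟨h ▸ Finset.mem_powerset.1 hV, h⟩, fun h => h.2⟩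
  rw [h, det_one_add_eq_sum_principalMinor]
  refine Finset.sum_bij (fun W _ => W.map (blockEmbedding S)) (fun W _ => ?_)
    (fun _ _ _ _ h => Finset.map_injective _ h) (fun W hW => ?_) fun W _ => ?_
  · simp only [Finset.mem_filter, Finset.mem_univ, true_and, Finset.subset_iff, Finset.mem_image,
      Finset.mem_map]
    rintro _ ⟨_, ⟨a, _, rfl⟩, rfl⟩
    exact a.1.2
  · have hsub : W ⊆ Finset.univ.map (blockEmbedding S) := fun a ha => by
      have : a.1 ∈ S := (Finset.mem_filter.1 hW).2 (Finset.mem_image_of_mem _ ha)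
      exact Finset.mem_map.2 ⟨⟨⟨a.1, this⟩, a.2⟩, Finset.mem_univ _, rfl⟩
    obtain ⟨W', _, rfl⟩ := Finset.subset_map_iff.1 hsub
    exact ⟨W', Finset.mem_univ _, rfl⟩
  · exact (principalMinor_map _ _ _).symm

theorem blockMinors_empty (K : Matrix (Σ u, s u) (Σ u, s u) R) : blockMinors K ∅ = 1 := by
  rw [blockMinors, Finset.sum_eq_single ∅]
  · exact Matrix.det_isEmpty
  · intro W hW hne
    exact absurd (Finset.image_eq_empty.1 (Finset.mem_filter.1 hW).2) hne
  · simp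

/-- The graph of a choice of one index in each of the blocks in `V`. -/
def sectionEmbedding {V : Finset ι} (i : (u : V) → s u) : V ↪ Σ u, s u where
  toFun u := ⟨u, i u⟩
  inj' _ _ h := Subtype.ext (congrArg Sigma.fst h)

theorem sum_principalMinor_eq_sectionMinors (K : Matrix (Σ u, s u) (Σ u, s u) R) (V : Finset ι) :
    ∑ W : Finset (Σ u, s u) with W.image Sigma.fst = V ∧ W.card = V.card, principalMinor K W =
      sectionMinors K V := by
  symm
  refine Finset.sum_bij (fun i _ => Finset.univ.map (sectionEmbedding i)) (fun i _ => ?_)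
    (fun i _ i' _ h => ?_) (fun W hW => ?_) fun i _ => ?_
  · simp only [Finset.mem_filter, Finset.mem_univ, true_and, Finset.card_map, Finset.card_univ,
      Fintype.card_coe, and_true]
    ext u
    simp only [Finset.mem_image, Finset.mem_map, Finset.mem_univ, true_and]
    constructor
    · rintro ⟨_, ⟨v, rfl⟩, rfl⟩
      exact v.2
    · exact fun hu => ⟨_, ⟨⟨u, hu⟩, rfl⟩, rfl⟩
  · funext u
    have : sectionEmbedding i u ∈ Finset.univ.map (sectionEmbedding i') :=
      h ▸ Finset.mem_map_of_mem _ (Finset.mem_univ u)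
    obtain ⟨v, _, hv⟩ := Finset.mem_map.1 this
    have hvu : v = u := Subtype.ext (congrArg Sigma.fst hv)
    subst hvu
    exact (eq_of_heq (Sigma.mk.inj_iff.1 hv).2).symm
  · obtain ⟨hWV, hc⟩ := (Finset.mem_filter.1 hW).2
    have hinj : Set.InjOn Sigma.fst (W : Set (Σ u, s u)) :=
      Finset.card_image_iff.1 (by rw [hWV, hc])
    have hex : ∀ u : V, ∃ i : s u, (⟨u, i⟩ : Σ u, s u) ∈ W := fun u => by
      obtain ⟨u, hu⟩ := u
      rw [← hWV] at hu
      obtain ⟨⟨v, i⟩, ha, hv⟩ := Finset.mem_image.1 hu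
      subst hv
      exact ⟨i, ha⟩
    choose i hi using hex
    refine ⟨i, Finset.mem_univ _, ?_⟩
    ext a
    simp only [Finset.mem_map, Finset.mem_univ, true_and]
    constructor
    · rintro ⟨u, rfl⟩
      exact hi u
    · intro ha
      have hu : a.1 ∈ V := hWV ▸ Finset.mem_image_of_mem _ ha
      exact ⟨⟨a.1, hu⟩, hinj (hi ⟨a.1, hu⟩) ha rfl⟩
  · rw [principalMinor_map, principalMinor_univ]
    rfl

theorem det_blockDiagonal' {o : Type*} [Fintype o] [DecidableEq o] [LinearOrder o] {q : o → Type*}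
    [∀ u, Fintype (q u)] [∀ u, DecidableEq (q u)] (D : ∀ u, Matrix (q u) (q u) R) :
    (Matrix.blockDiagonal' D).det = ∏ u, (D u).det := by
  rw [(Matrix.blockTriangular_blockDiagonal' D).det_fintype]
  refine Finset.prod_congr rfl fun u _ => ?_
  let e : q u ≃ {a : Σ u, q u // a.1 = u} :=
    { toFun := fun i => ⟨⟨u, i⟩, rfl⟩
      invFun := fun a => a.2 ▸ a.1.2
      left_inv := fun _ => rfl
      right_inv := by rintro ⟨⟨_, i⟩, rfl⟩; rfl }
  rw [← Matrix.det_submatrix_equiv_self e]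
  congr 1
  ext i j
  exact Matrix.blockDiagonal'_apply_eq D u i j

end Minors

/-! ### Correlations as sums of minors of the interaction matrix -/

section Interaction

open Matrix

/-- The matrix `(1 + B_u G_uu)⁻¹ B_u`. -/
def LocalBondModification.resolvent (L : LocalBondModification) : Matrix L.sites L.sites ℝ :=
  (1 + L.block * L.selfGreen)⁻¹ * L.block

/-- The positions of the sites relative to the local origin. -/
def LocalBondModification.position (L : LocalBondModification) : Matrix L.sites (Fin 2) ℝ :=
  fun i => siteVec i

theorem LocalBondModification.selfGreen_transpose (L : LocalBondModification) :
    L.selfGreenᵀ = L.selfGreen := by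
  ext i j
  rw [Matrix.transpose_apply, selfGreen, selfGreen, ← latticeGreen_neg, neg_sub]

/-- The push-through identity (1 + BG)B = B(1 + GB), with B and G symmetric. -/
theorem LocalBondModification.resolvent_transpose (L : LocalBondModification)
    (hp : L.bulkProb ≠ 0) : L.resolventᵀ = L.resolvent := by
  have h1 : IsUnit (1 + L.block * L.selfGreen).det := hp.isUnit
  have h2 : IsUnit (1 + L.selfGreen * L.block).det := by
    rw [Matrix.det_one_add_mul_comm]
    exact h1
  have e : L.resolventᵀ = L.block * (1 + L.selfGreen * L.block)⁻¹ := by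
    rw [resolvent, Matrix.transpose_mul, Matrix.transpose_nonsing_inv, Matrix.transpose_add,
      Matrix.transpose_one, Matrix.transpose_mul, L.block_transpose, L.selfGreen_transpose]
  have key : (1 + L.block * L.selfGreen) * L.block = L.block * (1 + L.selfGreen * L.block) := by
    rw [Matrix.add_mul, Matrix.mul_add, Matrix.one_mul, Matrix.mul_one, Matrix.mul_assoc]
  calc L.resolventᵀ = (1 + L.block * L.selfGreen)⁻¹ * ((1 + L.block * L.selfGreen) * L.block) *
        (1 + L.selfGreen * L.block)⁻¹ := by
        rw [e, Matrix.nonsing_inv_mul_cancel_left _ _ h1]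
    _ = L.resolvent := by
        rw [key, ← Matrix.mul_assoc, Matrix.mul_assoc _ _ (1 + L.selfGreen * L.block)⁻¹,
          Matrix.mul_nonsing_inv _ h2, Matrix.mul_one, resolvent]

theorem LocalBondModification.coeff_eq (L : LocalBondModification) (f g : L.sites → ℝ) :
    L.coeff f g = -L.bulkProb * (f ⬝ᵥ L.resolvent *ᵥ g) := rfl

theorem LocalBondModification.bulkProb_smul_eq (L : LocalBondModification)
    (hp : L.bulkProb ≠ 0) :
    L.bulkProb • (L.positionᵀ * (L.resolvent * L.position)) = -L.M := by
  have hlk : L.coeff L.lVec L.kVec = L.ckl := by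
    rw [ckl, coeff_eq, coeff_eq, Matrix.dotProduct_mulVec, ← Matrix.mulVec_transpose,
      L.resolvent_transpose hp, dotProduct_comm]
  have e : ∀ (a b : Fin 2) (f g : L.sites → ℝ), (∀ i, L.position i a = f i) →
      (∀ i, L.position i b = g i) →
      (L.bulkProb • (L.positionᵀ * (L.resolvent * L.position))) a b = -L.coeff f g := by
    intro a b f g hf hg
    rw [coeff_eq, neg_mul, neg_neg, Matrix.smul_apply, smul_eq_mul]
    congr 1
    simp only [Matrix.mul_apply, Matrix.transpose_apply, dotProduct, Matrix.mulVec, hf, hg]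
  have k0 : ∀ i, L.position i 0 = L.kVec i := fun _ => rfl
  have l0 : ∀ i, L.position i 1 = L.lVec i := fun _ => rfl
  ext a b
  fin_cases a <;> fin_cases b
  · exact e 0 0 _ _ k0 k0
  · exact e 0 1 _ _ k0 l0
  · exact (e 1 0 _ _ l0 k0).trans (by rw [hlk]; rfl)
  · exact e 1 1 _ _ l0 l0

variable {n : ℕ} (L : Fin n → LocalBondModification) (z : Fin n → ℤ × ℤ)

/-- The effective interaction of the modifications. -/
def interaction : Matrix (Σ u, (L u).sites) (Σ u, (L u).sites) ℝ := fun a b =>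
  if a.1 = b.1 then 0 else
    ∑ k, (L a.1).resolvent a.2 k * mixedDiff (z b.1 - z a.1) k b.2

/-- The leading term of the effective interaction. -/
def interactionLead : Matrix (Σ u, (L u).sites) (Σ u, (L u).sites) ℝ := fun a b =>
  ∑ k, (L a.1).resolvent a.2 k * mixedLead (z b.1 - z a.1) k b.2

/-- The off-diagonal part of G is a second difference E plus P and Q. P depends on its column only
through the block, so PB = 0; Q depends on its row only through the block, so BQ = 0. Since P stands
on the wrong side of B in det(1 + BG), it is removed after exchanging the factors by Sylvester's
identity. Factoring the diagonal blocks out of 1 + B(D + E) leaves 1 + K. -/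
theorem lbmCorrelation_eq (hp : ∀ u, (L u).bulkProb ≠ 0) (S : Finset (Fin n)) :
    lbmCorrelation L z S = (∏ u ∈ S, (L u).bulkProb) *
      (1 + (interaction L z).submatrix (blockEmbedding S) (blockEmbedding S)).det := by
  set B := blockB L S with hB
  let D : Matrix (BlockSites L S) (BlockSites L S) ℝ :=
    blockDiagonal' fun u : S => (L u).selfGreen
  let E : Matrix (BlockSites L S) (BlockSites L S) ℝ := fun a b =>
    if a.1 = b.1 then 0 else mixedDiff (z b.1 - z a.1) a.2 b.2
  let P : Matrix (BlockSites L S) (BlockSites L S) ℝ := fun a b =>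
    if a.1 = b.1 then 0 else latticeGreen (z b.1 - z a.1 - a.2)
  let Q : Matrix (BlockSites L S) (BlockSites L S) ℝ := fun a b =>
    if a.1 = b.1 then 0 else
      latticeGreen (z b.1 - z a.1 + b.2) - latticeGreen (z b.1 - z a.1)
  have hG : blockG L z S = D + E + P + Q := by
    ext ⟨u, i⟩ ⟨v, j⟩
    simp only [blockG, Matrix.add_apply]
    rcases eq_or_ne u v with rfl | h
    · simp only [D, E, P, Q, if_true, blockDiagonal'_apply_eq, add_zero,
        LocalBondModification.selfGreen]
      congr 1
      abel
    · simp only [D, E, P, Q, if_neg h, blockDiagonal'_apply_ne _ _ _ h, mixedDiff]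
      rw [show z v + j - (z u + i) = z v - z u + (j : ℤ × ℤ) - i by abel]
      ring
  have hBQ : B * Q = 0 := by
    ext ⟨u, i⟩ b
    rw [Matrix.mul_apply, hB, sum_blockB_mul]
    simp only [Q]
    rw [← Finset.sum_mul, LocalBondModification.block_sum, zero_mul, Matrix.zero_apply]
  have hPB : P * B = 0 := by
    have hBt : Bᵀ = B := by
      rw [hB, blockB, blockDiagonal'_transpose]
      simp only [LocalBondModification.block_transpose]
    rw [← Matrix.transpose_inj, Matrix.transpose_mul, hBt, Matrix.transpose_zero]
    ext ⟨u, i⟩ b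
    rw [Matrix.mul_apply, hB, sum_blockB_mul]
    have hP : ∀ t, Pᵀ ⟨u, t⟩ b = if b.1 = u then 0 else latticeGreen (z u - z b.1 - b.2) :=
      fun _ => rfl
    simp only [hP]
    rw [← Finset.sum_mul, LocalBondModification.block_sum, zero_mul, Matrix.zero_apply]
  have hBE : 1 + B * (D + E) = (blockDiagonal' fun u : S => 1 + (L u).block * (L u).selfGreen) *
      (1 + (interaction L z).submatrix (blockEmbedding S) (blockEmbedding S)) := by
    have e1 : (blockDiagonal' fun u : S => 1 + (L u).block * (L u).selfGreen) = 1 + B * D := by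
      rw [hB, blockB, ← blockDiagonal'_mul, ← blockDiagonal'_one, ← blockDiagonal'_add]
      rfl
    have e2 : (interaction L z).submatrix (blockEmbedding S) (blockEmbedding S) =
        (blockDiagonal' fun u : S => (L u).resolvent) * E := by
      ext ⟨u, i⟩ ⟨v, j⟩
      rw [Matrix.mul_apply, Fintype.sum_sigma, Finset.sum_eq_single u]
      · simp only [blockDiagonal'_apply_eq, E]
        change (if (u : Fin n) = v then 0 else
          ∑ k, (L u).resolvent i k * mixedDiff (z v - z u) k j) = _
        by_cases h : u = v
        · simp [h]
        · rw [if_neg (fun h' => h (Subtype.ext h'))]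
          simp only [if_neg h]
      · intro v _ hv
        simp only [blockDiagonal'_apply_ne _ _ _ hv.symm, zero_mul, Finset.sum_const_zero]
      · simp
    have e3 : (blockDiagonal' fun u : S => 1 + (L u).block * (L u).selfGreen) *
        (blockDiagonal' fun u : S => (L u).resolvent) = B := by
      rw [← blockDiagonal'_mul, hB, blockB]
      congr 1
      funext u
      exact Matrix.mul_nonsing_inv_cancel_left _ _ (hp u).isUnit
    rw [e2, Matrix.mul_add B, Matrix.mul_add (blockDiagonal' _), ← Matrix.mul_assoc, e3,
      Matrix.mul_one, e1, add_assoc]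
  rw [lbmCorrelation, hG, Matrix.mul_add, hBQ, add_zero, Matrix.det_one_add_mul_comm,
    Matrix.add_mul, hPB, add_zero, ← Matrix.det_one_add_mul_comm, hBE, Matrix.det_mul,
    det_blockDiagonal']
  congr 1
  exact Finset.prod_coe_sort S fun u => (L u).bulkProb

theorem lbmConnected_eq (hn : 2 ≤ n) (hp : ∀ u, (L u).bulkProb ≠ 0) :
    lbmConnected L z = (∏ u, (L u).bulkProb) *
      connected (blockMinors (s := fun u => (L u).sites) (interaction L z)) := by
  have h : lbmCorrelation L z = fun S => (∏ u ∈ S, (L u).bulkProb) *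
      ∑ V ∈ S.powerset, blockMinors (s := fun u => (L u).sites) (interaction L z) V := by
    funext S
    rw [lbmCorrelation_eq L z hp]
    congr 1
    exact det_one_add_submatrix (s := fun u => (L u).sites) (interaction L z) S
  rw [lbmConnected, connected_eq_cumulant, h, cumulant_prod_mul, cumulant_sum_powerset,
    connected_eq_cumulant]
  · exact blockMinors_empty _
  · simpa using hn

/-- The leading interaction factors through the coordinate vectors, and p_u Fᵀ(1 + B_u G_uu)⁻¹B_u F
= -M_u. The n minus signs and the sign (-1)^(n-1) of an n-cycle combine to the minus in front of the
traces. -/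
theorem neg_cyclicTraceSum_eq (hn : 2 ≤ n) (hp : ∀ u, (L u).bulkProb ≠ 0) :
    -cyclicTraceSum (fun u => (L u).M) (fun u => siteToComplex (z u)) =
      (∏ u, (L u).bulkProb) *
        connected (sectionMinors (s := fun u => (L u).sites) (interactionLead L z)) := by
  set N : Fin n → Fin n → Matrix (Fin 2) (Fin 2) ℝ := fun u v =>
    angularN (siteToComplex (z v) - siteToComplex (z u)) with hN
  have hK : ∀ u v (i : (L u).sites) (j : (L v).sites), interactionLead L z ⟨u, i⟩ ⟨v, j⟩ =
      ∑ α, ∑ β, ((L u).resolvent * (L u).position) i α * N u v α β * (L v).position j β := by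
    intro u v i j
    simp only [interactionLead, mixedLead_eq_angularN, siteToComplex_sub, Matrix.mul_apply, Finset.sum_mul,
      Finset.mul_sum]
    rw [Finset.sum_comm]
    refine Finset.sum_congr rfl fun α _ => ?_
    rw [Finset.sum_comm]
    refine Finset.sum_congr rfl fun β _ => Finset.sum_congr rfl fun k _ => ?_
    rw [hN, LocalBondModification.position, LocalBondModification.position]
    ring
  have hc := connected_eq_trace_sum hn (fun u v => -((L u).M * N u v))
    (fun S => (∏ u ∈ S, (L u).bulkProb) *
      sectionMinors (s := fun u => (L u).sites) (interactionLead L z) S) fun S => by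
    rw [sectionMinors_factor _ _ _ N hK, Finset.mul_sum]
    refine Finset.sum_congr rfl fun σ _ => ?_
    rw [mul_left_comm, Finset.mul_sum]
    congr 1
    refine Finset.sum_congr rfl fun b _ => ?_
    rw [← Finset.prod_coe_sort S fun u => (L u).bulkProb, ← Finset.prod_mul_distrib]
    refine Finset.prod_congr rfl fun u _ => ?_
    rw [← Matrix.neg_mul, ← (L u).bulkProb_smul_eq (hp u), Matrix.smul_mul, Matrix.smul_apply,
      smul_eq_mul]
  rw [connected_eq_cumulant, cumulant_prod_mul] at hc
  rw [connected_eq_cumulant, hc, cyclicTraceSum, Finset.mul_sum, Finset.mul_sum, Finset.mul_sum,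
    ← Finset.sum_neg_distrib]
  refine Finset.sum_congr rfl fun s _ => ?_
  have hl : (List.ofFn fun x => -((L (s x)).M * N (s x) (s (finRotate n x)))) =
      (List.ofFn fun x => (L (s x)).M * N (s x) (s (finRotate n x))).map Neg.neg := by
    rw [List.map_ofFn]
    rfl
  rw [hl, List.prod_map_neg, List.length_ofFn]
  have hneg : ((-1 : Matrix (Fin 2) (Fin 2) ℝ) ^ n) = ((-1 : ℝ) ^ n) • 1 := by
    rcases Nat.even_or_odd n with h | h <;> rw [h.neg_one_pow, h.neg_one_pow] <;> simp
  have hsign : (-1 : ℝ) ^ (n - 1) * (-1) ^ n = -1 := by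
    rw [← pow_add]
    exact Odd.neg_one_pow ⟨n - 1, by omega⟩
  rw [hneg, Matrix.smul_mul, Matrix.one_mul, Matrix.trace_smul, smul_eq_mul]
  linear_combination (-(1 / (n : ℝ)) * (List.ofFn fun x => (L (s x)).M *
    N (s x) (s (finRotate n x))).prod.trace) * hsign

end Interaction

/-! ### Orders of magnitude -/

section Orders

open Asymptotics

variable {X α : Type*} {l : Filter X} {ρ : X → ℝ}

theorem isBigO_prod_pow (t : Finset α) {f : α → X → ℝ} {e : α → ℕ}
    (hf : ∀ i ∈ t, f i =O[l] fun x => ρ x ^ e i) :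
    (fun x => ∏ i ∈ t, f i x) =O[l] fun x => ρ x ^ ∑ i ∈ t, e i := by
  classical
  induction t using Finset.induction_on with
  | empty => simpa using isBigO_refl (fun _ : X => (1 : ℝ)) l
  | insert i t hi ih =>
    simp only [Finset.prod_insert hi, Finset.sum_insert hi, pow_add]
    exact (hf i (Finset.mem_insert_self _ _)).mul
      (ih fun j hj => hf j (Finset.mem_insert_of_mem hj))

theorem isBigO_prod_sub_prod_pow (t : Finset α) {f g : α → X → ℝ} {e : α → ℕ}
    (hf : ∀ i ∈ t, f i =O[l] fun x => ρ x ^ e i) (hg : ∀ i ∈ t, g i =O[l] fun x => ρ x ^ e i)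
    (hfg : ∀ i ∈ t, (fun x => f i x - g i x) =O[l] fun x => ρ x ^ (e i + 1)) :
    (fun x => ∏ i ∈ t, f i x - ∏ i ∈ t, g i x) =O[l] fun x => ρ x ^ (∑ i ∈ t, e i + 1) := by
  classical
  induction t using Finset.induction_on with
  | empty => simpa using isBigO_zero _ _
  | insert i t hi ih =>
    have hft : ∀ j ∈ t, f j =O[l] fun x => ρ x ^ e j :=
      fun j hj => hf j (Finset.mem_insert_of_mem hj)
    have h1 := (hfg i (Finset.mem_insert_self _ _)).mul (isBigO_prod_pow t hft)
    have h2 := (hg i (Finset.mem_insert_self _ _)).mul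
      (ih hft (fun j hj => hg j (Finset.mem_insert_of_mem hj))
        fun j hj => hfg j (Finset.mem_insert_of_mem hj))
    have e1 : ∀ x, ρ x ^ (e i + 1) * ρ x ^ ∑ j ∈ t, e j = ρ x ^ (∑ j ∈ insert i t, e j + 1) :=
      fun x => by rw [Finset.sum_insert hi, ← pow_add]; congr 1; ring
    have e2 : ∀ x, ρ x ^ e i * ρ x ^ (∑ j ∈ t, e j + 1) = ρ x ^ (∑ j ∈ insert i t, e j + 1) :=
      fun x => by rw [Finset.sum_insert hi, ← pow_add, add_assoc]
    simp only [e1] at h1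
    simp only [e2] at h2
    refine (h1.add h2).congr_left fun x => ?_
    rw [Finset.prod_insert hi, Finset.prod_insert hi]
    ring

theorem isBigO_pow_of_le (hρ : ρ =O[l] fun _ => (1 : ℝ)) {j k : ℕ} (h : j ≤ k) :
    (fun x => ρ x ^ k) =O[l] fun x => ρ x ^ j := by
  obtain ⟨m, rfl⟩ := Nat.exists_eq_add_of_le h
  have := (isBigO_refl (fun x => ρ x ^ j) l).mul (hρ.pow m)
  simpa [pow_add] using this

section Determinants

variable {m : Type*} [Fintype m] [DecidableEq m] {K K' : X → Matrix m m ℝ}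

theorem isBigO_det (hK : ∀ i j, (fun x => K x i j) =O[l] fun x => ρ x ^ 2) :
    (fun x => (K x).det) =O[l] fun x => ρ x ^ (2 * Fintype.card m) := by
  simp only [Matrix.det_apply']
  refine IsBigO.fun_sum fun σ _ => IsBigO.const_mul_left ?_ _
  have := isBigO_prod_pow Finset.univ fun i _ => hK (σ i) i
  simpa [mul_comm] using this

theorem isBigO_det_sub_det (hK : ∀ i j, (fun x => K x i j) =O[l] fun x => ρ x ^ 2)
    (hK' : ∀ i j, (fun x => K' x i j) =O[l] fun x => ρ x ^ 2)
    (h : ∀ i j, (fun x => K x i j - K' x i j) =O[l] fun x => ρ x ^ 3) :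
    (fun x => (K x).det - (K' x).det) =O[l] fun x => ρ x ^ (2 * Fintype.card m + 1) := by
  simp only [Matrix.det_apply', ← Finset.sum_sub_distrib, ← mul_sub]
  refine IsBigO.fun_sum fun σ _ => IsBigO.const_mul_left ?_ _
  have := isBigO_prod_sub_prod_pow Finset.univ (fun i _ => hK (σ i) i) (fun i _ => hK' (σ i) i)
    fun i _ => h (σ i) i
  simpa [mul_comm] using this

end Determinants

section Blocks

variable {ι : Type*} [Fintype ι] [DecidableEq ι] {s : ι → Type*}
  [∀ u, Fintype (s u)] [∀ u, DecidableEq (s u)] {K K' : X → Matrix (Σ u, s u) (Σ u, s u) ℝ}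

theorem isBigO_blockMinors (hρ : ρ =O[l] fun _ => (1 : ℝ))
    (hK : ∀ i j, (fun x => K x i j) =O[l] fun x => ρ x ^ 2) (V : Finset ι) :
    (fun x => blockMinors (K x) V) =O[l] fun x => ρ x ^ (2 * V.card) := by
  refine IsBigO.fun_sum fun W hW => ?_
  have hc : V.card ≤ W.card := (Finset.mem_filter.1 hW).2 ▸ Finset.card_image_le
  have h := isBigO_det (m := W) fun i j => hK i j
  rw [Fintype.card_coe] at h
  exact h.trans (isBigO_pow_of_le hρ (by omega))

/-- An index set meeting exactly the blocks in V either has more than |V| elements, and then gains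
an extra ρ², or has one element in each block, and then replacing K by K' costs one factor ρ. -/
theorem isBigO_blockMinors_sub_sectionMinors (hρ : ρ =O[l] fun _ => (1 : ℝ))
    (hK : ∀ i j, (fun x => K x i j) =O[l] fun x => ρ x ^ 2)
    (hK' : ∀ i j, (fun x => K' x i j) =O[l] fun x => ρ x ^ 2)
    (h : ∀ i j, (fun x => K x i j - K' x i j) =O[l] fun x => ρ x ^ 3) (V : Finset ι) :
    (fun x => blockMinors (K x) V - sectionMinors (K' x) V) =O[l]
      fun x => ρ x ^ (2 * V.card + 1) := by
  have e : ∀ x, blockMinors (K x) V - sectionMinors (K' x) V =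
      ∑ W : Finset (Σ u, s u) with W.image Sigma.fst = V, (principalMinor (K x) W -
        if W.card = V.card then principalMinor (K' x) W else 0) := fun x => by
    rw [blockMinors, ← sum_principalMinor_eq_sectionMinors, Finset.sum_sub_distrib,
      ← Finset.filter_filter, Finset.sum_filter (fun W : Finset (Σ u, s u) => W.card = V.card)]
  simp only [e]
  refine IsBigO.fun_sum fun W hW => ?_
  have hc : V.card ≤ W.card := (Finset.mem_filter.1 hW).2 ▸ Finset.card_image_le
  by_cases hWV : W.card = V.card
  · have h := isBigO_det_sub_det (m := W) (fun i j => hK i j) (fun i j => hK' i j) fun i j => h i j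
    rw [Fintype.card_coe, hWV] at h
    simp only [if_pos hWV]
    exact h
  · have h := isBigO_det (m := W) fun i j => hK i j
    rw [Fintype.card_coe] at h
    simp only [if_neg hWV, sub_zero]
    exact h.trans (isBigO_pow_of_le hρ (by omega))

end Blocks

section Cumulants

variable {n : ℕ} {p q : X → Finset (Fin n) → ℝ}

theorem Finpartition.sum_two_mul_card (π : Finpartition (Finset.univ : Finset (Fin n))) :
    ∑ S ∈ π.parts, 2 * S.card = 2 * n := by
  rw [← Finset.mul_sum, π.sum_card_parts, Finset.card_univ, Fintype.card_fin]

theorem isBigO_connected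
    (hp : ∀ S, (fun x => p x S) =O[l] fun x => ρ x ^ (2 * S.card)) :
    (fun x => connected (p x)) =O[l] fun x => ρ x ^ (2 * n) := by
  refine IsBigO.fun_sum fun π _ => IsBigO.const_mul_left ?_ _
  have := isBigO_prod_pow π.parts fun S _ => hp S
  rwa [Finpartition.sum_two_mul_card] at this

theorem isBigO_connected_sub_connected
    (hp : ∀ S, (fun x => p x S) =O[l] fun x => ρ x ^ (2 * S.card))
    (hq : ∀ S, (fun x => q x S) =O[l] fun x => ρ x ^ (2 * S.card))
    (hpq : ∀ S, (fun x => p x S - q x S) =O[l] fun x => ρ x ^ (2 * S.card + 1)) :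
    (fun x => connected (p x) - connected (q x)) =O[l] fun x => ρ x ^ (2 * n + 1) := by
  simp only [connected, ← Finset.sum_sub_distrib, ← mul_sub]
  refine IsBigO.fun_sum fun π _ => IsBigO.const_mul_left ?_ _
  have := isBigO_prod_sub_prod_pow π.parts (fun S _ => hp S) (fun S _ => hq S) fun S _ => hpq S
  rwa [Finpartition.sum_two_mul_card] at this

end Cumulants

/-! ### Powers of the distance for well separated modifications. -/

section FarApart

variable {r : X → ℝ} {d : X → ℤ × ℤ} {c : ℝ}

theorem isBigO_norm_inv (hr : Tendsto r l atTop) (hc : 0 < c)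
    (hd : ∀ᶠ x in l, c * r x ≤ ‖siteToComplex (d x)‖) :
    (fun x => ‖siteToComplex (d x)‖⁻¹) =O[l] fun x => (r x)⁻¹ := by
  refine IsBigO.of_bound c⁻¹ ?_
  filter_upwards [hd, hr.eventually_gt_atTop 0] with x hx h0
  rw [norm_inv, norm_norm, norm_inv, Real.norm_of_nonneg h0.le, ← mul_inv]
  exact inv_anti₀ (by positivity) hx

theorem isBigO_mixedLead (hr : Tendsto r l atTop) (hc : 0 < c)
    (hd : ∀ᶠ x in l, c * r x ≤ ‖siteToComplex (d x)‖) (i j : ℤ × ℤ) :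
    (fun x => mixedLead (d x) i j) =O[l] fun x => (r x)⁻¹ ^ 2 := by
  refine IsBigO.trans ?_ ((isBigO_norm_inv hr hc hd).pow 2)
  simp only [mixedLead_eq_angularN]
  refine IsBigO.fun_sum fun a _ => IsBigO.fun_sum fun b _ => ?_
  have : (fun x => angularN (siteToComplex (d x)) a b) =O[l]
      fun x => ‖siteToComplex (d x)‖⁻¹ ^ 2 := by
    refine IsBigO.of_bound 1 (Eventually.of_forall fun x => ?_)
    have := abs_angularN_le (siteToComplex (d x)) a b
    simpa using this
  refine (this.const_mul_left (siteVec i a * siteVec j b)).congr_left fun x => ?_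
  ring

theorem isBigO_mixedDiff_sub (hr : Tendsto r l atTop) (hc : 0 < c)
    (hd : ∀ᶠ x in l, c * r x ≤ ‖siteToComplex (d x)‖) (i j : ℤ × ℤ) :
    (fun x => mixedDiff (d x) i j - mixedLead (d x) i j) =O[l] fun x => (r x)⁻¹ ^ 3 := by
  refine IsBigO.trans ?_ ((isBigO_norm_inv hr hc hd).pow 3)
  obtain ⟨C, R, -, -, h⟩ := exists_mixedDiff_bound i j
  refine IsBigO.of_bound C ?_
  filter_upwards [hd, (hr.const_mul_atTop hc).eventually_ge_atTop R] with x hx hR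
  have := h (d x) (hR.trans hx)
  simpa [div_eq_mul_inv] using this

variable {n : ℕ} (L : Fin n → LocalBondModification) {z : X → Fin n → ℤ × ℤ}

theorem isBigO_interactionLead (hr : Tendsto r l atTop)
    (hz : ∀ u v, u ≠ v → ∃ c : ℝ, 0 < c ∧
      ∀ᶠ x in l, c * r x ≤ ‖siteToComplex (z x v) - siteToComplex (z x u)‖) (a b) :
    (fun x => interactionLead L (z x) a b) =O[l] fun x => (r x)⁻¹ ^ 2 := by
  refine IsBigO.fun_sum fun k _ => IsBigO.const_mul_left ?_ _
  by_cases hab : a.1 = b.1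
  -- Within a block the displacement is 0 and the numerator of `mixedLead` vanishes, so the leading
  -- matrix has zero diagonal blocks just as `interaction` does.
  · have : ∀ x, mixedLead (z x b.1 - z x a.1) k b.2 = 0 := fun x => by
      simp [hab, mixedLead]
    simp only [this]
    exact isBigO_zero _ _
  · obtain ⟨c, hc, h⟩ := hz _ _ hab
    simp only [← siteToComplex_sub] at h
    exact isBigO_mixedLead hr hc h _ _

theorem isBigO_interaction_sub (hr : Tendsto r l atTop)
    (hz : ∀ u v, u ≠ v → ∃ c : ℝ, 0 < c ∧
      ∀ᶠ x in l, c * r x ≤ ‖siteToComplex (z x v) - siteToComplex (z x u)‖) (a b) :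
    (fun x => interaction L (z x) a b - interactionLead L (z x) a b) =O[l]
      fun x => (r x)⁻¹ ^ 3 := by
  by_cases hab : a.1 = b.1
  · have : ∀ x, interaction L (z x) a b - interactionLead L (z x) a b = 0 := fun x => by
      simp [hab, mixedLead, interaction, interactionLead]
    simp only [this]
    exact isBigO_zero _ _
  · simp only [interaction, if_neg hab, interactionLead, ← Finset.sum_sub_distrib, ← mul_sub]
    refine IsBigO.fun_sum fun k _ => IsBigO.const_mul_left ?_ _
    obtain ⟨c, hc, h⟩ := hz _ _ hab
    simp only [← siteToComplex_sub] at h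
    exact isBigO_mixedDiff_sub hr hc h _ _

/-- The connected correlations of modifications at mutual distances of order at least `r` are of
order `r⁻²ⁿ`, with the trace formula as the leading term. -/
theorem isBigO_lbmConnected (hn : 2 ≤ n) (hp : ∀ u, (L u).bulkProb ≠ 0) (hr : Tendsto r l atTop)
    (hz : ∀ u v, u ≠ v → ∃ c : ℝ, 0 < c ∧
      ∀ᶠ x in l, c * r x ≤ ‖siteToComplex (z x v) - siteToComplex (z x u)‖) :
    ((fun x => lbmConnected L (z x)) =O[l] fun x => (r x)⁻¹ ^ (2 * n)) ∧
    (fun x => lbmConnected L (z x) -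
      -cyclicTraceSum (fun u => (L u).M) (fun u => siteToComplex (z x u))) =O[l]
        fun x => (r x)⁻¹ ^ (2 * n + 1) := by
  have hρ : (fun x => (r x)⁻¹) =O[l] fun _ => (1 : ℝ) :=
    (tendsto_inv_atTop_zero.comp hr).isBigO_one ℝ
  have h1 := isBigO_interactionLead L hr hz
  have h2 := isBigO_interaction_sub L hr hz
  have h3 : ∀ a b, (fun x => interaction L (z x) a b) =O[l] fun x => (r x)⁻¹ ^ 2 := fun a b =>
    (((h2 a b).trans (isBigO_pow_of_le hρ (by norm_num))).add (h1 a b)).congr_left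
      fun x => sub_add_cancel _ _
  have h4 := isBigO_blockMinors (s := fun u => (L u).sites) hρ h3
  have h5 := isBigO_blockMinors_sub_sectionMinors (s := fun u => (L u).sites) hρ h3 h1 h2
  have h6 : ∀ S, (fun x => sectionMinors (s := fun u => (L u).sites) (interactionLead L (z x)) S)
      =O[l] fun x => (r x)⁻¹ ^ (2 * S.card) := fun S =>
    ((h4 S).sub ((h5 S).trans (isBigO_pow_of_le hρ (Nat.le_succ _)))).congr_left
      fun x => sub_sub_cancel _ _
  simp only [lbmConnected_eq L _ hn hp, neg_cyclicTraceSum_eq L _ hn hp, ← mul_sub]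
  exact ⟨(isBigO_connected h4).const_mul_left _,
    (isBigO_connected_sub_connected h4 h6 h5).const_mul_left _⟩

end FarApart

end Orders

/-! ### The scaling limit -/

section ScalingLimit

variable {n : ℕ} (M : Fin n → Matrix (Fin 2) (Fin 2) ℝ)

theorem angularN_real_smul {c : ℝ} (d : ℂ) : angularN (c * d) = (c ^ 2)⁻¹ • angularN d := by
  rcases eq_or_ne c 0 with rfl | hc
  · ext i j
    simp [angularN]
  rw [angularN_eq, angularN_eq]
  ext i j
  fin_cases i <;> fin_cases j <;> simp <;> field_simp

theorem cyclicTraceSum_eq_sum (hn : 2 ≤ n) (w : Fin n → ℂ) : cyclicTraceSum M w =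
    (1 / (n : ℝ)) * ∑ s : Equiv.Perm (Fin n), ∑ a : Fin n → Fin 2, ∏ x,
      (M (s x) * angularN (w (s (finRotate n x)) - w (s x))) (a x) (a (finRotate n x)) := by
  rw [cyclicTraceSum]
  congr 1
  exact Finset.sum_congr rfl fun s _ => trace_prod_ofFn (by omega) _

theorem cyclicTraceSum_smul (hn : 2 ≤ n) (w : Fin n → ℂ) (c : ℝ) :
    cyclicTraceSum M (fun u => c * w u) = (c ^ (2 * n))⁻¹ * cyclicTraceSum M w := by
  rw [cyclicTraceSum_eq_sum M hn, cyclicTraceSum_eq_sum M hn, mul_left_comm]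
  congr 1
  simp only [Finset.mul_sum]
  refine Finset.sum_congr rfl fun s _ => Finset.sum_congr rfl fun a _ => ?_
  simp only [← mul_sub, angularN_real_smul, Matrix.mul_smul, Matrix.smul_apply, smul_eq_mul,
    Finset.prod_mul_distrib, Finset.prod_const, Finset.card_univ, Fintype.card_fin]
  rw [inv_pow, pow_mul]

theorem continuousAt_angularN {d : ℂ} (hd : d ≠ 0) (a b : Fin 2) :
    ContinuousAt (fun d => angularN d a b) d := by
  have h : (d.re ^ 2 + d.im ^ 2) ^ 2 ≠ 0 := by
    have := Complex.normSq_pos.2 hd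
    rw [Complex.normSq_apply] at this
    exact (pow_pos (by nlinarith) 2).ne'
  have hre := Complex.continuous_re
  have him := Complex.continuous_im
  simp only [angularN_eq, Matrix.smul_apply, smul_eq_mul]
  refine continuousAt_const.mul ?_
  fin_cases a <;> fin_cases b <;> simp <;> fun_prop (disch := exact h)

theorem continuousAt_cyclicTraceSum (hn : 2 ≤ n) {w : Fin n → ℂ} (hw : Function.Injective w) :
    ContinuousAt (cyclicTraceSum M) w := by
  rw [show cyclicTraceSum M = _ from funext (cyclicTraceSum_eq_sum M hn)]
  refine continuousAt_const.mul (tendsto_finsetSum _ fun s _ => tendsto_finsetSum _ fun a _ =>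
    tendsto_finsetProd _ fun x _ => ?_)
  simp only [Matrix.mul_apply]
  refine tendsto_finsetSum _ fun b _ => tendsto_const_nhds.mul ?_
  have hne : w (s (finRotate n x)) - w (s x) ≠ 0 :=
    sub_ne_zero.2 fun h => finRotate_ne_self hn x (s.injective (hw h))
  exact ContinuousAt.comp (f := fun w : Fin n → ℂ => w (s (finRotate n x)) - w (s x))
    (continuousAt_angularN hne _ _) (by fun_prop)

/-- The scaling limit of the connected correlations. -/
theorem tendsto_mul_lbmConnected (hn : 2 ≤ n) (L : Fin n → LocalBondModification)
    (hp : ∀ u, (L u).bulkProb ≠ 0) {w : Fin n → ℂ} {r : ℕ → ℝ} {z : ℕ → Fin n → ℤ × ℤ}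
    (hw : Function.Injective w) (hr : Tendsto r atTop atTop)
    (hz : ∀ u, Tendsto (fun m => siteToComplex (z m u) / (r m : ℂ)) atTop (𝓝 (w u))) :
    Tendsto (fun m => r m ^ (2 * n) * lbmConnected L (z m)) atTop
      (𝓝 (-cyclicTraceSum (fun u => (L u).M) w)) := by
  have hfar : ∀ u v, u ≠ v → ∃ c : ℝ, 0 < c ∧ ∀ᶠ m in atTop,
      c * r m ≤ ‖siteToComplex (z m v) - siteToComplex (z m u)‖ := by
    intro u v huv
    have hpos : 0 < ‖w v - w u‖ := norm_pos_iff.2 (sub_ne_zero.2 fun h => huv (hw h).symm)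
    refine ⟨‖w v - w u‖ / 2, by positivity, ?_⟩
    filter_upwards [((hz v).sub (hz u)).norm.eventually_const_le (half_lt_self hpos),
      hr.eventually_gt_atTop 0] with m hm h0
    rwa [← sub_div, norm_div, Complex.norm_real, Real.norm_of_nonneg h0.le, le_div_iff₀ h0] at hm
  obtain ⟨-, hO⟩ := isBigO_lbmConnected L hn hp hr hfar
  have herr : Tendsto (fun m => r m ^ (2 * n) * (lbmConnected L (z m) -
      -cyclicTraceSum (fun u => (L u).M) fun u => siteToComplex (z m u))) atTop (𝓝 0) := by
    have h1 := (Asymptotics.isBigO_refl (fun m => r m ^ (2 * n)) atTop).mul hO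
    refine Asymptotics.IsBigO.trans_tendsto h1 ?_
    refine (tendsto_inv_atTop_zero.comp hr).congr' ?_
    filter_upwards [hr.eventually_gt_atTop 0] with m h0
    rw [Function.comp_apply, pow_succ, ← mul_assoc, inv_pow, mul_inv_cancel₀ (by positivity),
      one_mul]
  -- Homogeneity absorbs r^(2n) into the rescaled positions z/r, which converge to distinct points
  -- where the traces are continuous.
  have hmain : Tendsto (fun m => r m ^ (2 * n) *
      -cyclicTraceSum (fun u => (L u).M) fun u => siteToComplex (z m u)) atTop
      (𝓝 (-cyclicTraceSum (fun u => (L u).M) w)) := by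
    have h1 := ((continuousAt_cyclicTraceSum (fun u => (L u).M) hn hw).tendsto.comp
      (tendsto_pi_nhds.2 hz)).neg
    refine h1.congr' ?_
    filter_upwards [hr.eventually_gt_atTop 0] with m h0
    have := cyclicTraceSum_smul (fun u => (L u).M) hn (fun u => siteToComplex (z m u)) (r m)⁻¹
    rw [inv_pow, inv_inv] at this
    rw [mul_neg, ← this, Function.comp_apply]
    congr 3
    funext u
    push_cast
    ring
  have := herr.add hmain
  rw [zero_add] at this
  exact this.congr fun m => by ring

/-- The bounds of `isBigO_lbmConnected`, uniformly in the positions. -/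
theorem exists_lbmConnected_bound (hn : 2 ≤ n) (L : Fin n → LocalBondModification)
    (hp : ∀ u, (L u).bulkProb ≠ 0) {a : ℝ} (ha : 0 < a) :
    ∃ C R : ℝ, 0 < R ∧ ∀ r : ℝ, R ≤ r → ∀ z : Fin n → ℤ × ℤ,
      (∀ u v, u ≠ v → a * r ≤ ‖siteToComplex (z v) - siteToComplex (z u)‖) →
      |lbmConnected L z| ≤ C / r ^ (2 * n) ∧
      |lbmConnected L z -
          -cyclicTraceSum (fun u => (L u).M) (fun u => siteToComplex (z u))|
        ≤ C / r ^ (2 * n + 1) := by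
  -- The filter lives on pairs (r, z): r tends to infinity while z ranges over all configurations
  -- with separations at least a·r. A bound along it is therefore uniform in the positions.
  set l : Filter (ℝ × (Fin n → ℤ × ℤ)) := comap Prod.fst atTop ⊓ 𝓟 {x | ∀ u v, u ≠ v →
    a * x.1 ≤ ‖siteToComplex (x.2 v) - siteToComplex (x.2 u)‖} with hl
  have hr : Tendsto Prod.fst l atTop := tendsto_comap.mono_left inf_le_left
  obtain ⟨h1, h2⟩ := isBigO_lbmConnected L (z := Prod.snd) hn hp hr fun u v huv =>
    ⟨a, ha, mem_inf_of_right fun x (hx : ∀ u v, u ≠ v → _) => hx u v huv⟩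
  obtain ⟨C₁, hC₁⟩ := h1.bound
  obtain ⟨C₂, hC₂⟩ := h2.bound
  have hev := hC₁.and hC₂
  rw [hl, eventually_inf_principal, eventually_comap, eventually_atTop] at hev
  obtain ⟨R, hR⟩ := hev
  refine ⟨max C₁ C₂, max R 1, by positivity, fun r hrR z hz => ?_⟩
  have h0 : 0 < r := lt_of_lt_of_le (by positivity) hrR
  obtain ⟨b1, b2⟩ := hR r ((le_max_left _ _).trans hrR) (r, z) rfl hz
  simp only [Real.norm_eq_abs, inv_pow, abs_inv, abs_of_pos (pow_pos h0 _),
    ← div_eq_mul_inv] at b1 b2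
  exact ⟨b1.trans (by gcongr; exact le_max_left _ _), b2.trans (by gcongr; exact le_max_right _ _)⟩

end ScalingLimit

/-- The connected correlations of `n ≥ 2` local bond modifications of the critical sandpile:
infinite-volume limit, trace formula, identification with the `c = -2` fields, and scaling
dimension two. -/
theorem mainTheorem1 {n : ℕ} (hn : 2 ≤ n) (L : Fin n → LocalBondModification)
    (hp : ∀ u, (L u).bulkProb ≠ 0) :
    -- `det Δ' / det Δ` in a large box converges to `det (1 + B G)`
    (∀ (z : Fin n → ℤ × ℤ) (S : Finset (Fin n)),
      Tendsto (fun N : ℕ => boxDet (modifiedToppling L z S) N / boxDet topplingMatrix N)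
        atTop (𝓝 (lbmCorrelation L z S))) ∧
    -- order `r^{-2n}`, and the trace formula for the leading term
    (∀ a b : ℝ, 0 < a → a ≤ b → ∃ C R : ℝ, 0 < R ∧ ∀ r : ℝ, R ≤ r → ∀ z : Fin n → ℤ × ℤ,
      (∀ u v, u ≠ v → a * r ≤ ‖siteToComplex (z v) - siteToComplex (z u)‖ ∧
        ‖siteToComplex (z v) - siteToComplex (z u)‖ ≤ b * r) →
      |lbmConnected L z| ≤ C / r ^ (2 * n) ∧
      |lbmConnected L z -
          -cyclicTraceSum (fun u => (L u).M) (fun u => siteToComplex (z u))|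
        ≤ C / r ^ (2 * n + 1)) ∧
    -- the traces are the connected correlation of the fields `φ_u`
    (∀ w : Fin n → ℂ, Function.Injective w →
      ((-cyclicTraceSum (fun u => (L u).M) w : ℝ) : ℂ) =
        lcftConnected (fun u => (L u).field) w) ∧
    -- the fields `φ_u` have scaling dimension two
    (∀ (w : Fin n → ℂ) (S : Finset (Fin n)) (c : ℝ), Function.Injective w → 0 < c →
      lcftCorrelation (fun u => (L u).field) (fun u => (c : ℂ) * w u) S =
        lcftCorrelation (fun u => (L u).field) w S / (c : ℂ) ^ (2 * S.card)) ∧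
    -- the scaling limit, with a factor `r²` for each modification
    (∀ (w : Fin n → ℂ) (r : ℕ → ℝ) (z : ℕ → Fin n → ℤ × ℤ), Function.Injective w →
      Tendsto r atTop atTop →
      (∀ u, Tendsto (fun m => siteToComplex (z m u) / (r m : ℂ)) atTop (𝓝 (w u))) →
      Tendsto (fun m => ((r m ^ (2 * n) * lbmConnected L (z m) : ℝ) : ℂ)) atTop
        (𝓝 (lcftConnected (fun u => (L u).field) w))) := by
  refine ⟨fun z S => tendsto_boxDet_div z, fun a b ha _ => ?_,
    fun w hw => cyclicTraceSum_eq_lcftConnected hn L w hw,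
    fun w S c _ _ => lcftCorrelation_smul _ w S c, fun w r z hw hr hz => ?_⟩
  · obtain ⟨C, R, hR, h⟩ := exists_lbmConnected_bound hn L hp ha
    exact ⟨C, R, hR, fun r hr z hz => h r hr z fun u v huv => (hz u v huv).1⟩
  · rw [← cyclicTraceSum_eq_lcftConnected hn L w hw]
    exact (Complex.continuous_ofReal.tendsto _).comp (tendsto_mul_lbmConnected hn L hp hw hr hz)
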